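/- **Conventions.** Lines and planes in $\mathbb{R}^3$ (coordinates $x,y,z$) parallel to the $z$-axis are called isotropic. A *general isotropic similarity* is a map $\mathbf{x}\mapsto A\mathbf{x}+\mathbf{t}$ with $$A=\begin{pmatrix} h_1&-h_2&0\\ h_2&h_1&0\\ c_1&c_2&c_3\end{pmatrix},\qquad (h_1,h_2)\neq(0,0),\quad c_3\ne 0 .$$ A set is *isotropic similar* to a subset of $S\subset\mathbb{R}^3$ if some general isotropic similarity maps it into $S$. Let $I,J\subset\mathbb{R}$ be intervals with nonempty interior (endpoints may be included; derivatives there are one-sided), and let $\alpha:I\to\mathbb{R}^3$, $\beta:J\to\mathbb{R}^3$ be $C^3$ curves. The *translational surface* formed by $\alpha$ and $\beta$ is $r(u,v)=\alpha(u)+\beta(v)$, $(u,v)\in I\times J$ (self-intersections are allowed). It is *admissible* if at each point its differential is nondegenerate and its tangent plane is non-isotropic; then it is locally a graph $z=f(x,y)$, and its *isotropic principal curvatures* $\kappa_1,\kappa_2$ are the eigenvalues of the Hessian of $f$. It *has a constant ratio $a\ne 0$ of isotropic principal curvatures* if $\kappa_1/\kappa_2=a$ or $\kappa_2/\kappa_1=a$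 at each point. A curve is *planar* if it is contained in a plane. **Theorem.** Let $a\in\mathbb{R}$, $a\neq 0$. An admissible translational surface formed by a planar curve $\alpha$ and another curve $\beta$ has a constant ratio $a$ of isotropic principal curvatures if and only if it is isotropic similar to a subset of one of the following surfaces: 1. the paraboloid $r_a(u,v)=(u,\;v,\;v^2+au^2)$, $(u,v)\in\mathbb{R}^2$; 2. if $a\neq 1$, with $b:=(a+1)/(a-1)$: the surface $$r_b(u,v)=\bigl(v+b\cos v,\;\; b\sin v+(b^2-1)\log|b-\sin v|+(1-b^2)u,\;\; \exp u\bigr),$$ where $u$ runs through $\mathbb{R}$ and $v$ runs through some interval on which $\sin v\neq b$ (if $a<0$), respectively $b\sin v\ne 1$ (if $a>0$); 3. if $a=-1$: the surface $$r(u,v)=\bigl(u+v,\;\;\log|\cos u|-\log|\cos v|,\;\;u\bigr),\qquad (u,v)\in(-\pi/2,\pi/2)^2,\ u+v\ne 0 .$$ In particular, if such a surface has a constant ratio $a\ne 0$ of isotropic principal curvatures, then $\beta$ is a planar curve as well. -/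

import Mathlib

open Topology

namespace IsotropicGeometry

/-- The top view: the projection of space along the vertical `z`-axis onto the `xy`-plane. -/
def topView (p : Fin 3 → ℝ) : Fin 2 → ℝ := ![p 0, p 1]

/-- The translational surface `r(u,v) = α(u) + β(v)` formed by two curves. -/
def translational (α β : ℝ → Fin 3 → ℝ) : ℝ × ℝ → Fin 3 → ℝ :=
  fun q => α q.1 + β q.2

/-- The parametrized surface `r`, defined on `D`, has a nondegenerate differential at each point
of `D`, and its tangent plane there (the range of the differential) is not parallel to the
`z`-axis. One-sided derivatives are used at the boundary points of `D`. -/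
def IsAdmissible (r : ℝ × ℝ → Fin 3 → ℝ) (D : Set (ℝ × ℝ)) : Prop :=
  ∀ q ∈ D, Function.Injective (fderivWithin ℝ r D q) ∧
    (![0, 0, 1] : Fin 3 → ℝ) ∉ Set.range (fderivWithin ℝ r D q)

/-- Near the parameter `q`, the surface `r : D → ℝ³` lies on the graph `z = f(x,y)`, where `f` is
twice continuously differentiable in a neighbourhood of the top view of `r q`. -/
def IsLocalGraphAt (r : ℝ × ℝ → Fin 3 → ℝ) (D : Set (ℝ × ℝ)) (q : ℝ × ℝ)
    (f : (Fin 2 → ℝ) → ℝ) : Prop :=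
  ContDiffAt ℝ 2 f (topView (r q)) ∧ ∀ᶠ w in 𝓝[D] q, r w 2 = f (topView (r w))

/-- The isotropic shape operator of the graph of `f`: the Hessian matrix of `f`. -/
noncomputable def shapeOperator (f : (Fin 2 → ℝ) → ℝ) (p : Fin 2 → ℝ) :
    Matrix (Fin 2) (Fin 2) ℝ :=
  Matrix.of fun i j => fderiv ℝ (fderiv ℝ f) p (Pi.single i 1) (Pi.single j 1)

/-- `κ₁, κ₂` are the isotropic principal curvatures of the surface at the parameter `q`: the
eigenvalues, with multiplicity, of the isotropic shape operator. -/
def HasPrincipalCurvaturesAt (r : ℝ × ℝ → Fin 3 → ℝ) (D : Set (ℝ × ℝ)) (q : ℝ × ℝ)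
    (κ₁ κ₂ : ℝ) : Prop :=
  ∃ f : (Fin 2 → ℝ) → ℝ, IsLocalGraphAt r D q f ∧
    (shapeOperator f (topView (r q))).charpoly =
      (Polynomial.X - Polynomial.C κ₁) * (Polynomial.X - Polynomial.C κ₂)

/-- The surface has a constant ratio `a` of isotropic principal curvatures (used for `a ≠ 0`,
so that neither curvature vanishes). -/
def HasConstantRatio (r : ℝ × ℝ → Fin 3 → ℝ) (D : Set (ℝ × ℝ)) (a : ℝ) : Prop :=
  ∀ q ∈ D, ∃ κ₁ κ₂ : ℝ, HasPrincipalCurvaturesAt r D q κ₁ κ₂ ∧ (κ₁ / κ₂ = a ∨ κ₂ / κ₁ = a)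

/-- General isotropic similarities (elements of the 8-parametric group). -/
def IsSimilarity (T : (Fin 3 → ℝ) → (Fin 3 → ℝ)) : Prop :=
  ∃ (h₁ h₂ c₁ c₂ c₃ : ℝ) (t : Fin 3 → ℝ), (h₁ ≠ 0 ∨ h₂ ≠ 0) ∧ c₃ ≠ 0 ∧
    ∀ p, T p = Matrix.mulVec !![h₁, -h₂, 0; h₂, h₁, 0; c₁, c₂, c₃] p + t

/-- `M` is isotropic similar to a subset of `S`. -/
def SimilarToSubset (M S : Set (Fin 3 → ℝ)) : Prop :=
  ∃ T : (Fin 3 → ℝ) → (Fin 3 → ℝ), IsSimilarity T ∧ T '' M ⊆ S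

/-- The paraboloid `z = v² + a u²`. -/
def paraboloid (a : ℝ) : Set (Fin 3 → ℝ) :=
  Set.range fun q : ℝ × ℝ => ![q.1, q.2, q.2 ^ 2 + a * q.1 ^ 2]

/-- The map `r_b`. -/
noncomputable def expMap (b : ℝ) : ℝ × ℝ → Fin 3 → ℝ := fun q =>
  ![q.2 + b * Real.cos q.2,
    b * Real.sin q.2 + (b ^ 2 - 1) * Real.log |b - Real.sin q.2| + (1 - b ^ 2) * q.1,
    Real.exp q.1]

/-- The surface `r_b` with `u` running through `ℝ` and `v` through the set `J`. -/
noncomputable def expSurface (b : ℝ) (J : Set ℝ) : Set (Fin 3 → ℝ) :=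
  expMap b '' (Set.univ ×ˢ J)

/-- `J` is an interval allowed as the range of `v` in the surface `r_b`, `b = (a+1)/(a-1)`. -/
def IsParameterInterval (a b : ℝ) (J : Set ℝ) : Prop :=
  J.OrdConnected ∧ ∀ v ∈ J, (a < 0 → Real.sin v ≠ b) ∧ (0 < a → b * Real.sin v ≠ 1)

/-- The surface `(u + v, log |cos u| - log |cos v|, u)` over the open square
`(-π/2, π/2)²` without the line `u + v = 0`, where its tangent planes are vertical. -/
noncomputable def logCosSurface : Set (Fin 3 → ℝ) :=
  (fun q : ℝ × ℝ => ![q.1 + q.2, Real.log |Real.cos q.1| - Real.log |Real.cos q.2|, q.1]) ''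
    {q | q.1 ∈ Set.Ioo (-(Real.pi / 2)) (Real.pi / 2) ∧
      q.2 ∈ Set.Ioo (-(Real.pi / 2)) (Real.pi / 2) ∧ q.1 + q.2 ≠ 0}

end IsotropicGeometry

/-!
The tangents `p` of `α` and `q` of `β` are conjugate directions of the translational surface,
because its mixed second derivative vanishes. If the surface is locally the graph of `f`, then the
gradient of `f` is determined by `p` and `q`, and the values `A` and `B` of the Hessian of `f` on
`p` and `q` are determined by the second derivatives of the curves
(`hessian_of_isLocalGraphAt`). In a conjugate basis the determinant of the Hessian is `A B / D²` and
its trace is `(A |q|² + B |p|²) / D²` with `D = det (p, q)`, so that the ratio `a` of the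
eigenvalues means `a (A |q|² + B |p|²)² = (a + 1)² A B D²` (`RatioAt`). This condition is invariant
under similarities and under the exchange of the two curves. There are two cases.

*The plane of `α` is isotropic.* After a rotation `α = (x, y₀, z(x))` and `β = (X(y), y, Z(y))`.
The ratio condition becomes a quadratic equation for the quotient `s = (Z'' - z' X'') / z''` whose
coefficients depend on `y` only. By continuity and connectedness `s` depends on `y` only. If
`X'' = 0`, then `z''` and `Z''` are constant, and the surface is a paraboloid. Otherwise
`z'' = l - m z'` with constants `l` and `m ≠ 0`, so `z` is an exponential function, and
`X'' = m s`, `Z'' = l s`, while `s` satisfies a quadratic equation with coefficients depending on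
`X'`. With `s = (b² - 1) k²` this equation becomes `1 + X'² + (b² - 1) k² = 2 b k`, which says that
`(X' / k, b - 1 / k)` lies on the unit circle. The polar angle of this point is the parameter of the
profile curve of `r_b` (`exists_angle`).

*The plane of `α` is not isotropic.* After a shear it is horizontal, and `β` can be described by the
derivatives `Q`, `R` of its top view with respect to `z`. For `a ≠ -1` the ratio condition and its
derivative along `β` are two equations for the curvature of `α`. Eliminating it gives, for each
point of `β`, a homogeneous quartic equation for the direction of the tangent of `α`
(`eliminate_curvature`). This direction takes infinitely many values, hence the coefficients vanish,
and they force the curvature of the top view of `β` to vanish. So `β` lies in an isotropic plane,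
and the first case applies to the exchanged curves. For `a = -1` the ratio condition is the
vanishing of the trace. It separates the variables and gives `R = |Q|² m` with a constant vector
`m`, and both curves can be integrated: in the coordinates given by `m` their top views are graphs
of `±log |cos|` (or `β` lies in an isotropic plane).

Conversely, each listed surface is locally a graph whose Hessian can be computed, and the relation
between its trace and its determinant is preserved by similarities (`hasConstantRatio_of_graph`).
-/

namespace IsotropicGeometry

/-! ### Calculus on intervals -/

theorem eq_of_hasDerivWithinAt_zero {J : Set ℝ} (hJ : J.OrdConnected) {f : ℝ → ℝ}
    (hf : ∀ v ∈ J, HasDerivWithinAt f 0 J v) {u v : ℝ} (hu : u ∈ J) (hv : v ∈ J) : f u = f v := by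
  have h := hJ.convex.norm_image_sub_le_of_norm_hasDerivWithin_le (C := 0)
    (f' := fun _ => (0 : ℝ)) hf (fun _ _ => by simp) hv hu
  simpa [sub_eq_zero] using h

theorem exists_eq_add_of_hasDerivWithinAt {J : Set ℝ} (hJ : J.OrdConnected) {f g f' : ℝ → ℝ}
    (hf : ∀ v ∈ J, HasDerivWithinAt f (f' v) J v) (hg : ∀ v ∈ J, HasDerivWithinAt g (f' v) J v) :
    ∃ c, ∀ v ∈ J, f v = g v + c := by
  rcases J.eq_empty_or_nonempty with rfl | ⟨v₀, hv₀⟩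
  · exact ⟨0, by simp⟩
  · refine ⟨f v₀ - g v₀, fun v hv => ?_⟩
    have := eq_of_hasDerivWithinAt_zero hJ (f := fun x => f x - g x)
      (fun x hx => ((hf x hx).sub (hg x hx)).congr_deriv (sub_self _)) hv hv₀
    linarith

theorem injOn_of_hasDerivWithinAt_ne_zero {J : Set ℝ} (hJ : J.OrdConnected) {f f' : ℝ → ℝ}
    (hf : ∀ v ∈ J, HasDerivWithinAt f (f' v) J v) (h0 : ∀ v ∈ J, f' v ≠ 0) : Set.InjOn f J := by
  have key : ∀ u ∈ J, ∀ v ∈ J, u < v → f u ≠ f v := by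
    intro u hu v hv huv heq
    have hsub : Set.Icc u v ⊆ J := hJ.out hu hv
    obtain ⟨c, hc, hc0⟩ := exists_hasDerivAt_eq_zero (f := f) (f' := f') huv
      (fun x hx => ((hf x (hsub hx)).continuousWithinAt).mono hsub) heq
      (fun x hx => (hf x (hsub (Set.Ioo_subset_Icc_self hx))).hasDerivAt
        (Filter.mem_of_superset (Icc_mem_nhds hx.1 hx.2) hsub))
    exact h0 c (hsub (Set.Ioo_subset_Icc_self hc)) hc0
  intro u hu v hv huv
  rcases lt_trichotomy u v with h | h | h
  · exact absurd huv (key u hu v hv h)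
  · exact h
  · exact absurd huv.symm (key v hv u hu h)

theorem nontrivial_of_interior_nonempty {J : Set ℝ} (hJ : (interior J).Nonempty) :
    J.Nontrivial := by
  obtain ⟨x, hx⟩ := hJ
  rw [mem_interior_iff_mem_nhds, Metric.mem_nhds_iff] at hx
  obtain ⟨ε, hε, h⟩ := hx
  refine ⟨x, h (by simpa using hε), x + ε / 2, h ?_, by linarith⟩
  simpa [abs_of_pos hε] using hε

theorem infinite_of_interior_nonempty {J : Set ℝ} (hJ : (interior J).Nonempty) :
    J.Infinite := by
  obtain ⟨x, hx⟩ := hJ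
  exact infinite_of_mem_nhds x (mem_interior_iff_mem_nhds.1 hx)

/-- A continuous function on an interval whose values are roots of one fixed quadratic polynomial
is constant. -/
theorem eq_of_continuousOn_of_quadratic {J : Set ℝ} (hJ : J.OrdConnected) {f : ℝ → ℝ}
    (hf : ContinuousOn f J) {a b c : ℝ} (ha : a ≠ 0)
    (h : ∀ v ∈ J, a * f v ^ 2 + b * f v + c = 0) {u v : ℝ} (hu : u ∈ J) (hv : v ∈ J) :
    f u = f v := by
  set T : Set ℝ := {x | a * x ^ 2 + b * x + c = 0} with hT
  have hfin : T.Finite := by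
    let p : Polynomial ℝ := Polynomial.C a * Polynomial.X ^ 2 + Polynomial.C b * Polynomial.X
      + Polynomial.C c
    have hp : p ≠ 0 := by
      intro h0
      have := Polynomial.natDegree_quadratic (b := b) (c := c) ha
      change p.natDegree = 2 at this
      simp [h0] at this
    refine (Polynomial.finite_setOfPred_isRoot hp).subset fun x hx => ?_
    have hx' : a * x ^ 2 + b * x + c = 0 := hx
    simpa [p, Polynomial.IsRoot.def] using hx'
  exact hJ.isPreconnected.constant_of_mapsTo hfin.isDiscrete hf (fun v hv => h v hv) hu hv

/-- A polynomial of degree at most four with infinitely many zeros has zero coefficients. -/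
theorem quartic_coeff_eq_zero {S : Set ℝ} (hS : S.Infinite) {c₀ c₁ c₂ c₃ c₄ : ℝ}
    (h : ∀ t ∈ S, c₀ + c₁ * t + c₂ * t ^ 2 + c₃ * t ^ 3 + c₄ * t ^ 4 = 0) :
    c₀ = 0 ∧ c₁ = 0 ∧ c₂ = 0 ∧ c₃ = 0 ∧ c₄ = 0 := by
  let p : Polynomial ℝ := Polynomial.C c₀ + Polynomial.C c₁ * Polynomial.X
    + Polynomial.C c₂ * Polynomial.X ^ 2 + Polynomial.C c₃ * Polynomial.X ^ 3
    + Polynomial.C c₄ * Polynomial.X ^ 4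
  have hp : p = 0 := Polynomial.eq_zero_of_infinite_isRoot p
    (hS.mono fun t ht => by simpa [p, Polynomial.IsRoot.def] using h t ht)
  have hc : ∀ n, p.coeff n = 0 := fun n => by simp [hp]
  refine ⟨?_, ?_, ?_, ?_, ?_⟩
  · simpa [p, Polynomial.coeff_X, Polynomial.coeff_X_pow, Polynomial.coeff_C] using hc 0
  · simpa [p, Polynomial.coeff_X, Polynomial.coeff_X_pow, Polynomial.coeff_C] using hc 1
  · simpa [p, Polynomial.coeff_X, Polynomial.coeff_X_pow, Polynomial.coeff_C] using hc 2
  · simpa [p, Polynomial.coeff_X, Polynomial.coeff_X_pow, Polynomial.coeff_C] using hc 3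
  · simpa [p, Polynomial.coeff_X, Polynomial.coeff_X_pow, Polynomial.coeff_C] using hc 4

/-! ### The ratio condition in terms of the two curves -/

/-- The determinant of the top views of two vectors. -/
def topDet (p q : Fin 3 → ℝ) : ℝ := p 0 * q 1 - p 1 * q 0

/-- The squared length of the top view of a vector. -/
def topNormSq (p : Fin 3 → ℝ) : ℝ := p 0 ^ 2 + p 1 ^ 2

/-- `γ₁` and `γ₂` are the first two derivatives of the curve `γ` on `J`, and the second derivative
is differentiable once more. -/
structure HasSecondJet (J : Set ℝ) (γ γ₁ γ₂ : ℝ → Fin 3 → ℝ) : Prop where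
  deriv₁ : ∀ v ∈ J, HasDerivWithinAt γ (γ₁ v) J v
  deriv₂ : ∀ v ∈ J, HasDerivWithinAt γ₁ (γ₂ v) J v
  diff : DifferentiableOn ℝ γ₂ J

/-- The condition on the first two derivatives `p, p'` and `q, q'` of two curves which says that
their translational surface has the ratio `a` of principal curvatures. Here `(g₀, g₁)` is the
gradient of the function whose graph is the surface, and `A`, `B` are the values of its Hessian on
the top views of `p` and `q`, which are conjugate directions. -/
def RatioAt (a : ℝ) (p p' q q' : Fin 3 → ℝ) : Prop :=
  topDet p q ≠ 0 ∧ ∃ g₀ g₁ A B : ℝ, g₀ * p 0 + g₁ * p 1 = p 2 ∧ g₀ * q 0 + g₁ * q 1 = q 2 ∧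
    A = p' 2 - g₀ * p' 0 - g₁ * p' 1 ∧ B = q' 2 - g₀ * q' 0 - g₁ * q' 1 ∧ A ≠ 0 ∧ B ≠ 0 ∧
    a * (A * topNormSq q + B * topNormSq p) ^ 2 = (a + 1) ^ 2 * A * B * topDet p q ^ 2

/-- Two curves on nondegenerate intervals which satisfy the ratio condition everywhere. -/
structure RatioPair (a : ℝ) (I J : Set ℝ) (α α₁ α₂ β β₁ β₂ : ℝ → Fin 3 → ℝ) : Prop where
  ordI : I.OrdConnected
  ordJ : J.OrdConnected
  intI : (interior I).Nonempty
  intJ : (interior J).Nonempty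
  jetI : HasSecondJet I α α₁ α₂
  jetJ : HasSecondJet J β β₁ β₂
  ratio : ∀ u ∈ I, ∀ v ∈ J, RatioAt a (α₁ u) (α₂ u) (β₁ v) (β₂ v)

theorem uniqueDiffOn_of_interior_nonempty {J : Set ℝ} (hJ : J.OrdConnected)
    (hJ' : (interior J).Nonempty) : UniqueDiffOn ℝ J :=
  uniqueDiffOn_convex hJ.convex hJ'

theorem hasSecondJet_of_contDiffOn {J : Set ℝ} (hJ : UniqueDiffOn ℝ J)
    {γ : ℝ → Fin 3 → ℝ} (hγ : ContDiffOn ℝ 3 γ J) :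
    HasSecondJet J γ (derivWithin γ J) (derivWithin (derivWithin γ J) J) := by
  have h1 : ContDiffOn ℝ 2 (derivWithin γ J) J := hγ.derivWithin hJ (by norm_num)
  have h2 : ContDiffOn ℝ 1 (derivWithin (derivWithin γ J) J) J := h1.derivWithin hJ (by norm_num)
  exact ⟨fun v hv => ((hγ.differentiableOn (by norm_num)) v hv).hasDerivWithinAt,
    fun v hv => ((h1.differentiableOn (by norm_num)) v hv).hasDerivWithinAt,
    h2.differentiableOn (by norm_num)⟩

theorem HasSecondJet.coord₁ {J : Set ℝ} {γ γ₁ γ₂ : ℝ → Fin 3 → ℝ} (h : HasSecondJet J γ γ₁ γ₂)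
    {v : ℝ} (hv : v ∈ J) (i : Fin 3) : HasDerivWithinAt (fun v => γ v i) (γ₁ v i) J v :=
  hasDerivWithinAt_pi.1 (h.deriv₁ v hv) i

theorem HasSecondJet.coord₂ {J : Set ℝ} {γ γ₁ γ₂ : ℝ → Fin 3 → ℝ} (h : HasSecondJet J γ γ₁ γ₂)
    {v : ℝ} (hv : v ∈ J) (i : Fin 3) : HasDerivWithinAt (fun v => γ₁ v i) (γ₂ v i) J v :=
  hasDerivWithinAt_pi.1 (h.deriv₂ v hv) i

theorem HasSecondJet.coord_diff {J : Set ℝ} {γ γ₁ γ₂ : ℝ → Fin 3 → ℝ}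
    (h : HasSecondJet J γ γ₁ γ₂) (i : Fin 3) : DifferentiableOn ℝ (fun v => γ₂ v i) J :=
  differentiableOn_pi.1 h.diff i

/-- The top view as a continuous linear map. -/
noncomputable def topViewCLM : (Fin 3 → ℝ) →L[ℝ] (Fin 2 → ℝ) :=
  ContinuousLinearMap.pi ![ContinuousLinearMap.proj 0, ContinuousLinearMap.proj 1]

theorem topViewCLM_apply (p : Fin 3 → ℝ) : topViewCLM p = topView p := by
  ext i
  fin_cases i <;> rfl

theorem topView_eq (p : Fin 3 → ℝ) :
    topView p = p 0 • Pi.single (0 : Fin 2) (1 : ℝ) + p 1 • Pi.single (1 : Fin 2) (1 : ℝ) := by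
  ext i
  fin_cases i <;> simp [topView]

/-- The differential of a translational surface. -/
theorem hasFDerivWithinAt_translational {I J : Set ℝ} {α β : ℝ → Fin 3 → ℝ} {p q : Fin 3 → ℝ}
    {w : ℝ × ℝ} (hα : HasDerivWithinAt α p I w.1) (hβ : HasDerivWithinAt β q J w.2) :
    HasFDerivWithinAt (translational α β)
      ((ContinuousLinearMap.toSpanSingleton ℝ p).comp (ContinuousLinearMap.fst ℝ ℝ ℝ) +
        (ContinuousLinearMap.toSpanSingleton ℝ q).comp (ContinuousLinearMap.snd ℝ ℝ ℝ))
      (I ×ˢ J) w := by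
  have h1 := hα.hasFDerivWithinAt.comp w
    (hasFDerivWithinAt_fst (𝕜 := ℝ) (E := ℝ) (F := ℝ) (p := w) (s := I ×ˢ J)) (fun x hx => hx.1)
  have h2 := hβ.hasFDerivWithinAt.comp w
    (hasFDerivWithinAt_snd (𝕜 := ℝ) (E := ℝ) (F := ℝ) (p := w) (s := I ×ˢ J)) (fun x hx => hx.2)
  exact h1.add h2

theorem topDet_ne_zero_of_isAdmissible {I J : Set ℝ} (hI : UniqueDiffOn ℝ I)
    (hJ : UniqueDiffOn ℝ J) {α β : ℝ → Fin 3 → ℝ} {p q : Fin 3 → ℝ} {u v : ℝ} (hu : u ∈ I)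
    (hv : v ∈ J) (hα : HasDerivWithinAt α p I u) (hβ : HasDerivWithinAt β q J v)
    (hadm : IsAdmissible (translational α β) (I ×ˢ J)) : topDet p q ≠ 0 := by
  intro hD
  obtain ⟨hinj, hvert⟩ := hadm (u, v) ⟨hu, hv⟩
  have hF := (hasFDerivWithinAt_translational (w := (u, v)) hα hβ).fderivWithin
    ((hI.prod hJ) (u, v) ⟨hu, hv⟩)
  rw [hF] at hinj hvert
  -- a nonzero vector which the differential sends to a vertical vector
  obtain ⟨x, hx, h0, h1⟩ : ∃ x : ℝ × ℝ, x ≠ 0 ∧ x.1 * p 0 + x.2 * q 0 = 0 ∧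
      x.1 * p 1 + x.2 * q 1 = 0 := by
    unfold topDet at hD
    by_cases hp : p 0 = 0 ∧ p 1 = 0
    · exact ⟨(1, 0), by simp, by simp [hp.1], by simp [hp.2]⟩
    · by_cases h0 : p 0 = 0
      · have h1 : p 1 ≠ 0 := fun h => hp ⟨h0, h⟩
        exact ⟨(q 1, -p 1), by simp [h1], by simp only; linear_combination hD, by simp only; ring⟩
      · exact ⟨(q 0, -p 0), by simp [h0], by simp only; ring, by simp only; linear_combination -hD⟩
  set L := (ContinuousLinearMap.toSpanSingleton ℝ p).comp (ContinuousLinearMap.fst ℝ ℝ ℝ) +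
        (ContinuousLinearMap.toSpanSingleton ℝ q).comp (ContinuousLinearMap.snd ℝ ℝ ℝ) with hL
  have hLx : ∀ i, L x i = x.1 * p i + x.2 * q i := fun i => by simp [hL]
  have hz : L x 2 ≠ 0 := by
    intro hz
    apply hx
    apply hinj
    rw [map_zero]
    ext i
    fin_cases i
    · simpa [hLx] using h0
    · simpa [hLx] using h1
    · exact hz
  apply hvert
  refine ⟨(L x 2)⁻¹ • x, ?_⟩
  rw [map_smul]
  ext i
  fin_cases i
  · simp [hLx, h0]
  · simp [hLx, h1]
  · simp [hz]

/-- Two numbers of ratio `a ≠ 0`, in either order, are characterized by a relation between their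
sum and their product. The nonvanishing of the product takes care of `x / 0 = 0`. -/
theorem trace_det_of_ratio {a κ₁ κ₂ : ℝ} (ha : a ≠ 0) (h : κ₁ / κ₂ = a ∨ κ₂ / κ₁ = a) :
    a * (κ₁ + κ₂) ^ 2 = (a + 1) ^ 2 * (κ₁ * κ₂) ∧ κ₁ * κ₂ ≠ 0 := by
  rcases h with h | h
  · have h2 : κ₂ ≠ 0 := by rintro rfl; simp at h; exact ha h.symm
    have h1 : κ₁ ≠ 0 := by rintro rfl; simp at h; exact ha h.symm
    rw [div_eq_iff h2] at h
    subst h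
    exact ⟨by ring, mul_ne_zero h1 h2⟩
  · have h2 : κ₁ ≠ 0 := by rintro rfl; simp at h; exact ha h.symm
    have h1 : κ₂ ≠ 0 := by rintro rfl; simp at h; exact ha h.symm
    rw [div_eq_iff h2] at h
    subst h
    exact ⟨by ring, mul_ne_zero h2 h1⟩

theorem trace_det_of_charpoly_eq {H : Matrix (Fin 2) (Fin 2) ℝ} {κ₁ κ₂ : ℝ}
    (h : H.charpoly = (Polynomial.X - Polynomial.C κ₁) * (Polynomial.X - Polynomial.C κ₂)) :
    H 0 0 + H 1 1 = κ₁ + κ₂ ∧ H 0 0 * H 1 1 - H 0 1 * H 1 0 = κ₁ * κ₂ := by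
  rw [Matrix.charpoly_fin_two, Matrix.trace_fin_two, Matrix.det_fin_two] at h
  have h0 := congrArg (Polynomial.eval 0) h
  have h1 := congrArg (Polynomial.eval 1) h
  simp at h0 h1
  constructor <;> linarith

theorem HasSecondJet.topView₁ {J : Set ℝ} {γ γ₁ γ₂ : ℝ → Fin 3 → ℝ} (h : HasSecondJet J γ γ₁ γ₂)
    {v : ℝ} (hv : v ∈ J) :
    HasDerivWithinAt (fun v => topView (γ v)) (topView (γ₁ v)) J v := by
  simpa only [Function.comp_def, topViewCLM_apply] using
    topViewCLM.hasFDerivAt.comp_hasDerivWithinAt v (h.deriv₁ v hv)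

theorem HasSecondJet.topView₂ {J : Set ℝ} {γ γ₁ γ₂ : ℝ → Fin 3 → ℝ} (h : HasSecondJet J γ γ₁ γ₂)
    {v : ℝ} (hv : v ∈ J) :
    HasDerivWithinAt (fun v => topView (γ₁ v)) (topView (γ₂ v)) J v := by
  simpa only [Function.comp_def, topViewCLM_apply] using
    topViewCLM.hasFDerivAt.comp_hasDerivWithinAt v (h.deriv₂ v hv)

theorem topView_add (p q : Fin 3 → ℝ) : topView (p + q) = topView p + topView q := by
  simp only [← topViewCLM_apply, map_add]

theorem tendsto_mk_left {I J : Set ℝ} {u v : ℝ} (hv : v ∈ J) :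
    Filter.Tendsto (fun s => (s, v)) (𝓝[I] u) (𝓝[I ×ˢ J] (u, v)) := by
  refine tendsto_nhdsWithin_iff.2 ⟨?_, ?_⟩
  · exact ((Continuous.prodMk_left v).tendsto u).mono_left nhdsWithin_le_nhds
  · filter_upwards [self_mem_nhdsWithin] with s hs using ⟨hs, hv⟩

theorem tendsto_mk_right {I J : Set ℝ} {u v : ℝ} (hu : u ∈ I) :
    Filter.Tendsto (fun t => (u, t)) (𝓝[J] v) (𝓝[I ×ˢ J] (u, v)) := by
  refine tendsto_nhdsWithin_iff.2 ⟨?_, ?_⟩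
  · exact ((Continuous.prodMk_right u).tendsto v).mono_left nhdsWithin_le_nhds
  · filter_upwards [self_mem_nhdsWithin] with s hs using ⟨hu, hs⟩

/-- Differentiation of the graph equation along the two curves: the gradient of `f` is determined
by the tangents, and the Hessian of `f` on the tangents by the second derivatives. The mixed
values of the Hessian vanish since the mixed derivative of a translational surface does. -/
theorem hessian_of_isLocalGraphAt {I J : Set ℝ} (hI : UniqueDiffOn ℝ I)
    (hJ : UniqueDiffOn ℝ J) {α α₁ α₂ β β₁ β₂ : ℝ → Fin 3 → ℝ} (hα : HasSecondJet I α α₁ α₂)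
    (hβ : HasSecondJet J β β₁ β₂) {u v : ℝ} (hu : u ∈ I) (hv : v ∈ J) {f : (Fin 2 → ℝ) → ℝ}
    (hf : IsLocalGraphAt (translational α β) (I ×ˢ J) (u, v) f) :
    let P := topView (translational α β (u, v))
    fderiv ℝ f P (topView (α₁ u)) = α₁ u 2 ∧ fderiv ℝ f P (topView (β₁ v)) = β₁ v 2 ∧
    fderiv ℝ (fderiv ℝ f) P (topView (α₁ u)) (topView (α₁ u)) =
      α₂ u 2 - fderiv ℝ f P (topView (α₂ u)) ∧
    fderiv ℝ (fderiv ℝ f) P (topView (β₁ v)) (topView (β₁ v)) =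
      β₂ v 2 - fderiv ℝ f P (topView (β₂ v)) ∧
    fderiv ℝ (fderiv ℝ f) P (topView (α₁ u)) (topView (β₁ v)) = 0 ∧
    fderiv ℝ (fderiv ℝ f) P (topView (β₁ v)) (topView (α₁ u)) = 0 := by
  intro P
  obtain ⟨hf2, hgr⟩ := hf
  -- the top view of the surface as a function of the parameters
  set R : ℝ × ℝ → Fin 2 → ℝ := fun w => topView (translational α β w) with hR
  have hRu : ∀ w ∈ I ×ˢ J, HasDerivWithinAt (fun s => R (s, w.2)) (topView (α₁ w.1)) I w.1 := by
    intro w hw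
    simpa [hR, translational, topView_add] using (hα.topView₁ hw.1).add_const (topView (β w.2))
  have hRv : ∀ w ∈ I ×ˢ J, HasDerivWithinAt (fun s => R (w.1, s)) (topView (β₁ w.2)) J w.2 := by
    intro w hw
    simpa [hR, translational, topView_add] using (hβ.topView₁ hw.2).const_add (topView (α w.1))
  have huv : ((u, v) : ℝ × ℝ) ∈ I ×ˢ J := ⟨hu, hv⟩
  have hRcont : Filter.Tendsto R (𝓝[I ×ˢ J] (u, v)) (𝓝 P) := by
    have h := (hasFDerivWithinAt_translational (w := (u, v)) (hα.deriv₁ u hu)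
      (hβ.deriv₁ v hv)).continuousWithinAt
    simpa only [hR, Function.comp_def, topViewCLM_apply] using
      (topViewCLM.continuous.tendsto (translational α β (u, v))).comp h
  have hdiff : ∀ᶠ x in 𝓝 P, DifferentiableAt ℝ f x := by
    have h := hf2.eventually (by simp)
    filter_upwards [h] with x hx using hx.differentiableAt (by norm_num)
  have hfd : HasFDerivAt (fderiv ℝ f) (fderiv ℝ (fderiv ℝ f) P) P :=
    ((hf2.fderiv_right (m := 1) (by norm_num)).differentiableAt (by norm_num)).hasFDerivAt
  -- the first derivatives of the graph equation, at all nearby parameters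
  have hfirst : ∀ᶠ w in 𝓝[I ×ˢ J] (u, v),
      fderiv ℝ f (R w) (topView (α₁ w.1)) = α₁ w.1 2 ∧
        fderiv ℝ f (R w) (topView (β₁ w.2)) = β₁ w.2 2 := by
    filter_upwards [eventually_eventually_nhdsWithin.2 hgr, hRcont.eventually hdiff,
      self_mem_nhdsWithin] with w hw hdw hwD
    obtain ⟨s, t⟩ := w
    constructor
    · have h1 : HasDerivWithinAt (fun x => f (R (x, t))) (fderiv ℝ f (R (s, t))
          (topView (α₁ s))) I s :=
        HasFDerivAt.comp_hasDerivWithinAt (f := fun x => R (x, t)) s hdw.hasFDerivAt (hRu _ hwD)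
      have h2 : HasDerivWithinAt (fun x => α x 2 + β t 2) (α₁ s 2) I s :=
        (hα.coord₁ hwD.1 2).add_const _
      have heq : (fun x => α x 2 + β t 2) =ᶠ[𝓝[I] s] fun x => f (R (x, t)) :=
        (tendsto_mk_left hwD.2).eventually hw
      have h3 := h2.congr_of_eventuallyEq heq.symm (heq.symm.self_of_nhdsWithin hwD.1)
      exact (hI s hwD.1).eq_deriv _ h1 h3
    · have h1 : HasDerivWithinAt (fun x => f (R (s, x))) (fderiv ℝ f (R (s, t))
          (topView (β₁ t))) J t :=
        HasFDerivAt.comp_hasDerivWithinAt (f := fun x => R (s, x)) t hdw.hasFDerivAt (hRv _ hwD)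
      have h2 : HasDerivWithinAt (fun x => α s 2 + β x 2) (β₁ t 2) J t :=
        (hβ.coord₁ hwD.2 2).const_add _
      have heq : (fun x => α s 2 + β x 2) =ᶠ[𝓝[J] t] fun x => f (R (s, x)) :=
        (tendsto_mk_right hwD.1).eventually hw
      have h3 := h2.congr_of_eventuallyEq heq.symm (heq.symm.self_of_nhdsWithin hwD.2)
      exact (hJ t hwD.2).eq_deriv _ h1 h3
  have hp := hfirst.self_of_nhdsWithin huv
  have hGu : HasDerivWithinAt (fun s => fderiv ℝ f (R (s, v)))
      (fderiv ℝ (fderiv ℝ f) P (topView (α₁ u))) I u :=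
    HasFDerivAt.comp_hasDerivWithinAt (f := fun s => R (s, v)) u hfd (hRu _ huv)
  have hGv : HasDerivWithinAt (fun s => fderiv ℝ f (R (u, s)))
      (fderiv ℝ (fderiv ℝ f) P (topView (β₁ v))) J v :=
    HasFDerivAt.comp_hasDerivWithinAt (f := fun s => R (u, s)) v hfd (hRv _ huv)
  refine ⟨hp.1, hp.2, ?_, ?_, ?_, ?_⟩
  · have heq : (fun s => fderiv ℝ f (R (s, v)) (topView (α₁ s))) =ᶠ[𝓝[I] u] fun s => α₁ s 2 :=
      (tendsto_mk_left hv).eventually (hfirst.mono fun w hw => hw.1)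
    have h1 := hGu.clm_apply (hα.topView₂ hu)
    have h2 := (hα.coord₂ hu 2).congr_of_eventuallyEq heq (heq.self_of_nhdsWithin hu)
    have := (hI u hu).eq_deriv _ h1 h2
    rw [← this]
    simp [P, hR]
  · have heq : (fun s => fderiv ℝ f (R (u, s)) (topView (β₁ s))) =ᶠ[𝓝[J] v] fun s => β₁ s 2 :=
      (tendsto_mk_right hu).eventually (hfirst.mono fun w hw => hw.2)
    have h1 := hGv.clm_apply (hβ.topView₂ hv)
    have h2 := (hβ.coord₂ hv 2).congr_of_eventuallyEq heq (heq.self_of_nhdsWithin hv)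
    have := (hJ v hv).eq_deriv _ h1 h2
    rw [← this]
    simp [P, hR]
  · have heq : (fun s => fderiv ℝ f (R (s, v)) (topView (β₁ v))) =ᶠ[𝓝[I] u] fun _ => β₁ v 2 :=
      (tendsto_mk_left hv).eventually (hfirst.mono fun w hw => hw.2)
    have h1 := hGu.clm_apply (hasDerivWithinAt_const u I (topView (β₁ v)))
    have h2 := (hasDerivWithinAt_const u I (β₁ v 2)).congr_of_eventuallyEq heq
      (heq.self_of_nhdsWithin hu)
    simpa using (hI u hu).eq_deriv _ h1 h2
  · have heq : (fun s => fderiv ℝ f (R (u, s)) (topView (α₁ u))) =ᶠ[𝓝[J] v] fun _ => α₁ u 2 :=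
      (tendsto_mk_right hu).eventually (hfirst.mono fun w hw => hw.1)
    have h1 := hGv.clm_apply (hasDerivWithinAt_const v J (topView (α₁ u)))
    have h2 := (hasDerivWithinAt_const v J (α₁ u 2)).congr_of_eventuallyEq heq
      (heq.self_of_nhdsWithin hv)
    simpa using (hJ v hv).eq_deriv _ h1 h2

theorem bilin_topView (H : (Fin 2 → ℝ) →L[ℝ] (Fin 2 → ℝ) →L[ℝ] ℝ) (p q : Fin 3 → ℝ) :
    H (topView p) (topView q) =
      H (Pi.single 0 1) (Pi.single 0 1) * p 0 * q 0 + H (Pi.single 0 1) (Pi.single 1 1) * p 0 * q 1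
      + H (Pi.single 1 1) (Pi.single 0 1) * p 1 * q 0
      + H (Pi.single 1 1) (Pi.single 1 1) * p 1 * q 1 := by
  rw [topView_eq, topView_eq]
  simp
  ring

theorem lin_topView (g : (Fin 2 → ℝ) →L[ℝ] ℝ) (p : Fin 3 → ℝ) :
    g (topView p) = g (Pi.single 0 1) * p 0 + g (Pi.single 1 1) * p 1 := by
  rw [topView_eq]
  simp
  ring

/-- Conjugacy of the tangents `p` and `q` expresses the trace and the determinant of the Hessian
by its values `A` and `B` on `p` and `q`. -/
theorem ratioAt_of_hasPrincipalCurvaturesAt {I J : Set ℝ} (hI : UniqueDiffOn ℝ I)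
    (hJ : UniqueDiffOn ℝ J) {α α₁ α₂ β β₁ β₂ : ℝ → Fin 3 → ℝ} (hα : HasSecondJet I α α₁ α₂)
    (hβ : HasSecondJet J β β₁ β₂) {u v : ℝ} (hu : u ∈ I) (hv : v ∈ J)
    (hD : topDet (α₁ u) (β₁ v) ≠ 0) {a κ₁ κ₂ : ℝ} (ha : a ≠ 0)
    (hκ : HasPrincipalCurvaturesAt (translational α β) (I ×ˢ J) (u, v) κ₁ κ₂)
    (hratio : κ₁ / κ₂ = a ∨ κ₂ / κ₁ = a) :
    RatioAt a (α₁ u) (α₂ u) (β₁ v) (β₂ v) := by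
  obtain ⟨f, hf, hchar⟩ := hκ
  obtain ⟨h1, h2, h3, h4, h5, h6⟩ := hessian_of_isLocalGraphAt hI hJ hα hβ hu hv hf
  obtain ⟨htr, hdet⟩ := trace_det_of_charpoly_eq hchar
  obtain ⟨hr1, hr2⟩ := trace_det_of_ratio ha hratio
  rw [← htr, ← hdet] at hr1
  rw [← hdet] at hr2
  simp only [shapeOperator, Matrix.of_apply] at hr1 hr2
  rw [lin_topView] at h1 h2
  rw [bilin_topView] at h3 h4 h5 h6
  rw [lin_topView] at h3 h4
  set H := fderiv ℝ (fderiv ℝ f) (topView (translational α β (u, v)))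
  set g := fderiv ℝ f (topView (translational α β (u, v)))
  set H00 := H (Pi.single 0 1) (Pi.single 0 1)
  set H01 := H (Pi.single 0 1) (Pi.single 1 1)
  set H10 := H (Pi.single 1 1) (Pi.single 0 1)
  set H11 := H (Pi.single 1 1) (Pi.single 1 1)
  set p := α₁ u
  set q := β₁ v
  set A := α₂ u 2 - g (Pi.single 0 1) * α₂ u 0 - g (Pi.single 1 1) * α₂ u 1 with hA
  set B := β₂ v 2 - g (Pi.single 0 1) * β₂ v 0 - g (Pi.single 1 1) * β₂ v 1 with hB
  have h3' : H00 * p 0 * p 0 + H01 * p 0 * p 1 + H10 * p 1 * p 0 + H11 * p 1 * p 1 = A := by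
    rw [h3, hA]; ring
  have h4' : H00 * q 0 * q 0 + H01 * q 0 * q 1 + H10 * q 1 * q 0 + H11 * q 1 * q 1 = B := by
    rw [h4, hB]; ring
  have hdet' : (H00 * H11 - H01 * H10) * topDet p q ^ 2 = A * B := by
    rw [← h3', ← h4']
    unfold topDet
    linear_combination -(H00 * q 0 * p 0 + H01 * q 0 * p 1 + H10 * q 1 * p 0 + H11 * q 1 * p 1) * h5
  have htr' : (H00 + H11) * topDet p q ^ 2 = A * topNormSq q + B * topNormSq p := by
    rw [← h3', ← h4']
    unfold topDet topNormSq
    linear_combination -(p 0 * q 0 + p 1 * q 1) * (h5 + h6)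
  have hAB : A * B ≠ 0 := by
    rw [← hdet']
    exact mul_ne_zero hr2 (pow_ne_zero 2 hD)
  refine ⟨hD, _, _, A, B, h1, h2, hA, hB, left_ne_zero_of_mul hAB, right_ne_zero_of_mul hAB, ?_⟩
  rw [← htr', mul_assoc ((a + 1) ^ 2), ← hdet']
  linear_combination topDet p q ^ 4 * hr1

/-! ### Similarities and planar curves -/

/-- The linear part of a general isotropic similarity. -/
def simLin (h₁ h₂ c₁ c₂ c₃ : ℝ) (p : Fin 3 → ℝ) : Fin 3 → ℝ :=
  Matrix.mulVec !![h₁, -h₂, 0; h₂, h₁, 0; c₁, c₂, c₃] p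

section

variable (h₁ h₂ c₁ c₂ c₃ : ℝ) (p q : Fin 3 → ℝ)

theorem simLin_zero : simLin h₁ h₂ c₁ c₂ c₃ p 0 = h₁ * p 0 - h₂ * p 1 := by
  simp [simLin, Matrix.mulVec, dotProduct, Fin.sum_univ_three]
  ring

theorem simLin_one : simLin h₁ h₂ c₁ c₂ c₃ p 1 = h₂ * p 0 + h₁ * p 1 := by
  simp [simLin, Matrix.mulVec, dotProduct, Fin.sum_univ_three]

theorem simLin_two : simLin h₁ h₂ c₁ c₂ c₃ p 2 = c₁ * p 0 + c₂ * p 1 + c₃ * p 2 := by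
  simp [simLin, Matrix.mulVec, dotProduct, Fin.sum_univ_three]

theorem simLin_add : simLin h₁ h₂ c₁ c₂ c₃ (p + q) =
    simLin h₁ h₂ c₁ c₂ c₃ p + simLin h₁ h₂ c₁ c₂ c₃ q :=
  Matrix.mulVec_add _ _ _

theorem topNormSq_simLin :
    topNormSq (simLin h₁ h₂ c₁ c₂ c₃ p) = (h₁ ^ 2 + h₂ ^ 2) * topNormSq p := by
  simp only [topNormSq, simLin_zero, simLin_one]
  ring

theorem topDet_simLin : topDet (simLin h₁ h₂ c₁ c₂ c₃ p) (simLin h₁ h₂ c₁ c₂ c₃ q) =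
    (h₁ ^ 2 + h₂ ^ 2) * topDet p q := by
  simp only [topDet, simLin_zero, simLin_one]
  ring

end

theorem ext_fin_three {p q : Fin 3 → ℝ} (h0 : p 0 = q 0) (h1 : p 1 = q 1) (h2 : p 2 = q 2) :
    p = q := by
  ext i
  fin_cases i
  exacts [h0, h1, h2]

theorem sq_add_sq_ne_zero {h₁ h₂ : ℝ} (h : h₁ ≠ 0 ∨ h₂ ≠ 0) : h₁ ^ 2 + h₂ ^ 2 ≠ 0 := by
  intro h0
  have h1 : h₁ = 0 := by nlinarith [sq_nonneg h₁, sq_nonneg h₂]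
  have h2 : h₂ = 0 := by nlinarith [sq_nonneg h₁, sq_nonneg h₂]
  simp [h1, h2] at h

theorem isSimilarity_simLin {h₁ h₂ c₃ : ℝ} (h : h₁ ≠ 0 ∨ h₂ ≠ 0) (c₁ c₂ : ℝ) (hc : c₃ ≠ 0)
    (t : Fin 3 → ℝ) : IsSimilarity (fun p => simLin h₁ h₂ c₁ c₂ c₃ p + t) :=
  ⟨h₁, h₂, c₁, c₂, c₃, t, h, hc, fun _ => rfl⟩

theorem IsSimilarity.comp {T U : (Fin 3 → ℝ) → Fin 3 → ℝ} (hT : IsSimilarity T)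
    (hU : IsSimilarity U) : IsSimilarity (T ∘ U) := by
  obtain ⟨h₁, h₂, c₁, c₂, c₃, t, hh, hc, hT⟩ := hT
  obtain ⟨k₁, k₂, d₁, d₂, d₃, s, hk, hd, hU⟩ := hU
  refine ⟨h₁ * k₁ - h₂ * k₂, h₂ * k₁ + h₁ * k₂, c₁ * k₁ + c₂ * k₂ + c₃ * d₁,
    -c₁ * k₂ + c₂ * k₁ + c₃ * d₂, c₃ * d₃, simLin h₁ h₂ c₁ c₂ c₃ s + t, ?_, mul_ne_zero hc hd, ?_⟩
  · by_contra! h0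
    have := mul_ne_zero (sq_add_sq_ne_zero hh) (sq_add_sq_ne_zero hk)
    apply this
    linear_combination (h₁ * k₁ - h₂ * k₂) * h0.1 + (h₂ * k₁ + h₁ * k₂) * h0.2
  · intro p
    have hT' : ∀ p, T p = simLin h₁ h₂ c₁ c₂ c₃ p + t := hT
    have hU' : ∀ p, U p = simLin k₁ k₂ d₁ d₂ d₃ p + s := hU
    simp only [Function.comp_apply, hT', hU']
    change _ = simLin _ _ _ _ _ p + _
    apply ext_fin_three <;>
      simp only [Pi.add_apply, simLin_zero, simLin_one, simLin_two] <;> ring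

theorem SimilarToSubset.of_image {T : (Fin 3 → ℝ) → Fin 3 → ℝ} (hT : IsSimilarity T)
    {M S : Set (Fin 3 → ℝ)} (h : SimilarToSubset (T '' M) S) : SimilarToSubset M S := by
  obtain ⟨U, hU, hUS⟩ := h
  exact ⟨U ∘ T, hU.comp hT, by rwa [Set.image_comp]⟩

/-- The set `M` is isotropic similar to a subset of one of the listed surfaces with ratio `a`. -/
def IsListed (a : ℝ) (M : Set (Fin 3 → ℝ)) : Prop :=
  SimilarToSubset M (paraboloid a) ∨
    (a ≠ 1 ∧ ∃ V : Set ℝ, IsParameterInterval a ((a + 1) / (a - 1)) V ∧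
      SimilarToSubset M (expSurface ((a + 1) / (a - 1)) V)) ∨
    (a = -1 ∧ SimilarToSubset M logCosSurface)

theorem IsListed.of_image {a : ℝ} {T : (Fin 3 → ℝ) → Fin 3 → ℝ} (hT : IsSimilarity T)
    {M : Set (Fin 3 → ℝ)} (h : IsListed a (T '' M)) : IsListed a M := by
  rcases h with h | ⟨h1, V, hV, h⟩ | ⟨h1, h⟩
  · exact Or.inl (h.of_image hT)
  · exact Or.inr (Or.inl ⟨h1, V, hV, h.of_image hT⟩)
  · exact Or.inr (Or.inr ⟨h1, h.of_image hT⟩)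

theorem image_translational_simLin {h₁ h₂ c₁ c₂ c₃ : ℝ} {t : Fin 3 → ℝ} {α β : ℝ → Fin 3 → ℝ}
    {D : Set (ℝ × ℝ)} :
    translational (fun u => simLin h₁ h₂ c₁ c₂ c₃ (α u) + t)
      (fun v => simLin h₁ h₂ c₁ c₂ c₃ (β v)) '' D =
    (fun p => simLin h₁ h₂ c₁ c₂ c₃ p + t) '' (translational α β '' D) := by
  rw [Set.image_image]
  refine Set.image_congr fun w _ => ?_
  simp only [translational, simLin_add]
  abel

theorem image_translational_swap {α β : ℝ → Fin 3 → ℝ} {I J : Set ℝ} :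
    translational β α '' (J ×ˢ I) = translational α β '' (I ×ˢ J) := by
  ext x
  constructor
  · rintro ⟨w, hw, rfl⟩
    exact ⟨w.swap, ⟨hw.2, hw.1⟩, add_comm _ _⟩
  · rintro ⟨w, hw, rfl⟩
    exact ⟨w.swap, ⟨hw.2, hw.1⟩, add_comm _ _⟩

theorem topDet_swap (p q : Fin 3 → ℝ) : topDet q p = -topDet p q := by
  unfold topDet
  ring

theorem RatioAt.swap {a : ℝ} {p p' q q' : Fin 3 → ℝ} (h : RatioAt a p p' q q') :
    RatioAt a q q' p p' := by
  obtain ⟨hD, g₀, g₁, A, B, h1, h2, h3, h4, hA, hB, h5⟩ := h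
  refine ⟨by rw [topDet_swap]; exact neg_ne_zero.2 hD, g₀, g₁, B, A, h2, h1, h4, h3, hB, hA, ?_⟩
  rw [topDet_swap]
  linear_combination h5

theorem RatioPair.swap {a : ℝ} {I J : Set ℝ} {α α₁ α₂ β β₁ β₂ : ℝ → Fin 3 → ℝ}
    (h : RatioPair a I J α α₁ α₂ β β₁ β₂) : RatioPair a J I β β₁ β₂ α α₁ α₂ :=
  ⟨h.ordJ, h.ordI, h.intJ, h.intI, h.jetJ, h.jetI, fun v hv u hu => (h.ratio u hu v hv).swap⟩

theorem RatioAt.simLin {a h₁ h₂ c₃ : ℝ} (hh : h₁ ≠ 0 ∨ h₂ ≠ 0) (c₁ c₂ : ℝ) (hc : c₃ ≠ 0)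
    {p p' q q' : Fin 3 → ℝ} (h : RatioAt a p p' q q') :
    RatioAt a (simLin h₁ h₂ c₁ c₂ c₃ p) (simLin h₁ h₂ c₁ c₂ c₃ p')
      (simLin h₁ h₂ c₁ c₂ c₃ q) (simLin h₁ h₂ c₁ c₂ c₃ q') := by
  obtain ⟨hD, g₀, g₁, A, B, h1, h2, h3, h4, hA, hB, h5⟩ := h
  have hn := sq_add_sq_ne_zero hh
  refine ⟨by rw [topDet_simLin]; exact mul_ne_zero hn hD,
    (h₁ * (c₁ + c₃ * g₀) - h₂ * (c₂ + c₃ * g₁)) / (h₁ ^ 2 + h₂ ^ 2),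
    (h₂ * (c₁ + c₃ * g₀) + h₁ * (c₂ + c₃ * g₁)) / (h₁ ^ 2 + h₂ ^ 2), c₃ * A, c₃ * B, ?_, ?_, ?_, ?_,
    mul_ne_zero hc hA, mul_ne_zero hc hB, ?_⟩
  · simp only [simLin_zero, simLin_one, simLin_two, ← h1]
    field_simp
    ring
  · simp only [simLin_zero, simLin_one, simLin_two, ← h2]
    field_simp
    ring
  · simp only [simLin_zero, simLin_one, simLin_two, h3]
    field_simp
    ring
  · simp only [simLin_zero, simLin_one, simLin_two, h4]
    field_simp
    ring
  · rw [topNormSq_simLin, topNormSq_simLin, topDet_simLin]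
    linear_combination c₃ ^ 2 * (h₁ ^ 2 + h₂ ^ 2) ^ 2 * h5

/-- `simLin` as a continuous linear map. -/
noncomputable def simCLM (h₁ h₂ c₁ c₂ c₃ : ℝ) : (Fin 3 → ℝ) →L[ℝ] (Fin 3 → ℝ) :=
  LinearMap.toContinuousLinearMap (Matrix.mulVecLin !![h₁, -h₂, 0; h₂, h₁, 0; c₁, c₂, c₃])

theorem HasSecondJet.simLin {J : Set ℝ} {γ γ₁ γ₂ : ℝ → Fin 3 → ℝ} (h : HasSecondJet J γ γ₁ γ₂)
    (h₁ h₂ c₁ c₂ c₃ : ℝ) :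
    HasSecondJet J (fun v => simLin h₁ h₂ c₁ c₂ c₃ (γ v))
      (fun v => simLin h₁ h₂ c₁ c₂ c₃ (γ₁ v)) (fun v => simLin h₁ h₂ c₁ c₂ c₃ (γ₂ v)) :=
  ⟨fun v hv => (simCLM h₁ h₂ c₁ c₂ c₃).hasFDerivAt.comp_hasDerivWithinAt v (h.deriv₁ v hv),
    fun v hv => (simCLM h₁ h₂ c₁ c₂ c₃).hasFDerivAt.comp_hasDerivWithinAt v (h.deriv₂ v hv),
    (simCLM h₁ h₂ c₁ c₂ c₃).differentiable.comp_differentiableOn h.diff⟩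

theorem RatioPair.simLin {a : ℝ} {I J : Set ℝ} {α α₁ α₂ β β₁ β₂ : ℝ → Fin 3 → ℝ}
    (h : RatioPair a I J α α₁ α₂ β β₁ β₂) {h₁ h₂ c₃ : ℝ} (hh : h₁ ≠ 0 ∨ h₂ ≠ 0) (c₁ c₂ : ℝ)
    (hc : c₃ ≠ 0) (t : Fin 3 → ℝ) :
    RatioPair a I J (fun u => simLin h₁ h₂ c₁ c₂ c₃ (α u) + t)
      (fun v => simLin h₁ h₂ c₁ c₂ c₃ (α₁ v)) (fun v => simLin h₁ h₂ c₁ c₂ c₃ (α₂ v))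
      (fun v => simLin h₁ h₂ c₁ c₂ c₃ (β v))
      (fun v => simLin h₁ h₂ c₁ c₂ c₃ (β₁ v)) (fun v => simLin h₁ h₂ c₁ c₂ c₃ (β₂ v)) := by
  have hα := h.jetI.simLin h₁ h₂ c₁ c₂ c₃
  exact ⟨h.ordI, h.ordJ, h.intI, h.intJ,
    ⟨fun v hv => (hα.deriv₁ v hv).add_const t, hα.deriv₂, hα.diff⟩, h.jetJ.simLin _ _ _ _ _,
    fun u hu v hv => (h.ratio u hu v hv).simLin hh c₁ c₂ hc⟩

/-- The curve `γ`, restricted to `J`, lies in the plane `n₀ x + n₁ y + n₂ z = d`. -/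
def LiesInPlane (γ : ℝ → Fin 3 → ℝ) (J : Set ℝ) (n : Fin 3 → ℝ) (d : ℝ) : Prop :=
  ∀ v ∈ J, n 0 * γ v 0 + n 1 * γ v 1 + n 2 * γ v 2 = d

/-- The curve `γ`, restricted to `J`, lies in some plane. -/
def IsPlanarOn (γ : ℝ → Fin 3 → ℝ) (J : Set ℝ) : Prop :=
  ∃ n d, n ≠ 0 ∧ LiesInPlane γ J n d

theorem IsPlanarOn.of_simLin {h₁ h₂ c₁ c₂ c₃ : ℝ} (hh : h₁ ≠ 0 ∨ h₂ ≠ 0) (hc : c₃ ≠ 0)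
    {γ : ℝ → Fin 3 → ℝ} {J : Set ℝ}
    (h : IsPlanarOn (fun v => IsotropicGeometry.simLin h₁ h₂ c₁ c₂ c₃ (γ v)) J) :
    IsPlanarOn γ J := by
  obtain ⟨n, d, hn, hd⟩ := h
  refine ⟨![n 0 * h₁ + n 1 * h₂ + n 2 * c₁, -n 0 * h₂ + n 1 * h₁ + n 2 * c₂, n 2 * c₃], d, ?_, ?_⟩
  · intro h0
    have e0 := congrFun h0 0
    have e1 := congrFun h0 1
    have e2 := congrFun h0 2
    simp [hc] at e0 e1 e2
    simp [e2] at e0 e1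
    have hs := sq_add_sq_ne_zero hh
    apply hn
    ext i
    fin_cases i
    · exact (mul_eq_zero.1 (show (h₁ ^ 2 + h₂ ^ 2) * n 0 = 0 by
        linear_combination h₁ * e0 - h₂ * e1)).resolve_left hs
    · exact (mul_eq_zero.1 (show (h₁ ^ 2 + h₂ ^ 2) * n 1 = 0 by
        linear_combination h₂ * e0 + h₁ * e1)).resolve_left hs
    · exact e2
  · intro v hv
    have := hd v hv
    simp only [simLin_zero, simLin_one, simLin_two] at this
    simp
    linear_combination this

theorem isPlanarOn_of_coplanar {γ : ℝ → Fin 3 → ℝ} {J : Set ℝ} (h : Coplanar ℝ (γ '' J)) :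
    IsPlanarOn γ J := by
  have hlt : vectorSpan ℝ (γ '' J) < ⊤ := by
    rw [lt_top_iff_ne_top]
    intro htop
    have h2 : Module.rank ℝ (vectorSpan ℝ (γ '' J)) ≤ 2 := h
    rw [htop, rank_top, rank_fin_fun] at h2
    have : (3 : ℕ) ≤ 2 := by exact_mod_cast h2
    omega
  obtain ⟨f, hf, hle⟩ := Submodule.exists_le_ker_of_lt_top _ hlt
  have hfe : ∀ p, f p = f (Pi.single 0 1) * p 0 + f (Pi.single 1 1) * p 1
      + f (Pi.single 2 1) * p 2 := by
    intro p
    rw [LinearMap.pi_apply_eq_sum_univ f p, Fin.sum_univ_three]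
    simp only [smul_eq_mul]
    have e : ∀ i : Fin 3, (fun j => if i = j then (1 : ℝ) else 0) = Pi.single i 1 := by
      intro i
      ext j
      simp [Pi.single_apply, eq_comm]
    rw [e, e, e]
    ring
  rcases J.eq_empty_or_nonempty with rfl | ⟨v₀, hv₀⟩
  · exact ⟨![1, 0, 0], 0, fun h => by simpa using congrFun h 0, fun v hv => absurd hv (by simp)⟩
  refine ⟨fun i => f (Pi.single i 1), f (γ v₀), ?_, ?_⟩
  · intro h0
    apply hf
    ext i
    simpa using congrFun h0 i
  · intro v hv
    have : γ v - γ v₀ ∈ LinearMap.ker f :=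
      hle (vsub_mem_vectorSpan ℝ (Set.mem_image_of_mem _ hv) (Set.mem_image_of_mem _ hv₀))
    rw [LinearMap.mem_ker, map_sub, sub_eq_zero] at this
    rw [← this, hfe (γ v)]

theorem IsPlanarOn.coplanar {γ : ℝ → Fin 3 → ℝ} {J : Set ℝ} (h : IsPlanarOn γ J) :
    Coplanar ℝ (γ '' J) := by
  obtain ⟨n, d, hn, hd⟩ := h
  let f : (Fin 3 → ℝ) →ₗ[ℝ] ℝ := n 0 • LinearMap.proj 0 + n 1 • LinearMap.proj 1
    + n 2 • LinearMap.proj 2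
  have hf : f ≠ 0 := by
    intro h0
    apply hn
    ext i
    have := congrArg (fun g => g (Pi.single i 1)) h0
    fin_cases i <;> simpa [f] using this
  have hle : vectorSpan ℝ (γ '' J) ≤ LinearMap.ker f := by
    rw [vectorSpan_def, Submodule.span_le]
    rintro _ ⟨_, ⟨u, hu, rfl⟩, _, ⟨v, hv, rfl⟩, rfl⟩
    have h1 := hd u hu
    have h2 := hd v hv
    change f (γ u - γ v) = 0
    rw [map_sub, sub_eq_zero]
    simp only [f, LinearMap.add_apply, LinearMap.smul_apply, LinearMap.proj_apply, smul_eq_mul]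
    rw [h1, h2]
  have hker : Module.finrank ℝ (LinearMap.ker f) = 2 := by
    have h1 := LinearMap.finrank_range_add_finrank_ker f
    rw [LinearMap.range_eq_top.2 (LinearMap.surjective_of_ne_zero hf), finrank_top,
      Module.finrank_self, Module.finrank_fin_fun] at h1
    omega
  unfold Coplanar
  calc Module.rank ℝ (vectorSpan ℝ (γ '' J)) ≤ Module.rank ℝ (LinearMap.ker f) :=
        Submodule.rank_mono hle
    _ = 2 := by rw [← Module.finrank_eq_rank, hker]; rfl

/-! ### Surfaces that are graphs after a similarity -/

/-- A symmetric matrix whose trace and determinant satisfy the relation of ratio `a` has real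
eigenvalues of ratio `a`. -/
theorem exists_roots_of_trace_det {a : ℝ} (ha : a ≠ 0) {H : Matrix (Fin 2) (Fin 2) ℝ}
    (hsymm : H 0 1 = H 1 0) (hdet : H 0 0 * H 1 1 - H 0 1 * H 1 0 ≠ 0)
    (h : a * (H 0 0 + H 1 1) ^ 2 = (a + 1) ^ 2 * (H 0 0 * H 1 1 - H 0 1 * H 1 0)) :
    ∃ κ₁ κ₂ : ℝ, H.charpoly = (Polynomial.X - Polynomial.C κ₁) * (Polynomial.X - Polynomial.C κ₂) ∧
      (κ₁ / κ₂ = a ∨ κ₂ / κ₁ = a) := by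
  obtain ⟨κ₁, κ₂, h1, h2, h3⟩ : ∃ κ₁ κ₂ : ℝ, H 0 0 + H 1 1 = κ₁ + κ₂ ∧
      H 0 0 * H 1 1 - H 0 1 * H 1 0 = κ₁ * κ₂ ∧ κ₁ = a * κ₂ := by
    by_cases ha1 : a + 1 = 0
    · have ha' : a = -1 := by linarith
      have htr : H 0 0 + H 1 1 = 0 := by
        rw [ha1] at h
        have : (H 0 0 + H 1 1) ^ 2 = 0 := by
          simpa [ha] using h
        exact pow_eq_zero_iff (two_ne_zero) |>.1 this
      have hneg : 0 ≤ -(H 0 0 * H 1 1 - H 0 1 * H 1 0) := by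
        rw [← hsymm]
        have : H 1 1 = -H 0 0 := by linarith
        rw [this]
        nlinarith [sq_nonneg (H 0 0), sq_nonneg (H 0 1)]
      refine ⟨-√(-(H 0 0 * H 1 1 - H 0 1 * H 1 0)), √(-(H 0 0 * H 1 1 - H 0 1 * H 1 0)), ?_, ?_, ?_⟩
      · linarith
      · linear_combination Real.mul_self_sqrt hneg
      · rw [ha']; ring
    · refine ⟨a * ((H 0 0 + H 1 1) / (a + 1)), (H 0 0 + H 1 1) / (a + 1), ?_, ?_, rfl⟩
      · field_simp
      · field_simp
        linear_combination -h
  refine ⟨κ₁, κ₂, ?_, Or.inl ?_⟩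
  · rw [Matrix.charpoly_fin_two, Matrix.trace_fin_two, Matrix.det_fin_two, h1, h2]
    simp only [map_add, map_mul]
    ring
  · have : κ₂ ≠ 0 := by
      rintro rfl
      rw [h2] at hdet
      simp at hdet
    rw [h3]
    field_simp

/-- The map of top views induced by the linear part of a similarity. -/
noncomputable def topSim (h₁ h₂ : ℝ) : (Fin 2 → ℝ) →L[ℝ] (Fin 2 → ℝ) :=
  LinearMap.toContinuousLinearMap (Matrix.mulVecLin !![h₁, -h₂; h₂, h₁])

theorem topSim_apply (h₁ h₂ : ℝ) (x : Fin 2 → ℝ) :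
    topSim h₁ h₂ x = ![h₁ * x 0 - h₂ * x 1, h₂ * x 0 + h₁ * x 1] := by
  ext i
  fin_cases i
  · simp [topSim, Matrix.mulVec, dotProduct, Fin.sum_univ_two]
    ring
  · simp [topSim, Matrix.mulVec, dotProduct, Fin.sum_univ_two]

theorem vec_two_eq (x y : ℝ) : (![x, y] : Fin 2 → ℝ) =
    x • Pi.single (0 : Fin 2) (1 : ℝ) + y • Pi.single (1 : Fin 2) (1 : ℝ) := by
  ext i
  fin_cases i <;> simp

/-- The Hessian of the function obtained from `F` by a similarity of its graph. -/
theorem shapeOperator_comp_topSim {F : (Fin 2 → ℝ) → ℝ} {h₁ h₂ k : ℝ} {s P : Fin 2 → ℝ}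
    {l : (Fin 2 → ℝ) →L[ℝ] ℝ} {d : ℝ} (hF : ContDiffAt ℝ 2 F (topSim h₁ h₂ P + s))
    (i j : Fin 2) :
    shapeOperator (fun x => k * (F (topSim h₁ h₂ x + s) - l x - d)) P i j =
      k * fderiv ℝ (fderiv ℝ F) (topSim h₁ h₂ P + s) (topSim h₁ h₂ (Pi.single i 1))
        (topSim h₁ h₂ (Pi.single j 1)) := by
  set L := topSim h₁ h₂
  have hΦ : ∀ x, HasFDerivAt (fun x => L x + s) L x := fun x => L.hasFDerivAt.add_const s
  have hdiff : ∀ᶠ x in 𝓝 P, DifferentiableAt ℝ F (L x + s) := by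
    have h := hF.eventually (by simp)
    have h2 := (hΦ P).continuousAt.eventually h
    filter_upwards [h2] with x hx using hx.differentiableAt (by norm_num)
  have hfd : HasFDerivAt (fderiv ℝ F) (fderiv ℝ (fderiv ℝ F) (L P + s)) (L P + s) :=
    ((hF.fderiv_right (m := 1) (by norm_num)).differentiableAt (by norm_num)).hasFDerivAt
  have h1 : fderiv ℝ (fun x => k * (F (L x + s) - l x - d)) =ᶠ[𝓝 P]
      fun x => k • ((fderiv ℝ F (L x + s)).comp L - l) := by
    filter_upwards [hdiff] with x hx
    have h := hx.hasFDerivAt.comp x (hΦ x)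
    exact (((h.sub l.hasFDerivAt).sub_const d).const_mul k).fderiv
  have h2 : HasFDerivAt (fun x => k • ((fderiv ℝ F (L x + s)).comp L - l))
      (k • (((ContinuousLinearMap.compL ℝ (Fin 2 → ℝ) (Fin 2 → ℝ) ℝ).flip L).comp
        ((fderiv ℝ (fderiv ℝ F) (L P + s)).comp L))) P := by
    have h := hfd.comp P (hΦ P)
    have h' := ((ContinuousLinearMap.compL ℝ (Fin 2 → ℝ) (Fin 2 → ℝ) ℝ).flip L).hasFDerivAt.comp P h
    exact (h'.sub_const l).const_smul k
  simp only [shapeOperator, Matrix.of_apply]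
  rw [h1.fderiv_eq, h2.fderiv]
  simp

/-- A surface which a similarity maps into graphs with the right trace and determinant of the
Hessian has a constant ratio of principal curvatures. -/
theorem hasConstantRatio_of_graph {a : ℝ} (ha : a ≠ 0) {r : ℝ × ℝ → Fin 3 → ℝ}
    {D : Set (ℝ × ℝ)} {T : (Fin 3 → ℝ) → Fin 3 → ℝ} (hT : IsSimilarity T)
    (h : ∀ q ∈ D, ∃ F : (Fin 2 → ℝ) → ℝ, IsLocalGraphAt (fun w => T (r w)) D q F ∧
      ∀ H, H = shapeOperator F (topView (T (r q))) → H 0 0 * H 1 1 - H 0 1 * H 1 0 ≠ 0 ∧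
        a * (H 0 0 + H 1 1) ^ 2 = (a + 1) ^ 2 * (H 0 0 * H 1 1 - H 0 1 * H 1 0)) :
    HasConstantRatio r D a := by
  intro q hq
  obtain ⟨F, ⟨hF, hgr⟩, hH⟩ := h q hq
  obtain ⟨h₁, h₂, c₁, c₂, c₃, t, hh, hc, hT⟩ := hT
  have hT' : ∀ p, T p = simLin h₁ h₂ c₁ c₂ c₃ p + t := hT
  have htop : ∀ p, topView (T p) = topSim h₁ h₂ (topView p) + topView t := by
    intro p
    rw [hT', topView_add, topSim_apply]
    congr 1
    simp [topView, simLin_zero, simLin_one]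
  set P := topView (r q)
  let l : (Fin 2 → ℝ) →L[ℝ] ℝ := c₁ • ContinuousLinearMap.proj 0 + c₂ • ContinuousLinearMap.proj 1
  let f : (Fin 2 → ℝ) → ℝ := fun x => c₃⁻¹ * (F (topSim h₁ h₂ x + topView t) - l x - t 2)
  rw [htop] at hF
  have hf : ContDiffAt ℝ 2 f P := by
    have h1 : ContDiffAt ℝ 2 (fun x => F (topSim h₁ h₂ x + topView t)) P :=
      ContDiffAt.comp P (g := F) (f := fun x => topSim h₁ h₂ x + topView t) hF
        ((topSim h₁ h₂).contDiff.contDiffAt.add contDiffAt_const)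
    exact contDiffAt_const.mul ((h1.sub l.contDiff.contDiffAt).sub contDiffAt_const)
  have hgr' : ∀ᶠ w in 𝓝[D] q, r w 2 = f (topView (r w)) := by
    filter_upwards [hgr] with w hw
    simp only [f]
    rw [← htop, ← hw, hT']
    simp only [Pi.add_apply, simLin_two, l, topView, add_apply,
      smul_apply, ContinuousLinearMap.proj_apply, smul_eq_mul]
    simp only [Matrix.cons_val_zero, Matrix.cons_val_one]
    field_simp
    ring
  have hshape := fun i j => shapeOperator_comp_topSim (k := c₃⁻¹) (l := l) (d := t 2) hF i j
  obtain ⟨hdet, hratio⟩ := hH _ rfl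
  rw [htop] at hdet hratio
  simp only [shapeOperator, Matrix.of_apply] at hdet hratio
  change ∀ i j, shapeOperator f P i j = _ at hshape
  set B := fderiv ℝ (fderiv ℝ F) (topSim h₁ h₂ P + topView t)
  have hsingle0 : topSim h₁ h₂ (Pi.single 0 1) =
      h₁ • Pi.single (0 : Fin 2) (1 : ℝ) + h₂ • Pi.single (1 : Fin 2) (1 : ℝ) := by
    rw [topSim_apply, ← vec_two_eq]
    simp
  have hsingle1 : topSim h₁ h₂ (Pi.single 1 1) =
      (-h₂) • Pi.single (0 : Fin 2) (1 : ℝ) + h₁ • Pi.single (1 : Fin 2) (1 : ℝ) := by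
    rw [topSim_apply, ← vec_two_eq]
    simp
  have hsymm : shapeOperator f P 0 1 = shapeOperator f P 1 0 :=
    (hf.isSymmSndFDerivAt (by simp)).eq _ _
  have hdet' : shapeOperator f P 0 0 * shapeOperator f P 1 1 -
      shapeOperator f P 0 1 * shapeOperator f P 1 0 = c₃⁻¹ ^ 2 * (h₁ ^ 2 + h₂ ^ 2) ^ 2 *
      (B (Pi.single 0 1) (Pi.single 0 1) * B (Pi.single 1 1) (Pi.single 1 1) -
      B (Pi.single 0 1) (Pi.single 1 1) * B (Pi.single 1 1) (Pi.single 0 1)) := by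
    rw [hshape, hshape, hshape, hshape, hsingle0, hsingle1]
    simp only [map_add, map_smul, add_apply, smul_apply,
      smul_eq_mul]
    ring
  have htr' : shapeOperator f P 0 0 + shapeOperator f P 1 1 = c₃⁻¹ * (h₁ ^ 2 + h₂ ^ 2) *
      (B (Pi.single 0 1) (Pi.single 0 1) + B (Pi.single 1 1) (Pi.single 1 1)) := by
    rw [hshape, hshape, hsingle0, hsingle1]
    simp only [map_add, map_smul, add_apply, smul_apply,
      smul_eq_mul]
    ring
  obtain ⟨κ₁, κ₂, hκ, hκ'⟩ := exists_roots_of_trace_det ha (H := shapeOperator f P) hsymm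
    (by
      rw [hdet']
      exact mul_ne_zero (mul_ne_zero (pow_ne_zero 2 (inv_ne_zero hc))
        (pow_ne_zero 2 (sq_add_sq_ne_zero hh))) hdet)
    (by
      rw [hdet', htr']
      linear_combination (c₃⁻¹ * (h₁ ^ 2 + h₂ ^ 2)) ^ 2 * hratio)
  exact ⟨κ₁, κ₂, ⟨f, ⟨hf, hgr'⟩, hκ⟩, hκ'⟩

/-- The Hessian matrix from the partial derivatives `G₀`, `G₁` and their partial derivatives. -/
theorem shapeOperator_apply_eq {F G₀ G₁ : (Fin 2 → ℝ) → ℝ} {P : Fin 2 → ℝ}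
    (hG : ∀ᶠ x in 𝓝 P, HasFDerivAt F (G₀ x • ContinuousLinearMap.proj (R := ℝ) (φ := fun _ => ℝ)
      (0 : Fin 2) + G₁ x • ContinuousLinearMap.proj (R := ℝ) (φ := fun _ => ℝ) (1 : Fin 2)) x)
    {K₀ K₁ : (Fin 2 → ℝ) →L[ℝ] ℝ} (h0 : HasFDerivAt G₀ K₀ P) (h1 : HasFDerivAt G₁ K₁ P)
    (i : Fin 2) :
    shapeOperator F P i 0 = K₀ (Pi.single i 1) ∧ shapeOperator F P i 1 = K₁ (Pi.single i 1) := by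
  have e : fderiv ℝ F =ᶠ[𝓝 P] fun x => G₀ x • ContinuousLinearMap.proj (R := ℝ) (φ := fun _ => ℝ)
      (0 : Fin 2) + G₁ x • ContinuousLinearMap.proj (R := ℝ) (φ := fun _ => ℝ) (1 : Fin 2) := by
    filter_upwards [hG] with x hx using hx.fderiv
  have h2 := (h0.smul_const (ContinuousLinearMap.proj (R := ℝ) (φ := fun _ => ℝ) (0 : Fin 2))).add
    (h1.smul_const (ContinuousLinearMap.proj (R := ℝ) (φ := fun _ => ℝ) (1 : Fin 2)))
  simp only [shapeOperator, Matrix.of_apply]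
  rw [e.fderiv_eq]
  erw [h2.fderiv]
  simp

/-! ### The listed surfaces have a constant ratio -/

/-- Near each of its points the set `S` lies on a graph whose Hessian has at this point a nonzero
determinant and eigenvalues of ratio `a`. -/
def IsGraphWithRatio (a : ℝ) (S : Set (Fin 3 → ℝ)) : Prop :=
  ∀ p ∈ S, ∃ F : (Fin 2 → ℝ) → ℝ, ContDiffAt ℝ 2 F (topView p) ∧
    (∀ᶠ y in 𝓝 (topView p), ∀ x ∈ S, topView x = y → x 2 = F y) ∧
    ∀ H, H = shapeOperator F (topView p) → H 0 0 * H 1 1 - H 0 1 * H 1 0 ≠ 0 ∧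
      a * (H 0 0 + H 1 1) ^ 2 = (a + 1) ^ 2 * (H 0 0 * H 1 1 - H 0 1 * H 1 0)

theorem IsGraphWithRatio.hasConstantRatio {a : ℝ} (ha : a ≠ 0) {S : Set (Fin 3 → ℝ)}
    (hS : IsGraphWithRatio a S) {r : ℝ × ℝ → Fin 3 → ℝ} {D : Set (ℝ × ℝ)}
    (hr : ContinuousOn r D) (h : SimilarToSubset (r '' D) S) : HasConstantRatio r D a := by
  obtain ⟨T, hT, hTS⟩ := h
  refine hasConstantRatio_of_graph ha hT fun q hq => ?_
  have hmem : ∀ w ∈ D, T (r w) ∈ S := fun w hw =>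
    hTS (Set.mem_image_of_mem _ (Set.mem_image_of_mem _ hw))
  obtain ⟨F, hF, hgr, hH⟩ := hS _ (hmem q hq)
  refine ⟨F, ⟨hF, ?_⟩, hH⟩
  have hTc : Continuous T := by
    obtain ⟨h₁, h₂, c₁, c₂, c₃, t, -, -, hT⟩ := hT
    have hT' : T = fun p => simCLM h₁ h₂ c₁ c₂ c₃ p + t := funext hT
    rw [hT']
    fun_prop
  have hc : Filter.Tendsto (fun w => topView (T (r w))) (𝓝[D] q) (𝓝 (topView (T (r q)))) := by
    simp only [← topViewCLM_apply]
    exact ((topViewCLM.continuous.comp hTc).tendsto (r q)).comp (hr q hq)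
  filter_upwards [hc.eventually hgr, self_mem_nhdsWithin] with w hw hwD
  exact hw _ (hmem w hwD) rfl

theorem clm_ext_fin_two {K K' : (Fin 2 → ℝ) →L[ℝ] ℝ} (h0 : K (Pi.single 0 1) = K' (Pi.single 0 1))
    (h1 : K (Pi.single 1 1) = K' (Pi.single 1 1)) : K = K' := by
  ext x
  have : x = x 0 • Pi.single (0 : Fin 2) (1 : ℝ) + x 1 • Pi.single (1 : Fin 2) (1 : ℝ) := by
    ext i
    fin_cases i <;> simp
  rw [this]
  simp only [map_add, map_smul, h0, h1]

/-- The coordinate functions of the plane as continuous linear maps. -/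
noncomputable def coordCLM (i : Fin 2) : (Fin 2 → ℝ) →L[ℝ] ℝ :=
  ContinuousLinearMap.proj (R := ℝ) (φ := fun _ => ℝ) i

theorem hasFDerivAt_coord (i : Fin 2) (x : Fin 2 → ℝ) :
    HasFDerivAt (fun x : Fin 2 → ℝ => x i) (coordCLM i) x :=
  (coordCLM i).hasFDerivAt

theorem coordCLM_single (i j : Fin 2) :
    coordCLM i (Pi.single j 1) = (Pi.single j (1 : ℝ) : Fin 2 → ℝ) i := rfl

theorem isGraphWithRatio_paraboloid {a : ℝ} (ha : a ≠ 0) :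
    IsGraphWithRatio a (paraboloid a) := by
  intro p hp
  have hF : ContDiff ℝ 2 (fun x : Fin 2 → ℝ => x 1 ^ 2 + a * x 0 ^ 2) := by fun_prop
  refine ⟨fun x => x 1 ^ 2 + a * x 0 ^ 2, hF.contDiffAt, ?_, ?_⟩
  · refine Filter.Eventually.of_forall fun y x hx hxy => ?_
    obtain ⟨w, rfl⟩ := hx
    rw [← hxy]
    simp [topView]
  · intro H hH
    have hG : ∀ x : Fin 2 → ℝ, HasFDerivAt (fun x : Fin 2 → ℝ => x 1 ^ 2 + a * x 0 ^ 2)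
        ((2 * a * x 0) • coordCLM 0 + (2 * x 1) • coordCLM 1) x := by
      intro x
      refine (((hasFDerivAt_coord 1 x).pow 2).add
        (((hasFDerivAt_coord 0 x).pow 2).const_mul a)).congr_fderiv ?_
      apply clm_ext_fin_two
      · simp [coordCLM_single]
        ring
      · simp [coordCLM_single]
    have h := fun i => shapeOperator_apply_eq (P := topView p) (Filter.Eventually.of_forall hG)
      ((hasFDerivAt_coord 0 _).const_mul (2 * a)) ((hasFDerivAt_coord 1 _).const_mul 2) i
    rw [hH, (h 0).1, (h 0).2, (h 1).1, (h 1).2]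
    simp [coordCLM_single]
    exact ⟨ha, by ring⟩

/-- On the surface with `z = log |cos s| - log |cos y|` over `x = s + y` the parameter `s` is a
function of the top view: `exp (-z) = cos (x - s) / cos s = cos x + sin x tan s`. -/
theorem topView_logCos_eq {s y x z : ℝ} (hs : s + y ≠ 0)
    (h1 : s ∈ Set.Ioo (-(Real.pi / 2)) (Real.pi / 2))
    (h2 : y ∈ Set.Ioo (-(Real.pi / 2)) (Real.pi / 2)) (hx : x = s + y)
    (hz : z = Real.log |Real.cos s| - Real.log |Real.cos y|) :
    Real.sin x ≠ 0 ∧ s = Real.arctan ((Real.exp (-z) - Real.cos x) / Real.sin x) := by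
  have hc1 : 0 < Real.cos s := Real.cos_pos_of_mem_Ioo h1
  have hc2 : 0 < Real.cos y := Real.cos_pos_of_mem_Ioo h2
  have hsin : Real.sin x ≠ 0 := by
    rw [Ne, Real.sin_eq_zero_iff_of_lt_of_lt (by linarith [h1.1, h2.1, Real.pi_pos])
      (by linarith [h1.2, h2.2, Real.pi_pos]), hx]
    exact hs
  refine ⟨hsin, ?_⟩
  rw [← Real.arctan_tan h1.1 h1.2]
  congr 1
  rw [abs_of_pos hc1, abs_of_pos hc2, ← Real.log_div hc1.ne' hc2.ne'] at hz
  have he : Real.exp (-z) = Real.cos y / Real.cos s := by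
    rw [hz, Real.exp_neg, Real.exp_log (by positivity), inv_div]
  have hy : y = x - s := by linarith
  rw [he, Real.tan_eq_sin_div_cos]
  rw [hy, Real.cos_sub]
  field_simp
  ring

theorem isGraphWithRatio_logCosSurface : IsGraphWithRatio (-1) logCosSurface := by
  rintro p ⟨⟨s, y⟩, ⟨h1, h2, hsy⟩, rfl⟩
  set p : Fin 3 → ℝ := ![s + y, Real.log |Real.cos s| - Real.log |Real.cos y|, s]
  have hp0 : topView p 0 = s + y := rfl
  have hsin : Real.sin (topView p 0) ≠ 0 := (topView_logCos_eq hsy h1 h2 hp0 rfl).1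
  set F : (Fin 2 → ℝ) → ℝ :=
    fun x => Real.arctan ((Real.exp (-x 1) - Real.cos (x 0)) / Real.sin (x 0)) with hF
  -- the squared distance of `exp (-y)` from `exp (i x)`
  set E : (Fin 2 → ℝ) → ℝ := fun x => 1 - 2 * Real.exp (-x 1) * Real.cos (x 0) +
    Real.exp (-x 1) ^ 2 with hE
  have hEpos : ∀ x, Real.sin (x 0) ≠ 0 → 0 < E x := by
    intro x hx
    have : E x = Real.sin (x 0) ^ 2 + (Real.exp (-x 1) - Real.cos (x 0)) ^ 2 := by
      simp only [hE]
      linear_combination -Real.sin_sq_add_cos_sq (x 0)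
    rw [this]
    positivity
  refine ⟨F, ?_, ?_, ?_⟩
  · refine Real.contDiff_arctan.contDiffAt.comp _ (ContDiffAt.div ?_ ?_ hsin) <;> fun_prop
  · refine Filter.Eventually.of_forall fun y x hx hxy => ?_
    obtain ⟨⟨s', y'⟩, ⟨h1', h2', hsy'⟩, rfl⟩ := hx
    rw [← hxy]
    exact (topView_logCos_eq hsy' h1' h2' rfl rfl).2
  · intro H hH
    have hnhds : ∀ᶠ x in 𝓝 (topView p), Real.sin (x 0) ≠ 0 := by
      have : ContinuousAt (fun x : Fin 2 → ℝ => Real.sin (x 0)) (topView p) :=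
        (Real.continuous_sin.comp (continuous_apply 0)).continuousAt
      exact this.eventually_ne hsin
    have hG : ∀ᶠ x in 𝓝 (topView p), HasFDerivAt F
        (((1 - Real.exp (-x 1) * Real.cos (x 0)) / E x) • coordCLM 0 +
          (-(Real.exp (-x 1) * Real.sin (x 0)) / E x) • coordCLM 1) x := by
      filter_upwards [hnhds] with x hx
      have hE0 := hEpos x hx
      have hquot := ((((hasFDerivAt_coord 1 x).neg.exp).sub ((hasFDerivAt_coord 0 x).cos)).mul
        ((hasDerivAt_inv hx).comp_hasFDerivAt x ((hasFDerivAt_coord 0 x).sin))).arctan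
      refine hquot.congr_fderiv ?_
      have hden : 1 + ((Real.exp (-x 1) - Real.cos (x 0)) * (Real.sin (x 0))⁻¹) ^ 2 =
          E x / Real.sin (x 0) ^ 2 := by
        simp only [hE]
        field_simp
        linear_combination Real.sin_sq_add_cos_sq (x 0)
      apply clm_ext_fin_two
      · simp [coordCLM_single, hden]
        field_simp
        linear_combination Real.sin_sq_add_cos_sq (x 0)
      · simp [coordCLM_single, hden]
        field_simp
    have hE0 := hEpos _ hsin
    set x := topView p
    have hm : HasFDerivAt (fun x : Fin 2 → ℝ => Real.exp (-x 1))
        (Real.exp (-x 1) • -coordCLM 1) x := (hasFDerivAt_coord 1 x).neg.exp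
    have hc : HasFDerivAt (fun x : Fin 2 → ℝ => Real.cos (x 0))
        (-Real.sin (x 0) • coordCLM 0) x := (hasFDerivAt_coord 0 x).cos
    have hs : HasFDerivAt (fun x : Fin 2 → ℝ => Real.sin (x 0))
        (Real.cos (x 0) • coordCLM 0) x := (hasFDerivAt_coord 0 x).sin
    have hEd := (((hm.const_mul 2).mul hc).const_sub 1).add (hm.pow 2)
    have hEi := (hasDerivAt_inv hE0.ne').comp_hasFDerivAt x hEd
    have hG0 := ((hm.mul hc).const_sub 1).mul hEi
    have hG1 := ((hm.mul hs).neg).mul hEi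
    have h := fun i => shapeOperator_apply_eq (P := x) hG hG0 hG1 i
    rw [hH, (h 0).1, (h 0).2, (h 1).1, (h 1).2]
    simp [coordCLM_single]
    have hEx : E x = 1 - 2 * Real.exp (-x 1) * Real.cos (x 0) + Real.exp (-x 1) ^ 2 := rfl
    have hsc := Real.sin_sq_add_cos_sq (x 0)
    have hmpos := Real.exp_pos (-x 1)
    generalize Real.exp (-x 1) = m at *
    generalize Real.sin (x 0) = s at *
    generalize Real.cos (x 0) = c at *
    generalize E x = e at *
    have e00 : -((1 - m * c) * ((e ^ 2)⁻¹ * (2 * m * s))) + e⁻¹ * (m * s) =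
        m * s * (m ^ 2 - 1) / e ^ 2 := by
      field_simp
      linear_combination hEx
    have e11 : m * s * ((e ^ 2)⁻¹ * (c * (2 * m))) + -(m * s * ((e ^ 2)⁻¹ * (2 * m * m))) +
        e⁻¹ * (s * m) = -(m * s * (m ^ 2 - 1)) / e ^ 2 := by
      field_simp
      linear_combination hEx
    have e01 : m * s * ((e ^ 2)⁻¹ * (2 * m * s)) + -(e⁻¹ * (m * c)) =
        -(m * (c * (1 + m ^ 2) - 2 * m)) / e ^ 2 := by
      field_simp
      linear_combination -c * hEx + 2 * m * hsc
    have e10 : -((1 - m * c) * ((e ^ 2)⁻¹ * (c * (2 * m)))) +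
        (1 - m * c) * ((e ^ 2)⁻¹ * (2 * m * m)) + e⁻¹ * (c * m) =
        -(m * (c * (1 + m ^ 2) - 2 * m)) / e ^ 2 := by
      field_simp
      linear_combination c * hEx
    rw [e00, e11, e01, e10]
    refine ⟨?_, by ring⟩
    have : m * s * (m ^ 2 - 1) / e ^ 2 * (-(m * s * (m ^ 2 - 1)) / e ^ 2) -
        -(m * (c * (1 + m ^ 2) - 2 * m)) / e ^ 2 * (-(m * (c * (1 + m ^ 2) - 2 * m)) / e ^ 2) =
        -(m / e) ^ 2 := by
      field_simp
      rw [hEx]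
      linear_combination -(m ^ 2 - 1) ^ 2 * hsc
    rw [this]
    exact neg_ne_zero.2 (pow_ne_zero 2 (div_ne_zero hmpos.ne' hE0.ne'))

theorem exists_local_inverse {X : ℝ → ℝ} {d v₀ : ℝ} (hX : ContDiffAt ℝ 2 X v₀)
    (hd : HasDerivAt X d v₀) (h0 : d ≠ 0) :
    ∃ φ : ℝ → ℝ, ContDiffAt ℝ 2 φ (X v₀) ∧ φ (X v₀) = v₀ ∧ ∀ᶠ x in 𝓝 (X v₀), X (φ x) = x := by
  have hd' : HasFDerivAt X
      ((ContinuousLinearEquiv.unitsEquivAut ℝ (Units.mk0 d h0) : ℝ ≃L[ℝ] ℝ) : ℝ →L[ℝ] ℝ) v₀ := by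
    refine hd.hasFDerivAt.congr_fderiv ?_
    ext
    simp
  exact ⟨hX.localInverse hd' (by norm_num), hX.to_localInverse hd' (by norm_num),
    hX.localInverse_apply_image hd' (by norm_num),
    (hX.hasStrictFDerivAt' hd' (by norm_num)).eventually_right_inverse⟩

theorem hasDerivAt_add_mul_cos (b v : ℝ) :
    HasDerivAt (fun v => v + b * Real.cos v) (1 - b * Real.sin v) v := by
  refine ((hasDerivAt_id v).add ((Real.hasDerivAt_cos v).const_mul b)).congr_deriv ?_
  ring

theorem hasDerivAt_mul_sin_add_log {b v : ℝ} (h : b - Real.sin v ≠ 0) :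
    HasDerivAt (fun v => b * Real.sin v + (b ^ 2 - 1) * Real.log |b - Real.sin v|)
      (Real.cos v / (b - Real.sin v) * (1 - b * Real.sin v)) v := by
  simp only [Real.log_abs]
  refine (((Real.hasDerivAt_sin v).const_mul b).add
    ((((Real.hasDerivAt_sin v).const_sub b).log h).const_mul (b ^ 2 - 1))).congr_deriv ?_
  field_simp
  ring

theorem sq_ratio_param_sub_one {a : ℝ} (ha1 : a ≠ 1) :
    ((a + 1) / (a - 1)) ^ 2 - 1 = 4 * a / (a - 1) ^ 2 := by
  have : a - 1 ≠ 0 := sub_ne_zero.2 ha1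
  field_simp
  ring

/-- Of the two inequalities for the parameter `v`, one is the assumption and the other one holds
automatically: `|b| < 1` for `a < 0` and `|b| > 1` for `a > 0`. -/
theorem IsParameterInterval.ne_zero {a : ℝ} (ha : a ≠ 0) (ha1 : a ≠ 1) {V : Set ℝ}
    (hV : IsParameterInterval a ((a + 1) / (a - 1)) V) {v : ℝ} (hv : v ∈ V) :
    1 - (a + 1) / (a - 1) * Real.sin v ≠ 0 ∧ (a + 1) / (a - 1) - Real.sin v ≠ 0 := by
  have hb := sq_ratio_param_sub_one ha1
  set b := (a + 1) / (a - 1)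
  have ha1' : 0 < (a - 1) ^ 2 := by
    have : a - 1 ≠ 0 := sub_ne_zero.2 ha1
    positivity
  have hs : Real.sin v ^ 2 ≤ 1 := Real.sin_sq_le_one v
  rcases lt_or_gt_of_ne ha with h | h
  · have hb1 : b ^ 2 - 1 < 0 := by
      rw [hb]
      exact div_neg_of_neg_of_pos (by linarith) ha1'
    refine ⟨fun h0 => ?_, fun h0 => (hV.2 v hv).1 h (by linarith)⟩
    have h1 : (b * Real.sin v) ^ 2 = 1 := by
      rw [show b * Real.sin v = 1 by linarith]; norm_num
    nlinarith [sq_nonneg b, sq_nonneg (Real.sin v)]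
  · have hb1 : 0 < b ^ 2 - 1 := by
      rw [hb]
      positivity
    refine ⟨fun h0 => (hV.2 v hv).2 h (by linarith), fun h0 => ?_⟩
    have h1 : b = Real.sin v := by linarith
    rw [h1] at hb1
    linarith

/-- Near each of its points, the surface `r_b` is the graph of
`exp ((y - Y (φ x)) / (1 - b²))`, where `(X, Y)` is the profile curve and `φ` is an inverse of `X`.
The local inverse extends to the whole interval `V`, on which `X` is injective. -/
theorem isGraphWithRatio_expSurface {a : ℝ} (ha : a ≠ 0) (ha1 : a ≠ 1) {V : Set ℝ}
    (hV : IsParameterInterval a ((a + 1) / (a - 1)) V) :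
    IsGraphWithRatio a (expSurface ((a + 1) / (a - 1)) V) := by
  have hne := fun v hv => hV.ne_zero ha ha1 (v := v) hv
  have hb := sq_ratio_param_sub_one ha1
  have ha1' : a - 1 ≠ 0 := sub_ne_zero.2 ha1
  have hba : (a + 1) ^ 2 * (((a + 1) / (a - 1)) ^ 2 - 1) = 4 * a * ((a + 1) / (a - 1)) ^ 2 := by
    rw [hb]
    field_simp
  have hb1 : 1 - ((a + 1) / (a - 1)) ^ 2 ≠ 0 := by
    intro h0
    have h1 : 4 * a / (a - 1) ^ 2 = 0 := by rw [← hb]; linarith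
    simp [ha, ha1'] at h1
  set b := (a + 1) / (a - 1)
  rintro p ⟨⟨u, v₀⟩, ⟨-, hv₀⟩, rfl⟩
  obtain ⟨hd0, hs0⟩ := hne v₀ hv₀
  set X : ℝ → ℝ := fun v => v + b * Real.cos v with hX
  set Y : ℝ → ℝ := fun v => b * Real.sin v + (b ^ 2 - 1) * Real.log |b - Real.sin v| with hY
  set p := expMap b (u, v₀)
  have hp0 : topView p 0 = X v₀ := rfl
  obtain ⟨φ, hφ, hφ0, hφX⟩ := exists_local_inverse (X := X)
    (contDiffAt_id.add (contDiffAt_const.mul Real.contDiff_cos.contDiffAt))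
    (hasDerivAt_add_mul_cos b v₀) hd0
  -- the profile curve is regular at the parameters near `v₀`
  have hreg : ∀ᶠ v in 𝓝 v₀, 1 - b * Real.sin v ≠ 0 ∧ b - Real.sin v ≠ 0 := by
    have h1 : ContinuousAt (fun v => 1 - b * Real.sin v) v₀ :=
      (continuous_const.sub (continuous_const.mul Real.continuous_sin)).continuousAt
    have h2 : ContinuousAt (fun v => b - Real.sin v) v₀ :=
      (continuous_const.sub Real.continuous_sin).continuousAt
    exact (h1.eventually_ne hd0).and (h2.eventually_ne hs0)
  obtain ⟨ε, hε, hball⟩ := Metric.eventually_nhds_iff_ball.1 hreg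
  have hφc : Filter.Tendsto φ (𝓝 (X v₀)) (𝓝 v₀) := by
    simpa [hφ0] using hφ.continuousAt.tendsto
  have hnear : ∀ᶠ x in 𝓝 (X v₀), X (φ x) = x ∧ φ x ∈ Metric.ball v₀ ε ∧ ContinuousAt φ x := by
    filter_upwards [hφX, hφc.eventually (Metric.ball_mem_nhds v₀ hε), hφ.eventually (by simp)]
      with x h1 h2 h3 using ⟨h1, h2, h3.continuousAt⟩
  have hinj : Set.InjOn X (V ∪ Metric.ball v₀ ε) := by
    refine injOn_of_hasDerivWithinAt_ne_zero ?_ (f' := fun v => 1 - b * Real.sin v)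
      (fun v _ => (hasDerivAt_add_mul_cos b v).hasDerivWithinAt) ?_
    · exact (hV.1.isPreconnected.union v₀ hv₀ (Metric.mem_ball_self hε)
        (convex_ball v₀ ε).isPreconnected).ordConnected
    · rintro v (hv | hv)
      · exact (hne v hv).1
      · exact (hball v hv).1
  have hφd : ∀ᶠ x in 𝓝 (X v₀), HasDerivAt φ (1 - b * Real.sin (φ x))⁻¹ x := by
    filter_upwards [hnear, eventually_eventually_nhds.2 hφX] with x hx hx'
    exact HasDerivAt.of_local_left_inverse hx.2.2 (hasDerivAt_add_mul_cos b (φ x))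
      (hball _ hx.2.1).1 hx'
  have hYφ : ∀ᶠ x in 𝓝 (X v₀),
      HasDerivAt (fun x => Y (φ x)) (Real.cos (φ x) / (b - Real.sin (φ x))) x := by
    filter_upwards [hφd, hnear] with x h1 h2
    have h3 := hball _ h2.2.1
    refine ((hasDerivAt_mul_sin_add_log h3.2).comp x h1).congr_deriv ?_
    have := h3.1
    have := h3.2
    field_simp
  set F : (Fin 2 → ℝ) → ℝ := fun x => Real.exp ((x 1 - Y (φ (x 0))) * (1 - b ^ 2)⁻¹) with hF
  have hcoord : Filter.Tendsto (fun x : Fin 2 → ℝ => x 0) (𝓝 (topView p)) (𝓝 (X v₀)) :=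
    (continuous_apply 0).tendsto (topView p)
  refine ⟨F, ?_, ?_, ?_⟩
  · have h1 : ContDiffAt ℝ 2 (fun x : Fin 2 → ℝ => x 0) (topView p) := by fun_prop
    have h2 : ContDiffAt ℝ 2 (fun x : Fin 2 → ℝ => φ (x 0)) (topView p) :=
      ContDiffAt.comp (topView p) (g := φ) (f := fun x : Fin 2 → ℝ => x 0) hφ h1
    have h3 : ContDiffAt ℝ 2 Y v₀ := by
      simp only [hY, Real.log_abs]
      exact (contDiffAt_const.mul Real.contDiff_sin.contDiffAt).add (contDiffAt_const.mul
        ((contDiffAt_const.sub Real.contDiff_sin.contDiffAt).log hs0))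
    have h4 : ContDiffAt ℝ 2 (fun x : Fin 2 → ℝ => Y (φ (x 0))) (topView p) := by
      refine ContDiffAt.comp (topView p) (g := Y) (f := fun x : Fin 2 → ℝ => φ (x 0)) ?_ h2
      rw [hp0, hφ0]
      exact h3
    have h5 : ContDiffAt ℝ 2 (fun x : Fin 2 → ℝ => x 1) (topView p) := by fun_prop
    exact ((h5.sub h4).mul contDiffAt_const).exp
  · filter_upwards [hcoord.eventually hnear] with y hy x hx hxy
    obtain ⟨⟨u', v⟩, ⟨-, hv⟩, rfl⟩ := hx
    subst hxy
    have e0 : topView (expMap b (u', v)) 0 = X v := rfl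
    have e1 : topView (expMap b (u', v)) 1 = Y v + (1 - b ^ 2) * u' := rfl
    rw [e0] at hy
    have hvφ : φ (X v) = v := hinj (Or.inr hy.2.1) (Or.inl hv) hy.1
    simp only [hF, e0, e1, hvφ]
    change Real.exp u' = _
    congr 1
    field_simp
    ring
  · intro H hH
    have hYd : ∀ᶠ x in 𝓝 (topView p), HasFDerivAt (fun x : Fin 2 → ℝ => Y (φ (x 0)))
        ((Real.cos (φ (x 0)) / (b - Real.sin (φ (x 0)))) • coordCLM 0) x := by
      filter_upwards [hcoord.eventually hYφ] with x hx
      exact HasDerivAt.comp_hasFDerivAt (f := fun x : Fin 2 → ℝ => x 0) x hx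
        (hasFDerivAt_coord 0 x)
    have hFd : ∀ᶠ x in 𝓝 (topView p), HasFDerivAt F
        (F x • (1 - b ^ 2)⁻¹ • (coordCLM 1 -
          (Real.cos (φ (x 0)) / (b - Real.sin (φ (x 0)))) • coordCLM 0)) x := by
      filter_upwards [hYd] with x hx
      exact (((hasFDerivAt_coord 1 x).sub hx).mul_const (1 - b ^ 2)⁻¹).exp
    have hG : ∀ᶠ x in 𝓝 (topView p), HasFDerivAt F
        ((-(1 - b ^ 2)⁻¹ * (F x * (Real.cos (φ (x 0)) * (b - Real.sin (φ (x 0)))⁻¹))) • coordCLM 0 +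
          ((1 - b ^ 2)⁻¹ * F x) • coordCLM 1) x := by
      filter_upwards [hFd] with x hx
      refine hx.congr_fderiv ?_
      apply clm_ext_fin_two
      · simp [coordCLM_single]
        ring
      · simp [coordCLM_single]
        ring
    have hφ' : HasFDerivAt (fun x : Fin 2 → ℝ => φ (x 0)) ((1 - b * Real.sin v₀)⁻¹ • coordCLM 0)
        (topView p) := by
      have h1 := hφd.self_of_nhds
      rw [hφ0] at h1
      exact HasDerivAt.comp_hasFDerivAt (f := fun x : Fin 2 → ℝ => x 0) (topView p) h1
        (hasFDerivAt_coord 0 _)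
    have hF' := hFd.self_of_nhds
    have hs' : b - Real.sin (φ (topView p 0)) ≠ 0 := by rw [hp0, hφ0]; exact hs0
    have hG0 := ((hF'.mul (hφ'.cos.mul ((hasDerivAt_inv hs').comp_hasFDerivAt
      (f := fun x : Fin 2 → ℝ => b - Real.sin (φ (x 0))) _ (hφ'.sin.const_sub b)))).const_mul
      (-(1 - b ^ 2)⁻¹))
    have hG1 := hF'.const_mul (1 - b ^ 2)⁻¹
    have h := fun i => shapeOperator_apply_eq (P := topView p) hG hG0 hG1 i
    have hFpos : 0 < F (topView p) := Real.exp_pos _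
    rw [hH, (h 0).1, (h 0).2, (h 1).1, (h 1).2]
    simp only [hp0, hφ0]
    simp [coordCLM_single, hp0, hφ0]
    have hsc := Real.sin_sq_add_cos_sq v₀
    generalize F (topView p) = f at *
    generalize Real.sin v₀ = s at *
    generalize Real.cos v₀ = c at *
    have e00 : -((1 - b ^ 2)⁻¹ * (f * (c * (((b - s) ^ 2)⁻¹ * (c * (1 - b * s)⁻¹))))) +
        (1 - b ^ 2)⁻¹ * (f * ((b - s)⁻¹ * (s * (1 - b * s)⁻¹))) +
        (1 - b ^ 2)⁻¹ * (c * (b - s)⁻¹ * (f * ((1 - b ^ 2)⁻¹ * (c / (b - s))))) =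
        f * (c ^ 2 - (1 - b ^ 2)) / ((1 - b ^ 2) ^ 2 * (b - s) ^ 2) := by
      field_simp
      linear_combination -(1 - b ^ 2) * hsc
    rw [e00]
    have hdet : f * (c ^ 2 - (1 - b ^ 2)) / ((1 - b ^ 2) ^ 2 * (b - s) ^ 2) *
        ((1 - b ^ 2)⁻¹ * (f * (1 - b ^ 2)⁻¹)) -
        (1 - b ^ 2)⁻¹ * (f * ((1 - b ^ 2)⁻¹ * (c / (b - s)))) *
        ((1 - b ^ 2)⁻¹ * (c * (b - s)⁻¹ * (f * (1 - b ^ 2)⁻¹))) =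
        -f ^ 2 / ((1 - b ^ 2) ^ 3 * (b - s) ^ 2) := by
      field_simp
      ring
    have htr : f * (c ^ 2 - (1 - b ^ 2)) / ((1 - b ^ 2) ^ 2 * (b - s) ^ 2) +
        (1 - b ^ 2)⁻¹ * (f * (1 - b ^ 2)⁻¹) = 2 * b * f / ((1 - b ^ 2) ^ 2 * (b - s)) := by
      field_simp
      linear_combination hsc
    rw [hdet, htr]
    refine ⟨div_ne_zero (neg_ne_zero.2 (pow_ne_zero 2 hFpos.ne')) (mul_ne_zero
      (pow_ne_zero 3 hb1) (pow_ne_zero 2 hs0)), ?_⟩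
    field_simp
    linear_combination -hba

/-! ### Recognizing the profile curve and the paraboloid -/

theorem exists_cos_sin_eq {c s : ℝ} (h : c ^ 2 + s ^ 2 = 1) :
    ∃ θ : ℝ, Real.cos θ = c ∧ Real.sin θ = s := by
  have hn : ‖(⟨c, s⟩ : ℂ)‖ = 1 := by
    rw [Complex.norm_def, Complex.normSq_mk, ← sq, ← sq, h, Real.sqrt_one]
  have h0 : (⟨c, s⟩ : ℂ) ≠ 0 := by
    intro h0
    rw [h0, norm_zero] at hn
    exact zero_ne_one hn
  refine ⟨Complex.arg ⟨c, s⟩, ?_, ?_⟩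
  · rw [Complex.cos_arg h0, hn, div_one]
  · rw [Complex.sin_arg, hn, div_one]

/-- A plane curve `(t, y)` of slope `w`, whose second derivative `k²` with respect to `t` satisfies
`1 + w² + (b² - 1) k² = 2 b k`, is a piece of the profile curve of the surface `r_b`: the point
`(w / k, b - 1 / k)` of the unit circle has the angle `θ = t - b w / k + c`, and this angle is the
parameter of the profile curve. -/
theorem exists_angle {J : Set ℝ} (hJ : J.OrdConnected) (hJu : UniqueDiffOn ℝ J) {b : ℝ}
    {t t' y w k k' : ℝ → ℝ} (ht : ∀ v ∈ J, HasDerivWithinAt t (t' v) J v)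
    (hy : ∀ v ∈ J, HasDerivWithinAt y (w v * t' v) J v)
    (hw : ∀ v ∈ J, HasDerivWithinAt w (k v ^ 2 * t' v) J v)
    (hk : ∀ v ∈ J, HasDerivWithinAt k (k' v) J v) (ht0 : ∀ v ∈ J, t' v ≠ 0)
    (hk0 : ∀ v ∈ J, k v ≠ 0)
    (hrel : ∀ v ∈ J, 1 + w v ^ 2 + (b ^ 2 - 1) * k v ^ 2 = 2 * b * k v) :
    ∃ (θ : ℝ → ℝ) (c₀ c₁ : ℝ), ContinuousOn θ J ∧ ∀ v ∈ J,
      t v = θ v + b * Real.cos (θ v) + c₀ ∧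
      y v = b * Real.sin (θ v) + (b ^ 2 - 1) * Real.log |b - Real.sin (θ v)| + c₁ ∧
      b * Real.sin (θ v) ≠ 1 ∧ Real.sin (θ v) ≠ b := by
  rcases J.eq_empty_or_nonempty with rfl | ⟨v₀, hv₀⟩
  · exact ⟨fun _ => 0, 0, 0, continuousOn_empty _, fun v hv => absurd hv (by simp)⟩
  -- the derivative of the relation between `w` and `k`
  have hrel' : ∀ v ∈ J, w v * k v ^ 2 * t' v = k' v * (b - (b ^ 2 - 1) * k v) := by
    intro v hv
    have h1 := (((hw v hv).pow 2).const_add 1).add (((hk v hv).pow 2).const_mul (b ^ 2 - 1))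
    have h2 := ((hk v hv).const_mul (2 * b)).congr hrel (hrel v hv)
    have := (hJu v hv).eq_deriv _ h1 h2
    simp at this
    linarith
  obtain ⟨θ₀, hc0, hs0⟩ := exists_cos_sin_eq (c := w v₀ / k v₀) (s := b - (k v₀)⁻¹) (by
    have := hk0 v₀ hv₀
    have := hrel v₀ hv₀
    field_simp
    linarith)
  set C : ℝ → ℝ := fun v => w v / k v with hC
  set S : ℝ → ℝ := fun v => b - (k v)⁻¹ with hS
  set C' : ℝ → ℝ := fun v => k v * t' v - w v * k' v / k v ^ 2 with hC'
  set T : ℝ → ℝ := fun v => t' v - b * C' v with hT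
  have hCd : ∀ v ∈ J, HasDerivWithinAt C (C' v) J v := by
    intro v hv
    have h0 := hk0 v hv
    refine ((hw v hv).div (hk v hv) h0).congr_deriv ?_
    simp only [hC']
    field_simp
  have hSd : ∀ v ∈ J, HasDerivWithinAt S (k' v / k v ^ 2) J v := by
    intro v hv
    refine (((hk v hv).inv (hk0 v hv)).const_sub b).congr_deriv ?_
    ring
  set θ : ℝ → ℝ := fun v => t v - b * C v + (θ₀ - t v₀ + b * C v₀) with hθ
  have hθd : ∀ v ∈ J, HasDerivWithinAt θ (T v) J v := fun v hv =>
    ((ht v hv).sub ((hCd v hv).const_mul b)).add_const _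
  have hSC : ∀ v ∈ J, k' v / k v ^ 2 = C v * T v := by
    intro v hv
    have h0 := hk0 v hv
    simp only [hC, hT, hC']
    field_simp
    linear_combination (-1 + b * k v) * hrel' v hv - b * k' v * hrel v hv
  have hCS : ∀ v ∈ J, C' v = -S v * T v := by
    intro v hv
    have h0 := hk0 v hv
    simp only [hS, hT, hC']
    field_simp
    linear_combination w v * hrel' v hv - k v ^ 2 * t' v * hrel v hv
  have hone : ∀ v ∈ J, C v ^ 2 + S v ^ 2 = 1 := by
    intro v hv
    have := hk0 v hv
    have := hrel v hv
    simp only [hC, hS]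
    field_simp
    linarith
  have hθ0 : θ v₀ = θ₀ := by simp only [hθ]; ring
  have hinner : ∀ v ∈ J, C v * Real.cos (θ v) + S v * Real.sin (θ v) = 1 := by
    intro v hv
    have h := eq_of_hasDerivWithinAt_zero hJ
      (f := fun v => C v * Real.cos (θ v) + S v * Real.sin (θ v)) (fun v hv => by
        refine (((hCd v hv).mul (hθd v hv).cos).add
          ((hSd v hv).mul (hθd v hv).sin)).congr_deriv ?_
        rw [hSC v hv, hCS v hv]
        ring) hv hv₀
    simp only [hθ0, hc0, hs0] at h
    rw [h]
    have := hone v₀ hv₀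
    simp only [hC, hS] at this ⊢
    linarith
  have hcs : ∀ v ∈ J, Real.cos (θ v) = C v ∧ Real.sin (θ v) = S v := by
    intro v hv
    have h1 := hinner v hv
    have h2 := hone v hv
    have h3 := Real.sin_sq_add_cos_sq (θ v)
    have h4 : (Real.cos (θ v) - C v) ^ 2 + (Real.sin (θ v) - S v) ^ 2 = 0 := by
      linear_combination h2 + h3 - 2 * h1
    constructor
    · nlinarith [sq_nonneg (Real.cos (θ v) - C v), sq_nonneg (Real.sin (θ v) - S v)]
    · nlinarith [sq_nonneg (Real.cos (θ v) - C v), sq_nonneg (Real.sin (θ v) - S v)]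
  have hbs : ∀ v ∈ J, b - Real.sin (θ v) = (k v)⁻¹ := by
    intro v hv
    rw [(hcs v hv).2]
    simp [hS]
  have hbs0 : ∀ v ∈ J, b - Real.sin (θ v) ≠ 0 := fun v hv => by
    rw [hbs v hv]; exact inv_ne_zero (hk0 v hv)
  have hTt : ∀ v ∈ J, (1 - b * S v) * T v = t' v := by
    intro v hv
    have : T v = t' v - b * C' v := rfl
    rw [hCS v hv] at this
    linarith
  obtain ⟨c₁, hc₁⟩ := exists_eq_add_of_hasDerivWithinAt hJ (g := fun v =>
    b * Real.sin (θ v) + (b ^ 2 - 1) * Real.log |b - Real.sin (θ v)|) hy (fun v hv => by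
      refine ((hasDerivAt_mul_sin_add_log (hbs0 v hv)).comp_hasDerivWithinAt v
        (hθd v hv)).congr_deriv ?_
      rw [hbs v hv, mul_assoc, (hcs v hv).1, (hcs v hv).2, hTt v hv]
      simp only [hC]
      have := hk0 v hv
      field_simp)
  refine ⟨θ, -(θ₀ - t v₀ + b * C v₀), c₁, fun v hv => (hθd v hv).continuousWithinAt,
    fun v hv => ⟨?_, hc₁ v hv, ?_, fun h => hbs0 v hv (by linarith)⟩⟩
  · rw [(hcs v hv).1]
    simp only [hθ]
    ring
  · intro h
    rw [(hcs v hv).2] at h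
    apply ht0 v hv
    rw [← hTt v hv, h]
    ring

/-- A quadratic form of the plane with eigenvalues `a l` and `l` in coordinates rotated by the
direction `(h₁, h₂)`. -/
theorem exists_diagonalization {a H₀ H₁ H₂ : ℝ} (ha : a ≠ 0) (hdet : H₀ * H₂ - H₁ ^ 2 ≠ 0)
    (h : a * (H₀ + H₂) ^ 2 = (a + 1) ^ 2 * (H₀ * H₂ - H₁ ^ 2)) :
    ∃ l h₁ h₂ : ℝ, l ≠ 0 ∧ (h₁ ≠ 0 ∨ h₂ ≠ 0) ∧
      H₀ * (h₁ ^ 2 + h₂ ^ 2) = l * (a * h₁ ^ 2 + h₂ ^ 2) ∧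
      H₂ * (h₁ ^ 2 + h₂ ^ 2) = l * (a * h₂ ^ 2 + h₁ ^ 2) ∧
      H₁ * (h₁ ^ 2 + h₂ ^ 2) = l * (1 - a) * (h₁ * h₂) := by
  obtain ⟨l, htr, hdt⟩ : ∃ l, H₀ + H₂ = (1 + a) * l ∧ H₀ * H₂ - H₁ ^ 2 = a * l ^ 2 := by
    by_cases ha1 : a + 1 = 0
    · have ha' : a = -1 := by linarith
      subst ha'
      have htr : H₀ + H₂ = 0 := by
        have : (H₀ + H₂) ^ 2 = 0 := by linear_combination -h
        exact (pow_eq_zero_iff two_ne_zero).1 this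
      have hH : H₂ = -H₀ := by linarith
      refine ⟨√(H₀ ^ 2 + H₁ ^ 2), by rw [htr]; ring, ?_⟩
      rw [Real.sq_sqrt (by positivity), hH]
      ring
    · have ha1' : 1 + a ≠ 0 := by rwa [add_comm]
      refine ⟨(H₀ + H₂) / (1 + a), by field_simp, ?_⟩
      field_simp
      linear_combination -h
  have hl : l ≠ 0 := by
    rintro rfl
    apply hdet
    rw [hdt]
    ring
  by_cases ha1 : a = 1
  · subst ha1
    have h0 : (H₀ - H₂) ^ 2 + (2 * H₁) ^ 2 = 0 := by
      linear_combination (H₀ + H₂ + 2 * l) * htr - 4 * hdt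
    have e1 : H₀ = H₂ := by nlinarith [sq_nonneg (H₀ - H₂), sq_nonneg (2 * H₁)]
    have e2 : H₁ = 0 := by nlinarith [sq_nonneg (H₀ - H₂), sq_nonneg (2 * H₁)]
    refine ⟨l, 1, 0, hl, by simp, ?_, ?_, ?_⟩
    · linarith
    · linarith
    · rw [e2]; ring
  -- the matrix minus `a l` has rank one, and its image is the axis of the eigenvalue `l`
  by_cases hM : H₀ - a * l = 0
  · have e1 : H₁ = 0 := by
      have : H₁ ^ 2 = 0 := by linear_combination -hdt + H₂ * hM + a * l * (htr - hM)
      exact (pow_eq_zero_iff two_ne_zero).1 this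
    refine ⟨l, 1, 0, hl, by simp, by linarith, by linarith, by rw [e1]; ring⟩
  · have hsq : (H₀ - a * l) * (H₂ - a * l) = H₁ ^ 2 := by
      linear_combination hdt - a * l * htr
    refine ⟨l, H₁, H₀ - a * l, hl, Or.inr hM, ?_, ?_, ?_⟩
    · linear_combination -(H₀ - a * l) * hsq + (H₀ - a * l) ^ 2 * htr
    · linear_combination -(H₂ - l) * hsq + (H₀ - a * l) * (H₂ - a * l) * htr
    · linear_combination -H₁ * hsq + H₁ * (H₀ - a * l) * htr

/-- The graph of a quadratic function whose Hessian has eigenvalues of ratio `a`. -/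
theorem similarToSubset_paraboloid {a H₀ H₁ H₂ l₀ l₁ d : ℝ} (ha : a ≠ 0)
    (hdet : H₀ * H₂ - H₁ ^ 2 ≠ 0)
    (h : a * (H₀ + H₂) ^ 2 = (a + 1) ^ 2 * (H₀ * H₂ - H₁ ^ 2)) {M : Set (Fin 3 → ℝ)}
    (hM : ∀ p ∈ M, p 2 = (H₀ * p 0 ^ 2 + 2 * H₁ * (p 0 * p 1) + H₂ * p 1 ^ 2) / 2
      + l₀ * p 0 + l₁ * p 1 + d) : SimilarToSubset M (paraboloid a) := by
  obtain ⟨l, h₁, h₂, hl, hh, e0, e2, e1⟩ := exists_diagonalization ha hdet h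
  have hn := sq_add_sq_ne_zero hh
  set c := 2 * (h₁ ^ 2 + h₂ ^ 2) / l with hc
  have hc0 : c ≠ 0 := div_ne_zero (mul_ne_zero two_ne_zero hn) hl
  refine ⟨_, isSimilarity_simLin (c₃ := c) hh (-c * l₀) (-c * l₁) hc0 ![0, 0, -c * d], ?_⟩
  rintro _ ⟨p, hp, rfl⟩
  refine ⟨(h₁ * p 0 - h₂ * p 1, h₂ * p 0 + h₁ * p 1), ?_⟩
  apply ext_fin_three
  · simp [simLin_zero]
  · simp [simLin_one]
  · simp only [Pi.add_apply, simLin_two, hM p hp]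
    simp [hc]
    field_simp
    linear_combination -p 0 ^ 2 * e0 - p 1 ^ 2 * e2 - 2 * p 0 * p 1 * e1

/-! ### A curve in an isotropic plane -/

/-- The derivative of the `i`-th coordinate of a curve with respect to the `j`-th coordinate. -/
noncomputable def slope (i j : Fin 3) (γ₁ : ℝ → Fin 3 → ℝ) (v : ℝ) : ℝ := γ₁ v i / γ₁ v j

/-- The second derivative of the `i`-th coordinate of a curve with respect to the `j`-th
coordinate. -/
noncomputable def slope₂ (i j : Fin 3) (γ₁ γ₂ : ℝ → Fin 3 → ℝ) (v : ℝ) : ℝ :=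
  (γ₂ v i * γ₁ v j - γ₁ v i * γ₂ v j) / γ₁ v j ^ 3

theorem HasSecondJet.hasDerivWithinAt_slope {J : Set ℝ} {γ γ₁ γ₂ : ℝ → Fin 3 → ℝ}
    (h : HasSecondJet J γ γ₁ γ₂) (i j : Fin 3) {v : ℝ} (hv : v ∈ J) (h0 : γ₁ v j ≠ 0) :
    HasDerivWithinAt (slope i j γ₁) (slope₂ i j γ₁ γ₂ v * γ₁ v j) J v := by
  refine ((h.coord₂ hv i).div (h.coord₂ hv j) h0).congr_deriv ?_
  unfold slope₂
  field_simp

theorem HasSecondJet.differentiableOn_slope₂ {J : Set ℝ} {γ γ₁ γ₂ : ℝ → Fin 3 → ℝ}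
    (h : HasSecondJet J γ γ₁ γ₂) (i j : Fin 3) (h0 : ∀ v ∈ J, γ₁ v j ≠ 0) :
    DifferentiableOn ℝ (slope₂ i j γ₁ γ₂) J := by
  have d1 : ∀ i, DifferentiableOn ℝ (fun v => γ₁ v i) J := fun i v hv =>
    (h.coord₂ hv i).differentiableWithinAt
  have d2 := h.coord_diff
  exact (((d2 i).mul (d1 j)).sub ((d1 i).mul (d2 j))).div ((d1 j).pow 3)
    (fun v hv => pow_ne_zero 3 (h0 v hv))

theorem HasSecondJet.coord₁_eq {J : Set ℝ} {γ γ₁ γ₂ : ℝ → Fin 3 → ℝ}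
    (h : HasSecondJet J γ γ₁ γ₂) (i j : Fin 3) {v : ℝ} (hv : v ∈ J) (h0 : γ₁ v j ≠ 0) :
    HasDerivWithinAt (fun v => γ v i) (slope i j γ₁ v * γ₁ v j) J v := by
  refine (h.coord₁ hv i).congr_deriv ?_
  unfold slope
  field_simp

variable {a : ℝ} {I J : Set ℝ} {α α₁ α₂ β β₁ β₂ : ℝ → Fin 3 → ℝ}

theorem RatioPair.uniqI (h : RatioPair a I J α α₁ α₂ β β₁ β₂) : UniqueDiffOn ℝ I :=
  uniqueDiffOn_of_interior_nonempty h.ordI h.intI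

theorem RatioPair.uniqJ (h : RatioPair a I J α α₁ α₂ β β₁ β₂) : UniqueDiffOn ℝ J :=
  uniqueDiffOn_of_interior_nonempty h.ordJ h.intJ

theorem HasSecondJet.coord₂_eq_zero {γ γ₁ γ₂ : ℝ → Fin 3 → ℝ} (h : HasSecondJet J γ γ₁ γ₂)
    (hJ : UniqueDiffOn ℝ J) {i : Fin 3} (h0 : ∀ v ∈ J, γ₁ v i = 0) {v : ℝ} (hv : v ∈ J) :
    γ₂ v i = 0 :=
  (hJ v hv).eq_deriv _ (h.coord₂ hv i)
    ((hasDerivWithinAt_const v J (0 : ℝ)).congr h0 (h0 v hv))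

/-- The ratio condition for a curve `α` in a plane `y = const`: with `α = (x, y₀, z(x))` and
`β = (X(y), y, Z(y))` it relates `z''` to `X''` and `Z''`. -/
theorem RatioPair.slope_rel (h : RatioPair a I J α α₁ α₂ β β₁ β₂) (hα : ∀ u ∈ I, α₁ u 1 = 0)
    {u v : ℝ} (hu : u ∈ I) (hv : v ∈ J) :
    α₁ u 0 ≠ 0 ∧ β₁ v 1 ≠ 0 ∧ slope₂ 2 0 α₁ α₂ u ≠ 0 ∧
    slope₂ 2 1 β₁ β₂ v - slope 2 0 α₁ u * slope₂ 0 1 β₁ β₂ v ≠ 0 ∧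
    a * (slope₂ 2 0 α₁ α₂ u * (1 + slope 0 1 β₁ v ^ 2) +
      (slope₂ 2 1 β₁ β₂ v - slope 2 0 α₁ u * slope₂ 0 1 β₁ β₂ v)) ^ 2 =
    (a + 1) ^ 2 * (slope₂ 2 0 α₁ α₂ u *
      (slope₂ 2 1 β₁ β₂ v - slope 2 0 α₁ u * slope₂ 0 1 β₁ β₂ v)) := by
  obtain ⟨hD, g₀, g₁, A, B, e1, e2, eA, eB, hA, hB, e⟩ := h.ratio u hu v hv
  have h1 := hα u hu
  have h2 := h.jetI.coord₂_eq_zero h.uniqI hα hu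
  have hD' : topDet (α₁ u) (β₁ v) = α₁ u 0 * β₁ v 1 := by
    unfold topDet
    rw [h1]
    ring
  rw [hD'] at hD e
  have hp := left_ne_zero_of_mul hD
  have hq := right_ne_zero_of_mul hD
  rw [h1] at e1
  have hg0 : g₀ = α₁ u 2 / α₁ u 0 := by
    field_simp
    linarith
  have hg1 : g₁ = (β₁ v 2 - g₀ * β₁ v 0) / β₁ v 1 := by
    field_simp
    linarith
  have hA' : A = α₁ u 0 ^ 2 * slope₂ 2 0 α₁ α₂ u := by
    rw [eA, h2, hg0]
    unfold slope₂
    field_simp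
    ring
  have hB' : B = β₁ v 1 ^ 2 *
      (slope₂ 2 1 β₁ β₂ v - slope 2 0 α₁ u * slope₂ 0 1 β₁ β₂ v) := by
    rw [eB, hg1, hg0]
    unfold slope₂ slope
    field_simp
    ring
  have hw : topNormSq (β₁ v) = β₁ v 1 ^ 2 * (1 + slope 0 1 β₁ v ^ 2) := by
    unfold topNormSq slope
    field_simp
    ring
  have hn : topNormSq (α₁ u) = α₁ u 0 ^ 2 := by
    unfold topNormSq
    rw [h1]
    ring
  refine ⟨hp, hq, ?_, ?_, ?_⟩
  · intro h0
    rw [h0, mul_zero] at hA'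
    exact hA hA'
  · intro h0
    rw [h0, mul_zero] at hB'
    exact hB hB'
  · rw [hA', hB', hw, hn] at e
    have : (α₁ u 0 * β₁ v 1) ^ 4 ≠ 0 := pow_ne_zero 4 hD
    apply mul_left_cancel₀ this
    linear_combination e

/-- If moreover `β` lies in an isotropic plane too, the surface is a paraboloid. -/
theorem RatioPair.similarToSubset_paraboloid (h : RatioPair a I J α α₁ α₂ β β₁ β₂) (ha : a ≠ 0)
    (hα : ∀ u ∈ I, α₁ u 1 = 0) (hw : ∀ v ∈ J, slope₂ 0 1 β₁ β₂ v = 0) :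
    SimilarToSubset (translational α β '' (I ×ˢ J)) (paraboloid a) ∧ IsPlanarOn β J := by
  obtain ⟨u₀, hu₀⟩ := h.intI.mono interior_subset
  obtain ⟨v₀, hv₀⟩ := h.intJ.mono interior_subset
  have hp := fun u hu => (h.slope_rel hα (u := u) (v := v₀) hu hv₀).1
  have hq := fun v hv => (h.slope_rel hα (u := u₀) (v := v) hu₀ hv).2.1
  have hrel := fun u hu v hv => (h.slope_rel hα (u := u) (v := v) hu hv).2.2
  have hw' : ∀ v ∈ J, slope 0 1 β₁ v = slope 0 1 β₁ v₀ := by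
    intro v hv
    refine eq_of_hasDerivWithinAt_zero h.ordJ (fun v hv => ?_) hv hv₀
    refine (h.jetJ.hasDerivWithinAt_slope 0 1 hv (hq v hv)).congr_deriv ?_
    rw [hw v hv, zero_mul]
  have hrel' : ∀ u ∈ I, ∀ v ∈ J, slope₂ 2 0 α₁ α₂ u ≠ 0 ∧ slope₂ 2 1 β₁ β₂ v ≠ 0 ∧
      a * (slope₂ 2 0 α₁ α₂ u * (1 + slope 0 1 β₁ v₀ ^ 2) + slope₂ 2 1 β₁ β₂ v) ^ 2 =
      (a + 1) ^ 2 * (slope₂ 2 0 α₁ α₂ u * slope₂ 2 1 β₁ β₂ v) := by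
    intro u hu v hv
    have := hrel u hu v hv
    rw [hw v hv, hw' v hv] at this
    simpa using this
  set c := slope 0 1 β₁ v₀
  -- both second derivatives are constant, being roots of fixed quadratic polynomials
  have hφ : ∀ u ∈ I, slope₂ 2 0 α₁ α₂ u = slope₂ 2 0 α₁ α₂ u₀ := by
    intro u hu
    refine eq_of_continuousOn_of_quadratic h.ordI
      (h.jetI.differentiableOn_slope₂ 2 0 hp).continuousOn (a := a * (1 + c ^ 2) ^ 2)
      (b := 2 * a * (1 + c ^ 2) * slope₂ 2 1 β₁ β₂ v₀ - (a + 1) ^ 2 * slope₂ 2 1 β₁ β₂ v₀)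
      (c := a * slope₂ 2 1 β₁ β₂ v₀ ^ 2) (by positivity) (fun u hu => ?_) hu hu₀
    linear_combination (hrel' u hu v₀ hv₀).2.2
  have hχ : ∀ v ∈ J, slope₂ 2 1 β₁ β₂ v = slope₂ 2 1 β₁ β₂ v₀ := by
    intro v hv
    refine eq_of_continuousOn_of_quadratic h.ordJ
      (h.jetJ.differentiableOn_slope₂ 2 1 hq).continuousOn (a := a)
      (b := 2 * a * (slope₂ 2 0 α₁ α₂ u₀ * (1 + c ^ 2)) - (a + 1) ^ 2 * slope₂ 2 0 α₁ α₂ u₀)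
      (c := a * (slope₂ 2 0 α₁ α₂ u₀ * (1 + c ^ 2)) ^ 2) ha (fun v hv => ?_) hv hv₀
    linear_combination (hrel' u₀ hu₀ v hv).2.2
  obtain ⟨hf0, hs0, hfs⟩ := hrel' u₀ hu₀ v₀ hv₀
  set f := slope₂ 2 0 α₁ α₂ u₀
  set s := slope₂ 2 1 β₁ β₂ v₀
  obtain ⟨y₀, hy₀⟩ := exists_eq_add_of_hasDerivWithinAt h.ordI (f := fun u => α u 1)
    (g := fun _ => 0) (fun u hu => (h.jetI.coord₁ hu 1).congr_deriv (hα u hu))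
    (fun u _ => hasDerivWithinAt_const u I 0)
  obtain ⟨c₁, hc₁⟩ := exists_eq_add_of_hasDerivWithinAt h.ordI (f := slope 2 0 α₁)
    (g := fun u => f * α u 0)
    (fun u hu => (h.jetI.hasDerivWithinAt_slope 2 0 hu (hp u hu)).congr_deriv (by rw [hφ u hu]))
    (fun u hu => (h.jetI.coord₁ hu 0).const_mul f)
  obtain ⟨c₂, hc₂⟩ := exists_eq_add_of_hasDerivWithinAt h.ordI (f := fun u => α u 2)
    (g := fun u => f / 2 * α u 0 ^ 2 + c₁ * α u 0)
    (fun u hu => (h.jetI.coord₁_eq 2 0 hu (hp u hu)).congr_deriv (by rw [hc₁ u hu]))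
    (fun u hu => ((((h.jetI.coord₁ hu 0).pow 2).const_mul (f / 2)).add
      ((h.jetI.coord₁ hu 0).const_mul c₁)).congr_deriv (by simp; ring))
  obtain ⟨c₃, hc₃⟩ := exists_eq_add_of_hasDerivWithinAt h.ordJ (f := fun v => β v 0)
    (g := fun v => c * β v 1)
    (fun v hv => (h.jetJ.coord₁_eq 0 1 hv (hq v hv)).congr_deriv (by rw [hw' v hv]))
    (fun v hv => (h.jetJ.coord₁ hv 1).const_mul c)
  obtain ⟨c₄, hc₄⟩ := exists_eq_add_of_hasDerivWithinAt h.ordJ (f := slope 2 1 β₁)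
    (g := fun v => s * β v 1)
    (fun v hv => (h.jetJ.hasDerivWithinAt_slope 2 1 hv (hq v hv)).congr_deriv (by rw [hχ v hv]))
    (fun v hv => (h.jetJ.coord₁ hv 1).const_mul s)
  obtain ⟨c₅, hc₅⟩ := exists_eq_add_of_hasDerivWithinAt h.ordJ (f := fun v => β v 2)
    (g := fun v => s / 2 * β v 1 ^ 2 + c₄ * β v 1)
    (fun v hv => (h.jetJ.coord₁_eq 2 1 hv (hq v hv)).congr_deriv (by rw [hc₄ v hv]))
    (fun v hv => ((((h.jetJ.coord₁ hv 1).pow 2).const_mul (s / 2)).add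
      ((h.jetJ.coord₁ hv 1).const_mul c₄)).congr_deriv (by simp; ring))
  constructor
  · -- the surface is the graph of the form `f (x - c y)² / 2 + s y² / 2` plus an affine function
    refine IsotropicGeometry.similarToSubset_paraboloid (H₀ := f) (H₁ := -f * c)
      (H₂ := f * c ^ 2 + s)
      (l₀ := c₁ + f * (c * y₀ - c₃)) (l₁ := -c * c₁ - f * c * (c * y₀ - c₃) - s * y₀ + c₄)
      (d := f / 2 * (c * y₀ - c₃) ^ 2 + c₁ * (c * y₀ - c₃) + s / 2 * y₀ ^ 2 - c₄ * y₀ + c₂ + c₅)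
      ha ?_ ?_ ?_
    · have : f * (f * c ^ 2 + s) - (-f * c) ^ 2 = f * s := by ring
      rw [this]
      exact mul_ne_zero hf0 hs0
    · linear_combination hfs
    · rintro _ ⟨⟨u, v⟩, ⟨hu, hv⟩, rfl⟩
      simp only [translational, Pi.add_apply]
      rw [hc₂ u hu, hc₅ v hv, hc₃ v hv, hy₀ u hu]
      ring
  · refine ⟨![1, -c, 0], c₃, fun h0 => by simpa using congrFun h0 0, fun v hv => ?_⟩
    have := hc₃ v hv
    simp
    linarith

/-- The curvature parameter `k` of the profile curve, chosen as a differentiable function. It is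
determined by `2 b k = 1 + w² + s` unless `b = 0`. -/
theorem exists_differentiableOn_curvature {a : ℝ} (ha : a ≠ 0) (ha1 : a ≠ 1) {w s : ℝ → ℝ}
    (hw : DifferentiableOn ℝ w J) (hs : DifferentiableOn ℝ s J) (hs0 : ∀ v ∈ J, s v ≠ 0)
    (h : ∀ v ∈ J, a * (1 + w v ^ 2 + s v) ^ 2 = (a + 1) ^ 2 * s v) :
    ∃ k : ℝ → ℝ, DifferentiableOn ℝ k J ∧ ∀ v ∈ J, k v ≠ 0 ∧
      (((a + 1) / (a - 1)) ^ 2 - 1) * k v ^ 2 = s v ∧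
      1 + w v ^ 2 + (((a + 1) / (a - 1)) ^ 2 - 1) * k v ^ 2 = 2 * ((a + 1) / (a - 1)) * k v := by
  have hb := sq_ratio_param_sub_one ha1
  have ha1' : a - 1 ≠ 0 := sub_ne_zero.2 ha1
  by_cases ham : a = -1
  · subst ham
    have hs' : ∀ v ∈ J, s v = -(1 + w v ^ 2) := by
      intro v hv
      have h1 := h v hv
      have h2 : (1 + w v ^ 2 + s v) ^ 2 = 0 := by linear_combination -h1
      have h3 := (pow_eq_zero_iff two_ne_zero).1 h2
      linarith
    refine ⟨fun v => √(1 + w v ^ 2), ((hw.pow 2).const_add 1).sqrt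
      (fun v _ => (by positivity : (0 : ℝ) < 1 + w v ^ 2).ne'), fun v hv => ⟨?_, ?_, ?_⟩⟩
    · exact (Real.sqrt_pos.2 (by positivity)).ne'
    · rw [Real.sq_sqrt (by positivity), hs' v hv]
      norm_num
    · rw [Real.sq_sqrt (by positivity)]
      norm_num
  · have ha2 : a + 1 ≠ 0 := fun h0 => ham (by linarith)
    have hb0 : (a + 1) / (a - 1) ≠ 0 := div_ne_zero ha2 ha1'
    have hk : ∀ v ∈ J, (((a + 1) / (a - 1)) ^ 2 - 1) *
        ((1 + w v ^ 2 + s v) / (2 * ((a + 1) / (a - 1)))) ^ 2 = s v := by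
      intro v hv
      rw [hb]
      field_simp
      linear_combination 4 * h v hv
    refine ⟨fun v => (1 + w v ^ 2 + s v) / (2 * ((a + 1) / (a - 1))),
      (((hw.pow 2).const_add 1).add hs).div_const _, fun v hv => ⟨?_, hk v hv, ?_⟩⟩
    · intro h0
      have := hk v hv
      simp only at h0
      rw [h0] at this
      apply hs0 v hv
      rw [← this]
      ring
    · simp only
      rw [hk v hv]
      field_simp

/-- The integrated form of a profile curve `z(x)` whose second derivative is an affine function
`l - m z'` of the first. -/
theorem HasSecondJet.exists_exp (h : HasSecondJet I α α₁ α₂) (hI : I.OrdConnected)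
    (hI' : I.Nonempty) (hp : ∀ u ∈ I, α₁ u 0 ≠ 0) {l m : ℝ} (hm : m ≠ 0)
    (hode : ∀ u ∈ I, slope₂ 2 0 α₁ α₂ u = l - m * slope 2 0 α₁ u)
    (h0 : ∀ u ∈ I, slope₂ 2 0 α₁ α₂ u ≠ 0) :
    ∃ c z₀ : ℝ, c ≠ 0 ∧ ∀ u ∈ I,
      α u 2 = l / m * α u 0 - c / m * Real.exp (-m * α u 0) + z₀ := by
  obtain ⟨u₀, hu₀⟩ := hI'
  set ζ : ℝ → ℝ := fun u => (slope 2 0 α₁ u - l / m) * Real.exp (m * α u 0) with hζ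
  have hζc : ∀ u ∈ I, ζ u = ζ u₀ := by
    intro u hu
    refine eq_of_hasDerivWithinAt_zero hI (fun u hu => ?_) hu hu₀
    refine (((h.hasDerivWithinAt_slope 2 0 hu (hp u hu)).sub_const (l / m)).mul
      (((h.coord₁ hu 0).const_mul m).exp)).congr_deriv ?_
    rw [hode u hu]
    field_simp
    ring
  have hslope : ∀ u ∈ I, slope 2 0 α₁ u = l / m + ζ u₀ * Real.exp (-m * α u 0) := by
    intro u hu
    rw [← hζc u hu]
    simp only [hζ]
    rw [mul_assoc, ← Real.exp_add]
    simp
  obtain ⟨z₀, hz₀⟩ := exists_eq_add_of_hasDerivWithinAt hI (f := fun u => α u 2)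
    (g := fun u => l / m * α u 0 - ζ u₀ / m * Real.exp (-m * α u 0))
    (fun u hu => (h.coord₁_eq 2 0 hu (hp u hu)).congr_deriv (by rw [hslope u hu]))
    (fun u hu => (((h.coord₁ hu 0).const_mul (l / m)).sub
      ((((h.coord₁ hu 0).const_mul (-m)).exp).const_mul (ζ u₀ / m))).congr_deriv (by
        field_simp
        ring))
  refine ⟨ζ u₀, z₀, ?_, hz₀⟩
  intro hz
  have h1 := hslope u₀ hu₀
  rw [hz] at h1
  apply h0 u₀ hu₀
  rw [hode u₀ hu₀, h1]
  field_simp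
  ring

/-- If `β` does not lie in an isotropic plane, the mixed term of the ratio condition forces
`α` to be an exponential curve and `β` to be the profile curve of `r_b`, up to a shear. -/
theorem RatioPair.similarToSubset_expSurface (h : RatioPair a I J α α₁ α₂ β β₁ β₂) (ha : a ≠ 0)
    (hα : ∀ u ∈ I, α₁ u 1 = 0) (hw : ∃ v ∈ J, slope₂ 0 1 β₁ β₂ v ≠ 0) :
    (a ≠ 1 ∧ ∃ V : Set ℝ, IsParameterInterval a ((a + 1) / (a - 1)) V ∧
      SimilarToSubset (translational α β '' (I ×ˢ J)) (expSurface ((a + 1) / (a - 1)) V)) ∧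
    IsPlanarOn β J := by
  obtain ⟨v₀, hv₀, hw₀⟩ := hw
  obtain ⟨u₀, hu₀, u₁, hu₁, hu⟩ := nontrivial_of_interior_nonempty h.intI
  have hp := fun u hu => (h.slope_rel hα (u := u) (v := v₀) hu hv₀).1
  have hq := fun v hv => (h.slope_rel hα (u := u₀) (v := v) hu₀ hv).2.1
  have hφ0 := fun u hu => (h.slope_rel hα (u := u) (v := v₀) hu hv₀).2.2.1
  have hχ0 := fun u hu v hv => (h.slope_rel hα (u := u) (v := v) hu hv).2.2.2.1
  have hrel := fun u hu v hv => (h.slope_rel hα (u := u) (v := v) hu hv).2.2.2.2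
  have hφinj : slope 2 0 α₁ u₀ ≠ slope 2 0 α₁ u₁ := fun heq =>
    hu (injOn_of_hasDerivWithinAt_ne_zero h.ordI
      (fun u hu => h.jetI.hasDerivWithinAt_slope 2 0 hu (hp u hu))
      (fun u hu => mul_ne_zero (hφ0 u hu) (hp u hu)) hu₀ hu₁ heq)
  have hφd : ∀ u ∈ I, DifferentiableWithinAt ℝ (slope 2 0 α₁) I u := fun u hu =>
    (h.jetI.hasDerivWithinAt_slope 2 0 hu (hp u hu)).differentiableWithinAt
  have hw₂d := h.jetJ.differentiableOn_slope₂ 0 1 hq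
  have hφ₂d := h.jetI.differentiableOn_slope₂ 2 0 hp
  -- the quotient `s` of the two values of the Hessian does not depend on `u`
  set s : ℝ → ℝ := fun v => (slope₂ 2 1 β₁ β₂ v - slope 2 0 α₁ u₀ * slope₂ 0 1 β₁ β₂ v) /
    slope₂ 2 0 α₁ α₂ u₀ with hs
  have hsu : ∀ u ∈ I, ∀ v ∈ J, slope₂ 2 1 β₁ β₂ v - slope 2 0 α₁ u * slope₂ 0 1 β₁ β₂ v =
      s v * slope₂ 2 0 α₁ α₂ u := by
    intro u hu v hv
    have hconst := eq_of_continuousOn_of_quadratic h.ordI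
      (f := fun u => (slope₂ 2 1 β₁ β₂ v - slope 2 0 α₁ u * slope₂ 0 1 β₁ β₂ v) /
        slope₂ 2 0 α₁ α₂ u) (a := a)
      (b := 2 * a * (1 + slope 0 1 β₁ v ^ 2) - (a + 1) ^ 2)
      (c := a * (1 + slope 0 1 β₁ v ^ 2) ^ 2)
      (DifferentiableOn.continuousOn (𝕜 := ℝ) (fun u hu => (((hφd u hu).mul_const
        (slope₂ 0 1 β₁ β₂ v)).const_sub _).div (hφ₂d u hu) (hφ0 u hu))) ha (fun u hu => by
          have h1 := hrel u hu v hv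
          have h2 := hφ0 u hu
          field_simp
          linear_combination h1) hu hu₀
    have h2 := hφ0 u hu
    simp only [hs]
    rw [← hconst]
    field_simp
  have hs0 : ∀ v ∈ J, s v ≠ 0 := fun v hv => div_ne_zero (hχ0 u₀ hu₀ v hv) (hφ0 u₀ hu₀)
  set l := slope₂ 2 1 β₁ β₂ v₀ / s v₀ with hl
  set m := slope₂ 0 1 β₁ β₂ v₀ / s v₀ with hm
  have hm0 : m ≠ 0 := div_ne_zero hw₀ (hs0 v₀ hv₀)
  have hode : ∀ u ∈ I, slope₂ 2 0 α₁ α₂ u = l - m * slope 2 0 α₁ u := by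
    intro u hu
    have h1 := hsu u hu v₀ hv₀
    have h2 := hs0 v₀ hv₀
    rw [hl, hm]
    field_simp
    linarith
  have hw₂ : ∀ v ∈ J, slope₂ 0 1 β₁ β₂ v = m * s v := by
    intro v hv
    have h1 := hsu u₀ hu₀ v hv
    have h2 := hsu u₁ hu₁ v hv
    rw [hode u₀ hu₀] at h1
    rw [hode u₁ hu₁] at h2
    apply mul_left_cancel₀ (sub_ne_zero.2 hφinj)
    linear_combination h2 - h1
  have hχ₂ : ∀ v ∈ J, slope₂ 2 1 β₁ β₂ v = l * s v := by
    intro v hv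
    have h1 := hsu u₀ hu₀ v hv
    rw [hode u₀ hu₀, hw₂ v hv] at h1
    linarith
  have hrel' : ∀ v ∈ J, a * (1 + slope 0 1 β₁ v ^ 2 + s v) ^ 2 = (a + 1) ^ 2 * s v := by
    intro v hv
    have h1 := hrel u₀ hu₀ v hv
    rw [hsu u₀ hu₀ v hv] at h1
    have h2 := hφ0 u₀ hu₀
    apply mul_left_cancel₀ (pow_ne_zero 2 h2)
    linear_combination h1
  have hwd := fun v hv => h.jetJ.hasDerivWithinAt_slope 0 1 (v := v) hv (hq v hv)
  have ha1 : a ≠ 1 := by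
    rintro rfl
    -- for equal curvatures the quadratic equation for `s` is solvable only if the slope vanishes
    have hzero : ∀ v ∈ J, slope 0 1 β₁ v = 0 := by
      intro v hv
      have h1 := hrel' v hv
      have h2 : 0 < s v := by
        have h3 : 0 ≤ s v := by nlinarith [sq_nonneg (1 + slope 0 1 β₁ v ^ 2 + s v)]
        exact lt_of_le_of_ne h3 (hs0 v hv).symm
      have h4 : 4 * (s v * slope 0 1 β₁ v ^ 2) = -(1 + slope 0 1 β₁ v ^ 2 - s v) ^ 2 := by
        linear_combination h1
      have h5 : 0 ≤ s v * slope 0 1 β₁ v ^ 2 := by positivity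
      have h6 : s v * slope 0 1 β₁ v ^ 2 = 0 := by
        nlinarith [sq_nonneg (1 + slope 0 1 β₁ v ^ 2 - s v)]
      exact (pow_eq_zero_iff two_ne_zero).1 ((mul_eq_zero.1 h6).resolve_left h2.ne')
    have h1 := (h.uniqJ v₀ hv₀).eq_deriv _ (hwd v₀ hv₀)
      ((hasDerivWithinAt_const v₀ J (0 : ℝ)).congr hzero (hzero v₀ hv₀))
    exact mul_ne_zero hw₀ (hq v₀ hv₀) h1
  have hsd : DifferentiableOn ℝ s J :=
    (hw₂d.const_mul m⁻¹).congr fun v hv => by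
      rw [hw₂ v hv]
      field_simp
  obtain ⟨k, hkd, hk⟩ := exists_differentiableOn_curvature ha ha1
    (fun v hv => (hwd v hv).differentiableWithinAt) hsd hs0 hrel'
  have hb1 : ((a + 1) / (a - 1)) ^ 2 - 1 ≠ 0 := by
    rw [sq_ratio_param_sub_one ha1]
    have := sub_ne_zero.2 ha1
    positivity
  set b := (a + 1) / (a - 1)
  have hh : m * (b ^ 2 - 1) ≠ 0 := mul_ne_zero hm0 hb1
  obtain ⟨θ, c₀, c₁, hθc, hθ⟩ := exists_angle h.ordJ h.uniqJ (b := b)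
    (t := fun v => -(m * (b ^ 2 - 1)) * β v 1) (t' := fun v => -(m * (b ^ 2 - 1)) * β₁ v 1)
    (y := fun v => m * (b ^ 2 - 1) * β v 0) (w := fun v => -slope 0 1 β₁ v) (k := k)
    (k' := derivWithin k J)
    (fun v hv => (h.jetJ.coord₁ hv 1).const_mul _)
    (fun v hv => ((h.jetJ.coord₁_eq 0 1 hv (hq v hv)).const_mul _).congr_deriv (by ring))
    (fun v hv => (hwd v hv).neg.congr_deriv (by
      rw [hw₂ v hv]
      linear_combination m * β₁ v 1 * (hk v hv).2.1))
    (fun v hv => (hkd v hv).hasDerivWithinAt)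
    (fun v hv => mul_ne_zero (neg_ne_zero.2 hh) (hq v hv))
    (fun v hv => (hk v hv).1)
    (fun v hv => by
      have := (hk v hv).2.2
      rwa [neg_sq])
  obtain ⟨c, z₀, hc, hz⟩ := h.jetI.exists_exp h.ordI ⟨u₀, hu₀⟩ hp hm0 hode hφ0
  obtain ⟨y₀, hy₀⟩ := exists_eq_add_of_hasDerivWithinAt h.ordI (f := fun u => α u 1)
    (g := fun _ => 0) (fun u hu => (h.jetI.coord₁ hu 1).congr_deriv (hα u hu))
    (fun u _ => hasDerivWithinAt_const u I 0)
  obtain ⟨d₁, hd₁⟩ := exists_eq_add_of_hasDerivWithinAt h.ordJ (f := slope 2 1 β₁)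
    (g := fun v => l / m * slope 0 1 β₁ v)
    (fun v hv => (h.jetJ.hasDerivWithinAt_slope 2 1 hv (hq v hv)))
    (fun v hv => ((hwd v hv).const_mul (l / m)).congr_deriv (by
      rw [hw₂ v hv, hχ₂ v hv]
      field_simp))
  obtain ⟨d₂, hd₂⟩ := exists_eq_add_of_hasDerivWithinAt h.ordJ (f := fun v => β v 2)
    (g := fun v => l / m * β v 0 + d₁ * β v 1)
    (fun v hv => (h.jetJ.coord₁_eq 2 1 hv (hq v hv)))
    (fun v hv => (((h.jetJ.coord₁_eq 0 1 hv (hq v hv)).const_mul (l / m)).add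
      ((h.jetJ.coord₁ hv 1).const_mul d₁)).congr_deriv (by
        rw [hd₁ v hv]
        ring))
  refine ⟨⟨ha1, θ '' J, ⟨?_, ?_⟩, ?_⟩, ?_⟩
  · exact (h.ordJ.isPreconnected.image θ hθc).ordConnected
  · rintro _ ⟨v, hv, rfl⟩
    exact ⟨fun _ => (hθ v hv).2.2.2, fun _ => (hθ v hv).2.2.1⟩
  · -- the rotation exchanges the two horizontal axes, and the shear removes the linear terms
    refine ⟨_, isSimilarity_simLin (h₁ := 0) (h₂ := m * (b ^ 2 - 1)) (c₃ := -m / c) (Or.inr hh)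
      (m / c * (l / m)) (m / c * d₁) (div_ne_zero (neg_ne_zero.2 hm0) hc)
      ![m * (b ^ 2 - 1) * y₀ - c₀, -c₁, m / c * (z₀ + d₂ - d₁ * y₀)], ?_⟩
    rintro _ ⟨_, ⟨⟨u, v⟩, ⟨hu, hv⟩, rfl⟩, rfl⟩
    obtain ⟨e1, e2, -, -⟩ := hθ v hv
    rw [Real.log_abs] at e2
    refine ⟨(-m * α u 0, θ v), ⟨Set.mem_univ _, v, hv, rfl⟩, ?_⟩
    have hy := hy₀ u hu
    simp only [zero_add] at hy
    apply ext_fin_three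
    · simp only [Pi.add_apply, simLin_zero, translational, hy]
      simp [expMap]
      linear_combination -e1
    · simp only [Pi.add_apply, simLin_one, translational]
      simp [expMap]
      linear_combination -e2
    · simp only [Pi.add_apply, simLin_two, translational, hy, hz u hu, hd₂ v hv]
      simp [expMap]
      field_simp
      ring
  · refine ⟨![l / m, d₁, -1], -d₂, fun h0 => by simpa using congrFun h0 2, fun v hv => ?_⟩
    have := hd₂ v hv
    simp
    linarith

/-- The classification when the planar curve lies in a plane `y = const`. -/
theorem RatioPair.isListed_of_isotropic (h : RatioPair a I J α α₁ α₂ β β₁ β₂) (ha : a ≠ 0)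
    (hα : ∀ u ∈ I, α₁ u 1 = 0) :
    IsListed a (translational α β '' (I ×ˢ J)) ∧ IsPlanarOn β J := by
  by_cases hw : ∀ v ∈ J, slope₂ 0 1 β₁ β₂ v = 0
  · obtain ⟨h1, h2⟩ := h.similarToSubset_paraboloid ha hα hw
    exact ⟨Or.inl h1, h2⟩
  · push Not at hw
    obtain ⟨h1, h2⟩ := h.similarToSubset_expSurface ha hα hw
    exact ⟨Or.inr (Or.inl h1), h2⟩

/-- The classification when the top view of the planar curve lies on the line
`n₀ x + n₁ y = const`. -/
theorem RatioPair.isListed_of_topView_linear (h : RatioPair a I J α α₁ α₂ β β₁ β₂) (ha : a ≠ 0)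
    {n₀ n₁ : ℝ} (hn : n₀ ≠ 0 ∨ n₁ ≠ 0) (hα : ∀ u ∈ I, n₀ * α₁ u 0 + n₁ * α₁ u 1 = 0) :
    IsListed a (translational α β '' (I ×ˢ J)) ∧ IsPlanarOn β J := by
  have hn' := hn.symm
  obtain ⟨h1, h2⟩ := (h.simLin (c₃ := 1) hn' 0 0 one_ne_zero 0).isListed_of_isotropic ha
    (fun u hu => by rw [simLin_one]; exact hα u hu)
  rw [image_translational_simLin] at h1
  exact ⟨h1.of_image (isSimilarity_simLin hn' 0 0 one_ne_zero 0), h2.of_simLin hn' one_ne_zero⟩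

/-! ### A curve in a non-isotropic plane -/

/-- The ratio condition for a curve `α` in a plane `z = const`, in terms of the top views
`p`, `p'` of the derivatives of `α` and of the first two derivatives of the top view of `β` with
respect to `z`. -/
theorem RatioPair.horizontal_rel (h : RatioPair a I J α α₁ α₂ β β₁ β₂)
    (hα : ∀ u ∈ I, α₁ u 2 = 0) {u v : ℝ} (hu : u ∈ I) (hv : v ∈ J) :
    β₁ v 2 ≠ 0 ∧ topDet (α₁ u) (α₂ u) ≠ 0 ∧
    α₁ u 0 * slope 1 2 β₁ v - α₁ u 1 * slope 0 2 β₁ v ≠ 0 ∧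
    α₁ u 0 * slope₂ 1 2 β₁ β₂ v - α₁ u 1 * slope₂ 0 2 β₁ β₂ v ≠ 0 ∧
    a * (topDet (α₁ u) (α₂ u) * (slope 0 2 β₁ v ^ 2 + slope 1 2 β₁ v ^ 2) + topNormSq (α₁ u) *
      (α₁ u 0 * slope₂ 1 2 β₁ β₂ v - α₁ u 1 * slope₂ 0 2 β₁ β₂ v)) ^ 2 =
    (a + 1) ^ 2 * topDet (α₁ u) (α₂ u) *
      (α₁ u 0 * slope₂ 1 2 β₁ β₂ v - α₁ u 1 * slope₂ 0 2 β₁ β₂ v) *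
      (α₁ u 0 * slope 1 2 β₁ v - α₁ u 1 * slope 0 2 β₁ v) ^ 2 := by
  obtain ⟨hD, g₀, g₁, A, B, e1, e2, eA, eB, hA, hB, e⟩ := h.ratio u hu v hv
  have h1 := hα u hu
  have h2 := h.jetI.coord₂_eq_zero h.uniqI hα hu
  rw [h1] at e1
  rw [h2] at eA
  have hAD : A * topDet (α₁ u) (β₁ v) = -β₁ v 2 * topDet (α₁ u) (α₂ u) := by
    rw [eA, ← e2]
    unfold topDet
    linear_combination (α₂ u 0 * β₁ v 1 - α₂ u 1 * β₁ v 0) * -e1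
  have hq : β₁ v 2 ≠ 0 := by
    intro h0
    rw [h0] at hAD
    apply mul_ne_zero hA hD
    rw [hAD]
    ring
  have hP : topDet (α₁ u) (α₂ u) ≠ 0 := by
    intro h0
    rw [h0] at hAD
    apply mul_ne_zero hA hD
    rw [hAD]
    ring
  have hS : topDet (α₁ u) (β₁ v) =
      β₁ v 2 * (α₁ u 0 * slope 1 2 β₁ v - α₁ u 1 * slope 0 2 β₁ v) := by
    unfold topDet slope
    field_simp
  have hG : topNormSq (β₁ v) = β₁ v 2 ^ 2 * (slope 0 2 β₁ v ^ 2 + slope 1 2 β₁ v ^ 2) := by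
    unfold topNormSq slope
    field_simp
  have hBD : B * topDet (α₁ u) (β₁ v) = -β₁ v 2 ^ 3 *
      (α₁ u 0 * slope₂ 1 2 β₁ β₂ v - α₁ u 1 * slope₂ 0 2 β₁ β₂ v) := by
    unfold slope₂
    field_simp
    rw [eB, ← e2]
    unfold topDet
    linear_combination (β₁ v 0 * β₂ v 1 - β₁ v 1 * β₂ v 0) * e1
  set S := α₁ u 0 * slope 1 2 β₁ v - α₁ u 1 * slope 0 2 β₁ v
  set N := α₁ u 0 * slope₂ 1 2 β₁ β₂ v - α₁ u 1 * slope₂ 0 2 β₁ β₂ v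
  refine ⟨hq, hP, ?_, ?_, ?_⟩
  · intro h0
    rw [hS, h0, mul_zero] at hD
    exact hD rfl
  · intro h0
    rw [h0, mul_zero] at hBD
    exact mul_ne_zero hB hD hBD
  · rw [hG] at e
    rw [hS] at hAD hBD e
    apply mul_left_cancel₀ (pow_ne_zero 6 hq)
    have hAS : A * S = -topDet (α₁ u) (α₂ u) := by
      apply mul_left_cancel₀ hq
      linear_combination hAD
    have hBS : B * S = -β₁ v 2 ^ 2 * N := by
      apply mul_left_cancel₀ hq
      linear_combination hBD
    have hP' : topDet (α₁ u) (α₂ u) = -(A * S) := by linarith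
    have hN' : β₁ v 2 ^ 2 * N = -(B * S) := by linarith
    calc _ = β₁ v 2 ^ 2 * (a * (topDet (α₁ u) (α₂ u) *
            (β₁ v 2 ^ 2 * (slope 0 2 β₁ v ^ 2 + slope 1 2 β₁ v ^ 2)) +
            topNormSq (α₁ u) * (β₁ v 2 ^ 2 * N)) ^ 2) := by ring
      _ = β₁ v 2 ^ 4 * ((a + 1) ^ 2 * topDet (α₁ u) (α₂ u) * (β₁ v 2 ^ 2 * N) * S ^ 2) := by
        rw [hP', hN']
        linear_combination β₁ v 2 ^ 2 * S ^ 2 * e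
      _ = _ := by ring

/-- Elimination of the curvature of `α` from the ratio condition and its derivative with respect
to `z`. Here `P` is the determinant of the first two derivatives of `α`, `E` and `G` are the squared
lengths of the tangents of `α` and `β`, `S` and `C` their determinant and inner product, and
`N`, `N'` are the first two derivatives of `S`. The resulting identity no longer contains `P`, and
for fixed `v` it is homogeneous in the tangent of `α`. -/
theorem eliminate_curvature {P E G S C N N' g d : ℝ} (ha : a + 1 ≠ 0) (hP : P ≠ 0) (hE : E ≠ 0)
    (hS : S ≠ 0) (hN : N ≠ 0) (hEG : E * G = S ^ 2 + C ^ 2) (hNS : N = g * S + d * C)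
    (h : a * (P * G + E * N) ^ 2 = (a + 1) ^ 2 * P * N * S ^ 2)
    (h' : 2 * a * (P * G + E * N) * (P * (2 * g * G) + E * N') =
      (a + 1) ^ 2 * P * (N' * S ^ 2 + 2 * N ^ 2 * S)) :
    (2 * g * N - N') ^ 2 * ((a - 1) ^ 2 * S ^ 2 - 4 * a * C ^ 2) =
      4 * (a + 1) ^ 2 * d ^ 2 * N ^ 2 * C ^ 2 := by
  have h1 : 2 * N * S * (P * (2 * g * G) + E * N') = (N' * S + 2 * N ^ 2) * (P * G + E * N) := by
    apply mul_left_cancel₀ (mul_ne_zero (mul_ne_zero (pow_ne_zero 2 ha) hP) hS)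
    linear_combination (P * G + E * N) * h' - 2 * (P * (2 * g * G) + E * N') * h
  set U := S * (2 * g * N - N') with hU
  set V := 2 * d * N * C with hV
  have h2 : P * G * (U - V) = E * N * (U + V) := by
    rw [hU, hV]
    linear_combination h1 + 2 * N * (P * G + E * N) * hNS
  have h3 : 4 * a * (E * G) * U ^ 2 = (a + 1) ^ 2 * S ^ 2 * (U ^ 2 - V ^ 2) := by
    apply mul_left_cancel₀ (mul_ne_zero hE (pow_ne_zero 2 hN))
    have h4 : (P * G + E * N) * (U - V) = 2 * E * N * U := by linear_combination h2
    have h5 : a * G * (2 * E * N * U) ^ 2 =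
        (a + 1) ^ 2 * (P * G * (U - V)) * N * S ^ 2 * (U - V) := by
      rw [← h4]
      linear_combination G * (U - V) ^ 2 * h
    rw [h2] at h5
    linear_combination h5
  rw [hEG] at h3
  apply mul_left_cancel₀ (pow_ne_zero 2 hS)
  rw [hU, hV] at h3
  linear_combination -h3

/-- For `a ≠ -1`, a curve in a plane `z = const` forces the top view of the other curve to have
vanishing curvature. -/
theorem RatioPair.top_curvature_eq_zero (h : RatioPair a I J α α₁ α₂ β β₁ β₂)
    (ha : a + 1 ≠ 0) (hα : ∀ u ∈ I, α₁ u 2 = 0) {v : ℝ} (hv : v ∈ J) :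
    slope 0 2 β₁ v * slope₂ 1 2 β₁ β₂ v - slope 1 2 β₁ v * slope₂ 0 2 β₁ β₂ v = 0 := by
  obtain ⟨u₀, hu₀⟩ := h.intI.mono interior_subset
  have hrel := fun u hu v hv => h.horizontal_rel hα (u := u) (v := v) hu hv
  have hq := fun v hv => (hrel u₀ hu₀ v hv).1
  obtain ⟨K, hK⟩ : ∃ K : Fin 3 → ℝ,
      ∀ i, HasDerivWithinAt (slope₂ i 2 β₁ β₂) (K i * β₁ v 2) J v := by
    refine ⟨fun i => derivWithin (slope₂ i 2 β₁ β₂) J v / β₁ v 2, fun i => ?_⟩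
    have := hq v hv
    field_simp
    exact (h.jetJ.differentiableOn_slope₂ i 2 hq v hv).hasDerivWithinAt
  have hQ := fun i => h.jetJ.hasDerivWithinAt_slope i 2 hv (hq v hv)
  have hQ0 : slope 0 2 β₁ v ^ 2 + slope 1 2 β₁ v ^ 2 ≠ 0 := by
    intro h0
    have e0 : slope 0 2 β₁ v = 0 := by
      nlinarith [sq_nonneg (slope 0 2 β₁ v), sq_nonneg (slope 1 2 β₁ v)]
    have e1 : slope 1 2 β₁ v = 0 := by
      nlinarith [sq_nonneg (slope 0 2 β₁ v), sq_nonneg (slope 1 2 β₁ v)]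
    apply (hrel u₀ hu₀ v hv).2.2.1
    rw [e0, e1]
    ring
  -- the ratio condition, differentiated along `β`
  have hrel' : ∀ u ∈ I, 2 * a * (topDet (α₁ u) (α₂ u) * (slope 0 2 β₁ v ^ 2 + slope 1 2 β₁ v ^ 2) +
      topNormSq (α₁ u) * (α₁ u 0 * slope₂ 1 2 β₁ β₂ v - α₁ u 1 * slope₂ 0 2 β₁ β₂ v)) *
      (topDet (α₁ u) (α₂ u) *
        (2 * (slope 0 2 β₁ v * slope₂ 0 2 β₁ β₂ v + slope 1 2 β₁ v * slope₂ 1 2 β₁ β₂ v)) +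
        topNormSq (α₁ u) * (α₁ u 0 * K 1 - α₁ u 1 * K 0)) =
      (a + 1) ^ 2 * topDet (α₁ u) (α₂ u) * ((α₁ u 0 * K 1 - α₁ u 1 * K 0) *
        (α₁ u 0 * slope 1 2 β₁ v - α₁ u 1 * slope 0 2 β₁ v) ^ 2 +
        2 * (α₁ u 0 * slope₂ 1 2 β₁ β₂ v - α₁ u 1 * slope₂ 0 2 β₁ β₂ v) ^ 2 *
        (α₁ u 0 * slope 1 2 β₁ v - α₁ u 1 * slope 0 2 β₁ v)) := by
    intro u hu
    have hG := ((hQ 0).pow 2).add ((hQ 1).pow 2)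
    have hN := ((hK 1).const_mul (α₁ u 0)).sub ((hK 0).const_mul (α₁ u 1))
    have hS := ((hQ 1).const_mul (α₁ u 0)).sub ((hQ 0).const_mul (α₁ u 1))
    have h1 := (((hG.const_mul (topDet (α₁ u) (α₂ u))).add
      (hN.const_mul (topNormSq (α₁ u)))).pow 2).const_mul a
    have h2 := (hN.const_mul ((a + 1) ^ 2 * topDet (α₁ u) (α₂ u))).mul (hS.pow 2)
    have h3 := (h.uniqJ v hv).eq_deriv _ h1 (h2.congr (fun v hv => (hrel u hu v hv).2.2.2.2)
      (hrel u hu v hv).2.2.2.2)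
    simp at h3
    apply mul_left_cancel₀ (hq v hv)
    linear_combination h3
  set Q₀ := slope 0 2 β₁ v
  set Q₁ := slope 1 2 β₁ v
  set R₀ := slope₂ 0 2 β₁ β₂ v
  set R₁ := slope₂ 1 2 β₁ β₂ v
  set G := Q₀ ^ 2 + Q₁ ^ 2 with hG
  -- the coordinates of the second and third derivative in the basis `Q`, `(-Q₁, Q₀)`
  set g := (Q₀ * R₀ + Q₁ * R₁) / G with hg
  set d := (Q₀ * R₁ - Q₁ * R₀) / G with hd
  set n₁ := (Q₀ * K 0 + Q₁ * K 1) / G with hn₁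
  set n₀ := (Q₀ * K 1 - Q₁ * K 0) / G with hn₀
  have hkey : ∀ u ∈ I, (2 * g * (g * (α₁ u 0 * Q₁ - α₁ u 1 * Q₀) + d * (α₁ u 0 * Q₀ + α₁ u 1 * Q₁))
      - (n₁ * (α₁ u 0 * Q₁ - α₁ u 1 * Q₀) + n₀ * (α₁ u 0 * Q₀ + α₁ u 1 * Q₁))) ^ 2 *
      ((a - 1) ^ 2 * (α₁ u 0 * Q₁ - α₁ u 1 * Q₀) ^ 2 -
        4 * a * (α₁ u 0 * Q₀ + α₁ u 1 * Q₁) ^ 2) =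
      4 * (a + 1) ^ 2 * d ^ 2 * (g * (α₁ u 0 * Q₁ - α₁ u 1 * Q₀) +
        d * (α₁ u 0 * Q₀ + α₁ u 1 * Q₁)) ^ 2 * (α₁ u 0 * Q₀ + α₁ u 1 * Q₁) ^ 2 := by
    intro u hu
    obtain ⟨-, hP, hS, hN, e⟩ := hrel u hu v hv
    have e' := hrel' u hu
    have hNe : α₁ u 0 * R₁ - α₁ u 1 * R₀ = g * (α₁ u 0 * Q₁ - α₁ u 1 * Q₀) +
        d * (α₁ u 0 * Q₀ + α₁ u 1 * Q₁) := by
      rw [hg, hd]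
      field_simp
      rw [hG]
      ring
    have hNe' : α₁ u 0 * K 1 - α₁ u 1 * K 0 = n₁ * (α₁ u 0 * Q₁ - α₁ u 1 * Q₀) +
        n₀ * (α₁ u 0 * Q₀ + α₁ u 1 * Q₁) := by
      rw [hn₁, hn₀]
      field_simp
      rw [hG]
      ring
    have hEG : topNormSq (α₁ u) * G = (α₁ u 0 * Q₁ - α₁ u 1 * Q₀) ^ 2 +
        (α₁ u 0 * Q₀ + α₁ u 1 * Q₁) ^ 2 := by
      unfold topNormSq
      rw [hG]
      ring
    have hgG : 2 * (Q₀ * R₀ + Q₁ * R₁) = 2 * g * G := by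
      rw [hg]
      field_simp
    have hE : topNormSq (α₁ u) ≠ 0 := by
      intro h0
      rw [h0] at hEG
      have := sq_pos_of_ne_zero hS
      nlinarith [sq_nonneg (α₁ u 0 * Q₀ + α₁ u 1 * Q₁)]
    rw [hgG, hNe, hNe'] at e'
    rw [hNe] at e hN
    exact eliminate_curvature ha hP hE hS hN hEG rfl e e'
  -- the quotient of inner product and determinant takes infinitely many values along `α`
  set τ : ℝ → ℝ := fun u => (α₁ u 0 * Q₀ + α₁ u 1 * Q₁) / (α₁ u 0 * Q₁ - α₁ u 1 * Q₀) with hτ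
  have hinj : Set.InjOn τ I := by
    refine injOn_of_hasDerivWithinAt_ne_zero h.ordI (f' := fun u => topDet (α₁ u) (α₂ u) * G /
      (α₁ u 0 * Q₁ - α₁ u 1 * Q₀) ^ 2) (fun u hu => ?_) (fun u hu => ?_)
    · refine ((((h.jetI.coord₂ hu 0).mul_const Q₀).add ((h.jetI.coord₂ hu 1).mul_const Q₁)).div
        (((h.jetI.coord₂ hu 0).mul_const Q₁).sub ((h.jetI.coord₂ hu 1).mul_const Q₀))
        (hrel u hu v hv).2.2.1).congr_deriv ?_
      congr 1
      unfold topDet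
      simp only [Pi.add_apply, Pi.sub_apply]
      rw [hG]
      ring
    · exact div_ne_zero (mul_ne_zero (hrel u hu v hv).2.1 hQ0)
        (pow_ne_zero 2 (hrel u hu v hv).2.2.1)
  have hinf : (τ '' I).Infinite :=
    (infinite_of_interior_nonempty h.intI).image hinj
  set w₁ := 2 * g ^ 2 - n₁ with hw₁
  set w₀ := 2 * g * d - n₀ with hw₀
  obtain ⟨c0, -, c2, c3, c4⟩ := quartic_coeff_eq_zero hinf (c₀ := (a - 1) ^ 2 * w₁ ^ 2)
    (c₁ := 2 * (a - 1) ^ 2 * (w₀ * w₁))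
    (c₂ := (a - 1) ^ 2 * w₀ ^ 2 - 4 * a * w₁ ^ 2 - 4 * (a + 1) ^ 2 * d ^ 2 * g ^ 2)
    (c₃ := -8 * a * (w₀ * w₁) - 8 * (a + 1) ^ 2 * d ^ 3 * g)
    (c₄ := -4 * a * w₀ ^ 2 - 4 * (a + 1) ^ 2 * d ^ 4) (by
      rintro _ ⟨u, hu, rfl⟩
      have hS := (hrel u hu v hv).2.2.1
      have hk := hkey u hu
      simp only [hτ]
      set S := α₁ u 0 * Q₁ - α₁ u 1 * Q₀
      set C := α₁ u 0 * Q₀ + α₁ u 1 * Q₁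
      rw [hw₁, hw₀]
      field_simp
      linear_combination hk)
  -- the coefficients of `t⁴`, `1`, `t³`, `t²` force in turn `a < 0`, `w₁ = 0`, `g = 0`, `w₀ = 0`
  have hd0 : d = 0 := by
    by_contra hd0
    have hk : 0 < (a + 1) ^ 2 * d ^ 4 := by positivity
    have ha0 : a < 0 := by nlinarith [sq_nonneg w₀]
    have hw1 : w₁ = 0 := by
      have : (a - 1) ^ 2 ≠ 0 := pow_ne_zero 2 (by linarith)
      exact (pow_eq_zero_iff two_ne_zero).1 ((mul_eq_zero.1 c0).resolve_left this)
    have hg0 : g = 0 := by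
      rw [hw1] at c3
      have h1 : (a + 1) ^ 2 * d ^ 3 * g = 0 := by linear_combination -c3 / 8
      exact (mul_eq_zero.1 h1).resolve_left (mul_ne_zero (pow_ne_zero 2 ha) (pow_ne_zero 3 hd0))
    rw [hw1, hg0] at c2
    have hw0 : w₀ = 0 := by
      have : (a - 1) ^ 2 ≠ 0 := pow_ne_zero 2 (by linarith)
      have h1 : (a - 1) ^ 2 * w₀ ^ 2 = 0 := by linear_combination c2
      exact (pow_eq_zero_iff two_ne_zero).1 ((mul_eq_zero.1 h1).resolve_left this)
    rw [hw0] at c4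
    nlinarith
  rw [hd] at hd0
  exact (div_eq_zero_iff.1 hd0).resolve_right hQ0

/-! ### The classification -/

theorem HasSecondJet.isPlanarOn_of_topView_linear {γ γ₁ γ₂ : ℝ → Fin 3 → ℝ}
    (h : HasSecondJet J γ γ₁ γ₂) (hJ : J.OrdConnected) {n₀ n₁ : ℝ} (hn : n₀ ≠ 0 ∨ n₁ ≠ 0)
    (hγ : ∀ v ∈ J, n₀ * γ₁ v 0 + n₁ * γ₁ v 1 = 0) : IsPlanarOn γ J := by
  obtain ⟨d, hd⟩ := exists_eq_add_of_hasDerivWithinAt hJ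
    (f := fun v => n₀ * γ v 0 + n₁ * γ v 1) (g := fun _ => 0)
    (fun v hv => (((h.coord₁ hv 0).const_mul n₀).add
      ((h.coord₁ hv 1).const_mul n₁)).congr_deriv (hγ v hv))
    (fun v _ => hasDerivWithinAt_const v J 0)
  refine ⟨![n₀, n₁, 0], d, fun h0 => ?_, fun v hv => ?_⟩
  · have e0 := congrFun h0 0
    have e1 := congrFun h0 1
    simp at e0 e1
    simp [e0, e1] at hn
  · have := hd v hv
    simp at this ⊢
    exact this

/-- If the top view of `β` lies on a line, the roles of the two curves can be exchanged. -/
theorem RatioPair.isListed_of_topView_linear_right (h : RatioPair a I J α α₁ α₂ β β₁ β₂)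
    (ha : a ≠ 0) {n₀ n₁ : ℝ} (hn : n₀ ≠ 0 ∨ n₁ ≠ 0)
    (hβ : ∀ v ∈ J, n₀ * β₁ v 0 + n₁ * β₁ v 1 = 0) :
    IsListed a (translational α β '' (I ×ˢ J)) ∧ IsPlanarOn β J := by
  refine ⟨?_, h.jetJ.isPlanarOn_of_topView_linear h.ordJ hn hβ⟩
  rw [← image_translational_swap]
  exact (h.swap.isListed_of_topView_linear ha hn hβ).1

/-- A planar curve `α` in a plane `z = const`, for `a ≠ -1`: the top view of `β` has zero curvature,
so it lies on a line, and `β` takes the role of the curve in an isotropic plane. -/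
theorem RatioPair.isListed_of_horizontal (h : RatioPair a I J α α₁ α₂ β β₁ β₂) (ha : a ≠ 0)
    (ha1 : a + 1 ≠ 0) (hα : ∀ u ∈ I, α₁ u 2 = 0) :
    IsListed a (translational α β '' (I ×ˢ J)) ∧ IsPlanarOn β J := by
  obtain ⟨u₀, hu₀⟩ := h.intI.mono interior_subset
  obtain ⟨v₀, hv₀⟩ := h.intJ.mono interior_subset
  have hq := fun v hv => (h.horizontal_rel hα (u := u₀) (v := v) hu₀ hv).1
  have hS := fun v hv => (h.horizontal_rel hα (u := u₀) (v := v) hu₀ hv).2.2.1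
  have hQ := fun i v hv => h.jetJ.hasDerivWithinAt_slope i 2 (v := v) hv (hq v hv)
  -- a plane curve of zero curvature has a constant direction: the quotient of the determinants of
  -- the tangent with two fixed vectors has zero derivative
  have hdir : ∀ v ∈ J, (slope 0 2 β₁ v₀ * slope 1 2 β₁ v - slope 1 2 β₁ v₀ * slope 0 2 β₁ v) /
      (α₁ u₀ 0 * slope 1 2 β₁ v - α₁ u₀ 1 * slope 0 2 β₁ v) =
      (slope 0 2 β₁ v₀ * slope 1 2 β₁ v₀ - slope 1 2 β₁ v₀ * slope 0 2 β₁ v₀) /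
      (α₁ u₀ 0 * slope 1 2 β₁ v₀ - α₁ u₀ 1 * slope 0 2 β₁ v₀) := by
    intro v hv
    refine eq_of_hasDerivWithinAt_zero h.ordJ (f := fun v =>
      (slope 0 2 β₁ v₀ * slope 1 2 β₁ v - slope 1 2 β₁ v₀ * slope 0 2 β₁ v) /
      (α₁ u₀ 0 * slope 1 2 β₁ v - α₁ u₀ 1 * slope 0 2 β₁ v)) (fun v hv => ?_) hv hv₀
    refine ((((hQ 1 v hv).const_mul (slope 0 2 β₁ v₀)).sub
      ((hQ 0 v hv).const_mul (slope 1 2 β₁ v₀))).div (((hQ 1 v hv).const_mul (α₁ u₀ 0)).sub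
      ((hQ 0 v hv).const_mul (α₁ u₀ 1))) (hS v hv)).congr_deriv ?_
    rw [div_eq_zero_iff]
    left
    have h0 := h.top_curvature_eq_zero ha1 hα hv
    simp only [Pi.sub_apply]
    linear_combination β₁ v 2 * (slope 1 2 β₁ v₀ * α₁ u₀ 0 - slope 0 2 β₁ v₀ * α₁ u₀ 1) * h0
  refine h.isListed_of_topView_linear_right ha (n₀ := -slope 1 2 β₁ v₀) (n₁ := slope 0 2 β₁ v₀)
    ?_ fun v hv => ?_
  · by_contra! h0
    apply hS v₀ hv₀
    rw [h0.2, neg_eq_zero.1 h0.1]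
    ring
  · have h1 := hdir v hv
    rw [mul_comm (slope 1 2 β₁ v₀) (slope 0 2 β₁ v₀), sub_self, zero_div, div_eq_zero_iff] at h1
    have h2 := h1.resolve_right (hS v hv)
    unfold slope at h2 ⊢
    have := hq v hv
    have := hq v₀ hv₀
    field_simp at h2 ⊢
    linarith

theorem hasDerivWithinAt_log_abs_cos {f : ℝ → ℝ} {f' v : ℝ} (hf : HasDerivWithinAt f f' J v)
    (h0 : Real.cos (f v) ≠ 0) :
    HasDerivWithinAt (fun v => Real.log |Real.cos (f v)|) (-Real.tan (f v) * f') J v := by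
  simp only [Real.log_abs]
  refine (hf.cos.log h0).congr_deriv ?_
  rw [Real.tan_eq_sin_div_cos]
  ring

theorem neg_arctan_deriv_eq {x y x' y' : ℝ} (hx : x ≠ 0)
    (h : y' * x - y * x' = -(x ^ 2 + y ^ 2) * x) :
    -(1 / (1 + (y / x) ^ 2) * ((y' * x - y * x') / x ^ 2)) = x := by
  have h2 : x ^ 2 + y ^ 2 ≠ 0 := by
    have := sq_pos_of_ne_zero hx
    positivity
  rw [h]
  field_simp

/-- For `a = -1` and a curve `α` in a plane `z = const`, the derivatives `Q`, `R` of the top view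
of `β` with respect to `z` satisfy `R = |Q|² m` for a constant vector `m`, and the tangent angle of
`α` is an affine function of a linear coordinate. -/
theorem RatioPair.exists_direction (h : RatioPair (-1) I J α α₁ α₂ β β₁ β₂)
    (hα : ∀ u ∈ I, α₁ u 2 = 0) :
    ∃ m₀ m₁ : ℝ, (m₀ ≠ 0 ∨ m₁ ≠ 0) ∧
      (∀ v ∈ J, slope₂ 0 2 β₁ β₂ v = (slope 0 2 β₁ v ^ 2 + slope 1 2 β₁ v ^ 2) * m₀ ∧
        slope₂ 1 2 β₁ β₂ v = (slope 0 2 β₁ v ^ 2 + slope 1 2 β₁ v ^ 2) * m₁) ∧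
      ∀ u ∈ I, topDet (α₁ u) (α₂ u) = -topNormSq (α₁ u) * (α₁ u 0 * m₁ - α₁ u 1 * m₀) := by
  obtain ⟨u₀, hu₀⟩ := h.intI.mono interior_subset
  obtain ⟨v₀, hv₀⟩ := h.intJ.mono interior_subset
  have hrel := fun u hu v hv => h.horizontal_rel hα (u := u) (v := v) hu hv
  have hG : ∀ v ∈ J, slope 0 2 β₁ v ^ 2 + slope 1 2 β₁ v ^ 2 ≠ 0 := by
    intro v hv h0
    have e0 : slope 0 2 β₁ v = 0 := by
      nlinarith [sq_nonneg (slope 0 2 β₁ v), sq_nonneg (slope 1 2 β₁ v)]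
    have e1 : slope 1 2 β₁ v = 0 := by
      nlinarith [sq_nonneg (slope 0 2 β₁ v), sq_nonneg (slope 1 2 β₁ v)]
    apply (hrel u₀ hu₀ v hv).2.2.1
    rw [e0, e1]
    ring
  set m : Fin 3 → ℝ → ℝ := fun i v =>
    slope₂ i 2 β₁ β₂ v / (slope 0 2 β₁ v ^ 2 + slope 1 2 β₁ v ^ 2) with hm
  have hmR : ∀ i, ∀ v ∈ J,
      slope₂ i 2 β₁ β₂ v = (slope 0 2 β₁ v ^ 2 + slope 1 2 β₁ v ^ 2) * m i v := by
    intro i v hv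
    have := hG v hv
    simp only [hm]
    field_simp
  have hP : ∀ u ∈ I, ∀ v ∈ J, topDet (α₁ u) (α₂ u) =
      -topNormSq (α₁ u) * (α₁ u 0 * m 1 v - α₁ u 1 * m 0 v) := by
    intro u hu v hv
    have h1 := (hrel u hu v hv).2.2.2.2
    rw [hmR 0 v hv, hmR 1 v hv] at h1
    have h2 : (slope 0 2 β₁ v ^ 2 + slope 1 2 β₁ v ^ 2) ^ 2 * (topDet (α₁ u) (α₂ u) +
        topNormSq (α₁ u) * (α₁ u 0 * m 1 v - α₁ u 1 * m 0 v)) ^ 2 = 0 := by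
      linear_combination -h1
    have h3 := (pow_eq_zero_iff two_ne_zero).1
      ((mul_eq_zero.1 h2).resolve_left (pow_ne_zero 2 (hG v hv)))
    linarith
  have hE : ∀ u ∈ I, topNormSq (α₁ u) ≠ 0 := by
    intro u hu h0
    apply (hrel u hu v₀ hv₀).2.1
    rw [hP u hu v₀ hv₀, h0]
    ring
  -- `m v - m v₀` is parallel to all tangents of `α`, which is not a straight line
  have hconst : ∀ v ∈ J, m 0 v = m 0 v₀ ∧ m 1 v = m 1 v₀ := by
    intro v hv
    have h1 : ∀ u ∈ I, α₁ u 0 * (m 1 v - m 1 v₀) - α₁ u 1 * (m 0 v - m 0 v₀) = 0 := by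
      intro u hu
      have e := (hP u hu v hv).symm.trans (hP u hu v₀ hv₀)
      apply mul_left_cancel₀ (hE u hu)
      linear_combination -e
    have h2 := (h.uniqI u₀ hu₀).eq_deriv _
      (((h.jetI.coord₂ hu₀ 0).mul_const (m 1 v - m 1 v₀)).sub
        ((h.jetI.coord₂ hu₀ 1).mul_const (m 0 v - m 0 v₀)))
      ((hasDerivWithinAt_const u₀ I (0 : ℝ)).congr h1 (h1 u₀ hu₀))
    have h3 := h1 u₀ hu₀
    have hP0 := (hrel u₀ hu₀ v hv).2.1
    unfold topDet at hP0
    constructor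
    · apply sub_eq_zero.1
      apply (mul_eq_zero.1 (_ : (α₁ u₀ 0 * α₂ u₀ 1 - α₁ u₀ 1 * α₂ u₀ 0) * _ = 0)).resolve_left hP0
      linear_combination α₂ u₀ 0 * h3 - α₁ u₀ 0 * h2
    · apply sub_eq_zero.1
      apply (mul_eq_zero.1 (_ : (α₁ u₀ 0 * α₂ u₀ 1 - α₁ u₀ 1 * α₂ u₀ 0) * _ = 0)).resolve_left hP0
      linear_combination α₂ u₀ 1 * h3 - α₁ u₀ 1 * h2
  refine ⟨m 0 v₀, m 1 v₀, ?_, fun v hv => ⟨?_, ?_⟩, fun u hu => hP u hu v₀ hv₀⟩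
  · by_contra! h0
    apply (hrel u₀ hu₀ v₀ hv₀).2.1
    rw [hP u₀ hu₀ v₀ hv₀, h0.1, h0.2]
    ring
  · rw [hmR 0 v hv, (hconst v hv).1]
  · rw [hmR 1 v hv, (hconst v hv).2]

/-- A planar curve `α` in a plane `z = const`, for `a = -1`. In the coordinates
`x = m₁ p₀ - m₀ p₁`, `y = m₀ p₀ + m₁ p₁` of points `p` the top views of `α` and `β` satisfy
`y'' = -(1 + y'²)` and `y'' = 1 + y'²`, and the arctangents of the slopes, up to sign, are the
parameters of the listed surface. -/
theorem RatioPair.isListed_of_horizontal_neg_one (h : RatioPair (-1) I J α α₁ α₂ β β₁ β₂)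
    (hα : ∀ u ∈ I, α₁ u 2 = 0) :
    IsListed (-1) (translational α β '' (I ×ˢ J)) ∧ IsPlanarOn β J := by
  obtain ⟨u₀, hu₀⟩ := h.intI.mono interior_subset
  obtain ⟨v₀, hv₀⟩ := h.intJ.mono interior_subset
  have hrel := fun u hu v hv => h.horizontal_rel hα (u := u) (v := v) hu hv
  have hq := fun v hv => (hrel u₀ hu₀ v hv).1
  obtain ⟨m₀, m₁, hm, hR, hP⟩ := h.exists_direction hα
  have hn := sq_add_sq_ne_zero hm
  have hQ := fun i v hv => h.jetJ.hasDerivWithinAt_slope i 2 (v := v) hv (hq v hv)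
  obtain ⟨κ, hκ⟩ := exists_eq_add_of_hasDerivWithinAt h.ordJ
    (f := fun v => m₁ * slope 0 2 β₁ v - m₀ * slope 1 2 β₁ v) (g := fun _ => 0)
    (fun v hv => (((hQ 0 v hv).const_mul m₁).sub ((hQ 1 v hv).const_mul m₀)).congr_deriv (by
      rw [(hR v hv).1, (hR v hv).2]
      ring))
    (fun v _ => hasDerivWithinAt_const v J 0)
  simp only [zero_add] at hκ
  have hβ0 : ∀ v ∈ J, m₁ * β₁ v 0 - m₀ * β₁ v 1 = κ * β₁ v 2 := by
    intro v hv
    have h0 := hq v hv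
    rw [← hκ v hv]
    unfold slope
    field_simp
  by_cases hκ0 : κ = 0
  · refine h.isListed_of_topView_linear_right (by norm_num) (n₀ := m₁) (n₁ := -m₀)
      (by rw [neg_ne_zero]; exact hm.symm) (fun v hv => ?_)
    have := hβ0 v hv
    rw [hκ0] at this
    linarith
  -- the tangents of both curves in the coordinates `m₁ x - m₀ y` and `m₀ x + m₁ y`
  have hp0 : ∀ u ∈ I, m₁ * α₁ u 0 - m₀ * α₁ u 1 ≠ 0 := by
    intro u hu h0
    apply (hrel u hu v₀ hv₀).2.1
    rw [hP u hu]
    linear_combination -topNormSq (α₁ u) * h0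
  have hxα : ∀ u ∈ I, HasDerivWithinAt (fun u => m₁ * α u 0 - m₀ * α u 1)
      (m₁ * α₁ u 0 - m₀ * α₁ u 1) I u := fun u hu =>
    ((h.jetI.coord₁ hu 0).const_mul m₁).sub ((h.jetI.coord₁ hu 1).const_mul m₀)
  have hyα : ∀ u ∈ I, HasDerivWithinAt (fun u => m₀ * α u 0 + m₁ * α u 1)
      (m₀ * α₁ u 0 + m₁ * α₁ u 1) I u := fun u hu =>
    ((h.jetI.coord₁ hu 0).const_mul m₀).add ((h.jetI.coord₁ hu 1).const_mul m₁)
  have hxβ : ∀ v ∈ J, HasDerivWithinAt (fun v => m₁ * β v 0 - m₀ * β v 1)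
      (κ * β₁ v 2) J v := fun v hv =>
    (((h.jetJ.coord₁ hv 0).const_mul m₁).sub
      ((h.jetJ.coord₁ hv 1).const_mul m₀)).congr_deriv (hβ0 v hv)
  have hyβ : ∀ v ∈ J, HasDerivWithinAt (fun v => m₀ * β v 0 + m₁ * β v 1)
      (m₀ * β₁ v 0 + m₁ * β₁ v 1) J v := fun v hv =>
    ((h.jetJ.coord₁ hv 0).const_mul m₀).add ((h.jetJ.coord₁ hv 1).const_mul m₁)
  -- the slopes, whose arctangents are affine functions of the first coordinate
  set σ : ℝ → ℝ := fun u => (m₀ * α₁ u 0 + m₁ * α₁ u 1) / (m₁ * α₁ u 0 - m₀ * α₁ u 1) with hσ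
  set τ : ℝ → ℝ := fun v => (m₀ * slope 0 2 β₁ v + m₁ * slope 1 2 β₁ v) / κ with hτ
  obtain ⟨c₁, hc₁⟩ := exists_eq_add_of_hasDerivWithinAt h.ordI
    (f := fun u => -Real.arctan (σ u)) (g := fun u => m₁ * α u 0 - m₀ * α u 1)
    (fun u hu => by
      refine (((((h.jetI.coord₂ hu 0).const_mul m₀).add ((h.jetI.coord₂ hu 1).const_mul m₁)).div
        (((h.jetI.coord₂ hu 0).const_mul m₁).sub ((h.jetI.coord₂ hu 1).const_mul m₀))
        (hp0 u hu)).arctan.neg).congr_deriv ?_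
      have h0 := hp0 u hu
      have h1 := hP u hu
      unfold topDet topNormSq at h1
      simp only [Pi.add_apply, Pi.sub_apply, Pi.div_apply]
      refine neg_arctan_deriv_eq h0 ?_
      linear_combination (m₀ ^ 2 + m₁ ^ 2) * h1)
    hxα
  obtain ⟨c₂, hc₂⟩ := exists_eq_add_of_hasDerivWithinAt h.ordJ
    (f := fun v => Real.arctan (τ v)) (g := fun v => m₁ * β v 0 - m₀ * β v 1)
    (fun v hv => by
      refine (((((hQ 0 v hv).const_mul m₀).add
        ((hQ 1 v hv).const_mul m₁)).div_const κ).arctan).congr_deriv ?_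
      have h1 := hκ v hv
      rw [(hR v hv).1, (hR v hv).2]
      have h2 : κ ^ 2 + (m₀ * slope 0 2 β₁ v + m₁ * slope 1 2 β₁ v) ^ 2 ≠ 0 := by
        have := sq_pos_of_ne_zero hκ0
        positivity
      simp only [Pi.add_apply]
      field_simp
      rw [← h1]
      ring)
    hxβ
  have hcosα : ∀ u, Real.cos (-Real.arctan (σ u)) ≠ 0 := fun u => by
    rw [Real.cos_neg]
    exact (Real.cos_arctan_pos _).ne'
  have hcosβ : ∀ v, Real.cos (Real.arctan (τ v)) ≠ 0 := fun v => (Real.cos_arctan_pos _).ne'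
  obtain ⟨d₁, hd₁⟩ := exists_eq_add_of_hasDerivWithinAt h.ordI
    (f := fun u => m₀ * α u 0 + m₁ * α u 1)
    (g := fun u => Real.log |Real.cos (-Real.arctan (σ u))|) hyα
    (fun u hu => by
      have hs := ((hxα u hu).add_const c₁).congr hc₁ (hc₁ u hu)
      refine (hasDerivWithinAt_log_abs_cos hs (hcosα u)).congr_deriv ?_
      rw [Real.tan_neg, Real.tan_arctan]
      rw [neg_neg]
      exact div_mul_cancel₀ _ (hp0 u hu))
  obtain ⟨d₂, hd₂⟩ := exists_eq_add_of_hasDerivWithinAt h.ordJ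
    (f := fun v => m₀ * β v 0 + m₁ * β v 1)
    (g := fun v => -Real.log |Real.cos (Real.arctan (τ v))|) hyβ
    (fun v hv => by
      have hs := ((hxβ v hv).add_const c₂).congr hc₂ (hc₂ v hv)
      refine (hasDerivWithinAt_log_abs_cos hs (hcosβ v)).neg.congr_deriv ?_
      rw [Real.tan_arctan]
      simp only [hτ]
      unfold slope
      have := hq v hv
      field_simp)
  obtain ⟨d₃, hd₃⟩ := exists_eq_add_of_hasDerivWithinAt h.ordJ
    (f := fun v => m₁ * β v 0 - m₀ * β v 1) (g := fun v => κ * β v 2) hxβ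
    (fun v hv => (h.jetJ.coord₁ hv 2).const_mul κ)
  obtain ⟨z₀, hz₀⟩ := exists_eq_add_of_hasDerivWithinAt h.ordI (f := fun u => α u 2)
    (g := fun _ => 0) (fun u hu => (h.jetI.coord₁ hu 2).congr_deriv (hα u hu))
    (fun u _ => hasDerivWithinAt_const u I 0)
  constructor
  · refine Or.inr (Or.inr ⟨rfl, _, isSimilarity_simLin (h₁ := m₁) (h₂ := m₀) (c₃ := -κ) hm.symm
      m₁ (-m₀) (neg_ne_zero.2 hκ0) ![c₁ + c₂, -d₁ - d₂, c₁ - d₃ + κ * z₀], ?_⟩)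
    rintro _ ⟨_, ⟨⟨u, v⟩, ⟨hu, hv⟩, rfl⟩, rfl⟩
    have e1 := hc₁ u hu
    have e2 := hc₂ v hv
    have e3 := hd₁ u hu
    have e4 := hd₂ v hv
    have e5 := hd₃ v hv
    have e6 := hz₀ u hu
    refine ⟨(-Real.arctan (σ u), Real.arctan (τ v)), ⟨⟨?_, ?_⟩, Real.arctan_mem_Ioo _, ?_⟩, ?_⟩
    · linarith [Real.arctan_lt_pi_div_two (σ u)]
    · linarith [Real.neg_pi_div_two_lt_arctan (σ u)]
    · -- equal slopes would make the tangents parallel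
      intro h0
      have h1 : σ u = τ v := Real.arctan_injective (by simp only at h0; linarith)
      have h2 := (hrel u hu v hv).2.2.1
      apply mul_ne_zero hn h2
      simp only [hσ, hτ] at h1
      rw [div_eq_div_iff (hp0 u hu) hκ0, ← hκ v hv] at h1
      linear_combination -h1
    · apply ext_fin_three
      · simp only [Pi.add_apply, simLin_zero, translational]
        simp
        linear_combination e1 + e2
      · simp only [Pi.add_apply, simLin_one, translational]
        simp only [Matrix.cons_val_one, Matrix.cons_val_zero]
        linear_combination -e3 - e4
      · simp only [Pi.add_apply, simLin_two, translational]
        simp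
        linear_combination e1 - e5 + κ * e6
  · refine ⟨![m₁, -m₀, -κ], d₃, fun h0 => hκ0 (by simpa using congrFun h0 2), fun v hv => ?_⟩
    have := hd₃ v hv
    simp
    linarith

/-- The classification of the surfaces formed by a planar curve `α` and a curve `β`. -/
theorem RatioPair.isListed (h : RatioPair a I J α α₁ α₂ β β₁ β₂) (ha : a ≠ 0)
    (hα : IsPlanarOn α I) : IsListed a (translational α β '' (I ×ˢ J)) ∧ IsPlanarOn β J := by
  obtain ⟨n, d, hn, hd⟩ := hα
  have hn1 : ∀ u ∈ I, n 0 * α₁ u 0 + n 1 * α₁ u 1 + n 2 * α₁ u 2 = 0 := fun u hu =>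
    (h.uniqI u hu).eq_deriv _ ((((h.jetI.coord₁ hu 0).const_mul (n 0)).add
      ((h.jetI.coord₁ hu 1).const_mul (n 1))).add ((h.jetI.coord₁ hu 2).const_mul (n 2)))
      ((hasDerivWithinAt_const u I d).congr hd (hd u hu))
  by_cases h2 : n 2 = 0
  · refine h.isListed_of_topView_linear ha (n₀ := n 0) (n₁ := n 1) ?_ (fun u hu => ?_)
    · by_contra! h0
      exact hn (ext_fin_three h0.1 h0.2 h2)
    · simpa [h2] using hn1 u hu
  · have h10 : (1 : ℝ) ≠ 0 ∨ (0 : ℝ) ≠ 0 := Or.inl one_ne_zero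
    -- the shear `z ↦ n₀ x + n₁ y + n₂ z` makes the plane horizontal
    have hs := h.simLin h10 (n 0) (n 1) h2 0
    have hflat : ∀ u ∈ I,
        IsotropicGeometry.simLin 1 0 (n 0) (n 1) (n 2) (α₁ u) 2 = 0 := fun u hu => by
      rw [simLin_two]
      exact hn1 u hu
    have key : IsListed a ((fun p => IsotropicGeometry.simLin 1 0 (n 0) (n 1) (n 2) p + 0) ''
        (translational α β '' (I ×ˢ J))) ∧
        IsPlanarOn (fun v => IsotropicGeometry.simLin 1 0 (n 0) (n 1) (n 2) (β v)) J := by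
      rw [← image_translational_simLin]
      by_cases ha1 : a + 1 = 0
      · obtain rfl : a = -1 := by linarith
        exact hs.isListed_of_horizontal_neg_one hflat
      · exact hs.isListed_of_horizontal ha ha1 hflat
    exact ⟨key.1.of_image (isSimilarity_simLin h10 _ _ h2 0), key.2.of_simLin h10 h2⟩

theorem hasConstantRatio_of_isListed (ha : a ≠ 0) {r : ℝ × ℝ → Fin 3 → ℝ} {D : Set (ℝ × ℝ)}
    (hr : ContinuousOn r D) (h : IsListed a (r '' D)) : HasConstantRatio r D a := by
  rcases h with h | ⟨ha1, V, hV, h⟩ | ⟨rfl, h⟩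
  · exact (isGraphWithRatio_paraboloid ha).hasConstantRatio ha hr h
  · exact (isGraphWithRatio_expSurface ha ha1 hV).hasConstantRatio ha hr h
  · exact isGraphWithRatio_logCosSurface.hasConstantRatio ha hr h

end IsotropicGeometry

theorem mainTheorem1 (I J : Set ℝ) (hI : I.OrdConnected) (hJ : J.OrdConnected)
    (hI' : (interior I).Nonempty) (hJ' : (interior J).Nonempty)
    (α β : ℝ → Fin 3 → ℝ) (hα : ContDiffOn ℝ 3 α I) (hβ : ContDiffOn ℝ 3 β J)
    (hplanar : Coplanar ℝ (α '' I))
    (hadm : IsotropicGeometry.IsAdmissible (IsotropicGeometry.translational α β) (I ×ˢ J))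
    (a : ℝ) (ha : a ≠ 0) :
    (IsotropicGeometry.HasConstantRatio (IsotropicGeometry.translational α β) (I ×ˢ J) a ↔
      (IsotropicGeometry.SimilarToSubset (IsotropicGeometry.translational α β '' (I ×ˢ J))
          (IsotropicGeometry.paraboloid a) ∨
        (a ≠ 1 ∧ ∃ V : Set ℝ,
          IsotropicGeometry.IsParameterInterval a ((a + 1) / (a - 1)) V ∧
          IsotropicGeometry.SimilarToSubset (IsotropicGeometry.translational α β '' (I ×ˢ J))
            (IsotropicGeometry.expSurface ((a + 1) / (a - 1)) V)) ∨
        (a = -1 ∧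
          IsotropicGeometry.SimilarToSubset (IsotropicGeometry.translational α β '' (I ×ˢ J))
            IsotropicGeometry.logCosSurface))) ∧
    (IsotropicGeometry.HasConstantRatio (IsotropicGeometry.translational α β) (I ×ˢ J) a →
      Coplanar ℝ (β '' J)) := by
  have hIu := IsotropicGeometry.uniqueDiffOn_of_interior_nonempty hI hI'
  have hJu := IsotropicGeometry.uniqueDiffOn_of_interior_nonempty hJ hJ'
  have jα := IsotropicGeometry.hasSecondJet_of_contDiffOn hIu hα
  have jβ := IsotropicGeometry.hasSecondJet_of_contDiffOn hJu hβ
  have hpair : IsotropicGeometry.HasConstantRatio (IsotropicGeometry.translational α β)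
      (I ×ˢ J) a → IsotropicGeometry.IsListed a
        (IsotropicGeometry.translational α β '' (I ×ˢ J)) ∧ IsotropicGeometry.IsPlanarOn β J := by
    intro hratio
    refine IsotropicGeometry.RatioPair.isListed ⟨hI, hJ, hI', hJ', jα, jβ, fun u hu v hv => ?_⟩ ha
      (IsotropicGeometry.isPlanarOn_of_coplanar hplanar)
    obtain ⟨κ₁, κ₂, hκ, hκ'⟩ := hratio (u, v) ⟨hu, hv⟩
    exact IsotropicGeometry.ratioAt_of_hasPrincipalCurvaturesAt hIu hJu jα jβ hu hv
      (IsotropicGeometry.topDet_ne_zero_of_isAdmissible hIu hJu hu hv (jα.deriv₁ u hu)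
        (jβ.deriv₁ v hv) hadm) ha hκ hκ'
  refine ⟨⟨fun h => (hpair h).1, fun h => ?_⟩, fun h => (hpair h).2.coplanar⟩
  refine IsotropicGeometry.hasConstantRatio_of_isListed ha (fun w hw => ?_) h
  exact (IsotropicGeometry.hasFDerivWithinAt_translational (w := w) (jα.deriv₁ w.1 hw.1)
    (jβ.deriv₁ w.2 hw.2)).continuousWithinAt
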